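/- Let $p,q\in(0,1/2)$ and let $X_1,X_2,Y$ be binary random variables with $X_2\sim\mathrm{Bern}(1/2)$, $X_1=X_2\oplus Z$ with $Z\sim\mathrm{Bern}(q)$ independent of $X_2$, and $Y=X_1\oplus W$ with $W\sim\mathrm{Bern}(p)$ independent of $(X_1,X_2)$. Let $(X_1^n,X_2^n,Y^n)$ be $n$ i.i.d. copies of $(X_1,X_2,Y)$; all logarithms are to base 2. A pair $(R,\mu)$ of nonnegative reals is achievable if for every $\varepsilon>0$ there is $n_0$ such that for every $n>n_0$ there are a message set $\mathcal J=\{1,\dots,M\}$ and an encoder $\phi:\{0,1\}^n\to\mathcal J$ with $\frac1n\log_2 M\le R+\varepsilon$ and $\frac1n I\bigl(Y^n;\phi(X_1^n),X_2^n\bigr)\ge\mu-\varepsilon$. Let $\mu^{D}(R)=\sup\{\mu:(R,\mu)\text{ is achievable}\}$ be the relevance-rate function with side information $X_2$ at the decoder only. Write $h_2$ for the binary entropy function, $a\ast b=a(1-b)+b(1-a)$, and for $r\in[0,1]$ $$g(r)=h_2(r\ast q)-h_2(r),$$ $$f(r)=h_2(r\ast q)-(1-p\ast q)\,h_2\Bigl(r\ast\tfrac{pq}{1-p\ast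 q}\Bigr)-(p\ast q)\,h_2\Bigl(r\ast\tfrac{p(1-q)}{p\ast q}\Bigr).$$ Let $g^{-1}:[0,h_2(q)]\to[0,1/2]$ be the inverse of the restriction of $g$ to $[0,1/2]$. Then the tangency equation $$\frac{f'(g^{-1}(T))}{g'(g^{-1}(T))}=\frac{f(g^{-1}(T))}{T},\qquad T\in(0,h_2(q)),$$ has at most one solution, and it has one if and only if $(1-2q)^2\bigl((1-2q)^2+3\bigr)(1-2p)^2<5(1-2q)^2-1$. Let $R_c$ be this solution if it exists and $R_c=0$ otherwise. Then for every $R\ge0$ $$\mu^{D}(R)=\begin{cases}1-h_2(p\ast q)+\dfrac{f(g^{-1}(R_c))}{R_c}\,R, & 0\le R\le R_c,\\[2mm] 1-h_2(p\ast q)+f(g^{-1}(R)), & R_c<R\le h_2(q),\\[1mm] 1-h_2(p), & R>h_2(q),\end{cases}$$ where for $R_c=0$ the first line is only used at $R=0$ and reads $\mu^{D}(0)=1-h_2(p\ast q)$. -/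

import Mathlib

open MeasureTheory ProbabilityTheory

namespace InfoBottleneck

noncomputable section

/-! Information measures on finite alphabets; all logarithms are to base 2. -/

/-- Entropy in bits of a probability mass function on a finite alphabet. -/
def entropy {α : Type*} [Fintype α] (p : α → ℝ) : ℝ :=
  ∑ a, Real.negMulLog (p a) / Real.log 2

/-- The law of `φ` when the underlying outcome has probability mass function `p`. -/
def lawOf {α β : Type*} [Fintype α] [DecidableEq β] (p : α → ℝ) (φ : α → β) : β → ℝ :=
  fun b => ∑ a, if φ a = b then p a else 0

/-- Mutual information `I(φ; ψ) = H(φ) + H(ψ) - H(φ, ψ)` in bits of two random variables on a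
finite space with probability mass function `p`. -/
def mutualInfo {α β γ : Type*} [Fintype α] [Fintype β] [Fintype γ] [DecidableEq β] [DecidableEq γ]
    (p : α → ℝ) (φ : α → β) (ψ : α → γ) : ℝ :=
  entropy (lawOf p φ) + entropy (lawOf p ψ) - entropy (lawOf p fun a => (φ a, ψ a))

/-- The law of `n` i.i.d. copies of a random variable with probability mass function `P`. -/
def iidLaw {α : Type*} (P : α → ℝ) (n : ℕ) : (Fin n → α) → ℝ :=
  fun s => ∏ i, P (s i)

/-! The source-coding problem: one half-round, with side information at the decoder only. -/

section Coding

variable {A B C : Type*} [Fintype A] [Fintype B] [Fintype C]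
  [DecidableEq B] [DecidableEq C]

/-- The information `I(Y^n; J, X₂^n)` about the hidden sequence `Y^n` that is available to a decoder
which observes the side information `X₂^n` and receives the description `J = enc (X₁^n)`, when
`(X₁, X₂, Y)` has law `P`. -/
def relevance (P : A × B × C → ℝ) (n : ℕ) {M : ℕ} (enc : (Fin n → A) → Fin M) : ℝ :=
  mutualInfo (iidLaw P n)
    (fun (s : Fin n → A × B × C) (i : Fin n) => (s i).2.2)
    (fun s => (enc fun i => (s i).1, fun i => (s i).2.1))

/-- `(R, m)` is achievable if for every `ε > 0` and all large enough `n` there is an encoder of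
`X₁^n` of rate at most `R + ε` whose normalized relevance is at least `m - ε`. -/
def Achievable (P : A × B × C → ℝ) (R m : ℝ) : Prop :=
  0 ≤ R ∧ 0 ≤ m ∧
    ∀ ε : ℝ, 0 < ε → ∃ n₀ : ℕ, ∀ n : ℕ, n₀ < n →
      ∃ (M : ℕ) (enc : (Fin n → A) → Fin M),
        1 / (n : ℝ) * Real.logb 2 M ≤ R + ε ∧
        m - ε ≤ 1 / (n : ℝ) * relevance P n enc

/-- The complexity-relevance region: the set of achievable pairs. -/
def region (P : A × B × C → ℝ) : Set (ℝ × ℝ) :=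
  {x | Achievable P x.1 x.2}

end Coding

/-- Joint probability mass function of three binary random variables. -/
def jointLaw {Ω : Type*} [MeasurableSpace Ω] (μ : Measure Ω) (X₁ X₂ Y : Ω → Bool) :
    Bool × Bool × Bool → ℝ :=
  fun t => μ.real {ω | (X₁ ω, X₂ ω, Y ω) = t}

/-! The functions in which the answer is expressed. -/

/-- Binary entropy in bits. -/
def h₂ (x : ℝ) : ℝ := Real.binEntropy x / Real.log 2

/-- Binary convolution `a ∗ b = a (1 - b) + b (1 - a)`. -/
def bconv (a b : ℝ) : ℝ := a * (1 - b) + b * (1 - a)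

/-- `g r = h₂ (r ∗ q) - h₂ r`. -/
def g (q r : ℝ) : ℝ := h₂ (bconv r q) - h₂ r

/-- `f r = h₂ (r ∗ q) - (1 - p ∗ q) h₂ (r ∗ (p q / (1 - p ∗ q)))
- (p ∗ q) h₂ (r ∗ (p (1 - q) / (p ∗ q)))`. -/
def f (p q r : ℝ) : ℝ :=
  h₂ (bconv r q)
    - (1 - bconv p q) * h₂ (bconv r (p * q / (1 - bconv p q)))
    - bconv p q * h₂ (bconv r (p * (1 - q) / bconv p q))

/-- The inverse of the decreasing bijection `g : [0, 1/2] → [0, h₂ q]`. -/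
def gInv (q R : ℝ) : ℝ := Function.invFunOn (g q) (Set.Icc 0 (1 / 2)) R

/-- The tangency condition `f'(g⁻¹ R) / g'(g⁻¹ R) = f (g⁻¹ R) / R`. -/
def Tangency (p q R : ℝ) : Prop :=
  deriv (f p q) (gInv q R) / deriv (g q) (gInv q R) = f p q (gInv q R) / R

end

end InfoBottleneck

/-!
The relevance-rate function is the concave envelope `U` of the curve `r ↦ (g r, f r)`, shifted by `1
- h₂ (p ∗ q)`. The proof has an analytic half, which computes `U`, and a coding half, which
identifies it with the operational quantity.

**Analysis.** In the bias `x = 1 - 2 r` the functions `f` and `g` become, up to the factor `log 2`,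
combinations `Φ`, `G` of the functions `x ↦ ψ (m x)`, where `ψ x = log 2 - H((1 - x) / 2)` has
second derivative `1 / (1 - x ^ 2)`. The second derivatives of `Φ` and `G` are therefore rational,
and the derivative of their ratio is `2 x u x` where `u` (`curveU`) has a single sign change, from
positive to negative (`curveU_neg`). The sign change survives two integrations
(`SingleCrossing.integral`): along the curve the slope `Φ' / G'` first increases, if at all, and
then decreases, and `(Φ' / G') G - Φ`, whose zeros are the solutions of the tangency equation, is
first positive, if at all, and then negative. Either there is exactly one tangent through the
origin, or the curve is strictly concave throughout; the former holds if and only if `u 0 > 0`,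
which is the polynomial condition on `p`, `q` (`exists_curveU_pos_iff`). Beyond the tangency point
every tangent supports the whole curve (`RatioData.le_tangent`, `RatioData.le_support`). So at each
rate `R` there are a supporting line of slope `l ≥ 0` and a point of the curve which, time-shared
with the origin, attains the value `U R` (`exists_criticalRate`).

**Converse.** A supporting line of slope `l` is the inequality `- H(Y | X₂) ≤ τ + l (H(X₂) - H(X₁))`
for all laws of the input `X₁` of the channel `X₁ ↦ (X₂, Y)`, which is `Dominated`. Both sides are
homogeneous in the law, and the conditional entropy functional `condFn` is superadditive, so the
inequality tensorizes (`Dominated.tensor`). Applied to the `n`-fold channel and the law of `X₁ⁿ`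
given the description, and summed over the descriptions, it bounds the relevance by a linear
function of the rate (`relevance_le`).

**Achievability.** A greedy covering of the Hamming cube gives a quantizer of distortion `r` and
rate `1 - h₂ r` (`exists_quantizer`). The error of the reproduction of each letter is a Bernoulli
variable, and as `h₂` is concave and `f` convex, the description has entropy about `g r` per letter
given the side information and a relevance gain of `f r` (`condEnt_quantizer_le`,
`condEnt_Y_quantizer_le`). Random binning of many blocks (`exists_block_binning`) brings the rate
down to that conditional entropy; ignoring a fixed fraction of the letters is the time sharing
(`achievable_of_curve`).
-/

open MeasureTheory ProbabilityTheory

namespace InfoBottleneck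

set_option linter.unusedSectionVars false

/-! ### Entropy and conditional entropy of finite measures -/

/-- The function `η x = - x log₂ x` whose sum over the atoms is the entropy. -/
noncomputable def eta (x : ℝ) : ℝ := Real.negMulLog x / Real.log 2

lemma log_two_pos : 0 < Real.log 2 := Real.log_pos one_lt_two

lemma entropy_eq_sum_eta {α : Type*} [Fintype α] (m : α → ℝ) : entropy m = ∑ a, eta (m a) := rfl

@[simp] lemma eta_zero : eta 0 = 0 := by simp [eta]

lemma eta_mul (x y : ℝ) : eta (x * y) = y * eta x + x * eta y := by
  unfold eta; rw [Real.negMulLog_mul]; ring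

lemma eta_eq (x : ℝ) : eta x = - (x * Real.logb 2 x) := by
  unfold eta Real.negMulLog Real.logb; ring

/-- The conditional entropy functional of a finite measure `m`, not necessarily normalized: the
total mass of `m` times the entropy of its normalization. -/
noncomputable def condFn {β : Type*} [Fintype β] (m : β → ℝ) : ℝ := entropy m - eta (∑ b, m b)

section CondFn

variable {β : Type*} [Fintype β]

lemma condFn_smul (c : ℝ) (m : β → ℝ) : condFn (fun b => c * m b) = c * condFn m := by
  unfold condFn
  simp only [entropy_eq_sum_eta, eta_mul, Finset.sum_add_distrib, ← Finset.mul_sum,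
    ← Finset.sum_mul]
  ring

@[simp] lemma condFn_zero : condFn (fun _ : β => (0 : ℝ)) = 0 := by
  simp [condFn, entropy_eq_sum_eta]

lemma concaveOn_eta : ConcaveOn ℝ (Set.Ici 0) eta := by
  have h := Real.concaveOn_negMulLog.smul (inv_nonneg.2 log_two_pos.le)
  refine h.congr fun x _ => ?_
  simp [eta, div_eq_inv_mul]

/-- Termwise form of the log-sum inequality. -/
lemma eta_add_ge {a b S S' : ℝ} (ha : 0 ≤ a) (hb : 0 ≤ b) (haS : a ≤ S) (hbS : b ≤ S') :
    eta a + eta b - (a / S) * eta S - (b / S') * eta S'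
      ≤ eta (a + b) - (a + b) / (S + S') * eta (S + S') := by
  rcases (ha.trans haS).eq_or_lt with h | hS
  · have : a = 0 := le_antisymm (h ▸ haS) ha
    subst this; rw [← h]; simp
  rcases (hb.trans hbS).eq_or_lt with h | hS'
  · have : b = 0 := le_antisymm (h ▸ hbS) hb
    subst this; rw [← h]; simp
  have key : ∀ x T : ℝ, 0 < T → eta x - (x / T) * eta T = T * eta (x / T) := by
    intro x T hT
    have := eta_mul (x / T) T
    rw [div_mul_cancel₀ _ hT.ne'] at this
    linarith
  have hT : 0 < S + S' := by positivity
  have h1 := key a S hS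
  have h2 := key b S' hS'
  have h3 := key (a + b) (S + S') hT
  have hc := concaveOn_eta.2 (show a / S ∈ Set.Ici 0 from div_nonneg ha hS.le)
    (show b / S' ∈ Set.Ici 0 from div_nonneg hb hS'.le)
    (show 0 ≤ S / (S + S') by positivity) (show 0 ≤ S' / (S + S') by positivity) (by field_simp)
  have e : (S / (S + S')) • (a / S) + (S' / (S + S')) • (b / S') = (a + b) / (S + S') := by
    simp only [smul_eq_mul]; field_simp
  rw [e] at hc
  simp only [smul_eq_mul] at hc
  have := mul_le_mul_of_nonneg_left hc hT.le
  have e2 : (S + S') * (S / (S + S') * eta (a / S) + S' / (S + S') * eta (b / S'))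
      = S * eta (a / S) + S' * eta (b / S') := by field_simp
  linarith

/-- Superadditivity of the conditional entropy functional, the log-sum inequality. Together with
homogeneity it says that conditioning reduces entropy. -/
lemma condFn_add_le {m m' : β → ℝ} (hm : ∀ b, 0 ≤ m b) (hm' : ∀ b, 0 ≤ m' b) :
    condFn m + condFn m' ≤ condFn (fun b => m b + m' b) := by
  have hz : ∀ (u : β → ℝ), (∀ b, 0 ≤ u b) → ∑ b, u b / (∑ b, u b) * eta (∑ b, u b)
      = eta (∑ b, u b) := by
    intro u hu
    rw [← Finset.sum_mul, ← Finset.sum_div]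
    by_cases h : ∑ b, u b = 0
    · simp [h]
    · rw [div_self h, one_mul]
  have h1 := hz m hm
  have h2 := hz m' hm'
  have h3 := hz (fun b => m b + m' b) (fun b => add_nonneg (hm b) (hm' b))
  simp only [Finset.sum_add_distrib] at h3
  have := Finset.sum_le_sum fun b (_ : b ∈ Finset.univ) =>
    eta_add_ge (hm b) (hm' b) (Finset.single_le_sum (fun i _ => hm i) (Finset.mem_univ b))
      (Finset.single_le_sum (fun i _ => hm' i) (Finset.mem_univ b))
  simp only [Finset.sum_sub_distrib, Finset.sum_add_distrib] at this
  unfold condFn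
  simp only [entropy_eq_sum_eta, Finset.sum_add_distrib]
  linarith

lemma condFn_sum_le {σ : Type*} (s : Finset σ) (m : σ → β → ℝ) (hm : ∀ i b, 0 ≤ m i b) :
    ∑ i ∈ s, condFn (m i) ≤ condFn (fun b => ∑ i ∈ s, m i b) := by
  classical
  induction s using Finset.induction_on with
  | empty => simp
  | insert i s hi ih =>
    simp only [Finset.sum_insert hi]
    exact (add_le_add le_rfl ih).trans
      (condFn_add_le (hm i) fun b => Finset.sum_nonneg fun j _ => hm j b)

lemma condFn_mix_le {σ : Type*} (s : Finset σ) (k : σ → ℝ) (m : σ → β → ℝ) (hk : ∀ i, 0 ≤ k i)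
    (hm : ∀ i b, 0 ≤ m i b) :
    ∑ i ∈ s, k i * condFn (m i) ≤ condFn (fun b => ∑ i ∈ s, k i * m i b) := by
  simpa only [condFn_smul] using
    condFn_sum_le s (fun i b => k i * m i b) fun i b => mul_nonneg (hk i) (hm i b)

/-- The functional as the mean of the logarithm of the inverse conditional probabilities. -/
lemma condFn_eq_sum (m : β → ℝ) (hm : ∀ b, 0 ≤ m b) :
    condFn m = ∑ b, (m b * Real.logb 2 ((∑ b, m b) / m b)) := by
  have : eta (∑ b, m b) = ∑ b, - (m b * Real.logb 2 (∑ b, m b)) := by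
    rw [eta_eq, Finset.sum_mul, Finset.sum_neg_distrib]
  rw [condFn, entropy_eq_sum_eta, this, ← Finset.sum_sub_distrib]
  refine Finset.sum_congr rfl fun b _ => ?_
  rcases (hm b).eq_or_lt with h | h
  · simp [← h]
  have hS : 0 < ∑ b, m b := h.trans_le (Finset.single_le_sum (fun i _ => hm i) (Finset.mem_univ b))
  rw [Real.logb_div hS.ne' h.ne', eta_eq]; ring

lemma condFn_nonneg {m : β → ℝ} (hm : ∀ b, 0 ≤ m b) : 0 ≤ condFn m := by
  rw [condFn_eq_sum m hm]
  refine Finset.sum_nonneg fun b _ => mul_nonneg (hm b) ?_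
  rcases (hm b).eq_or_lt with h | h
  · simp [← h]
  refine Real.logb_nonneg one_lt_two ?_
  rw [one_le_div h]
  exact Finset.single_le_sum (fun i _ => hm i) (Finset.mem_univ b)

/-- The entropy of a normalized law is at most the logarithm of the size of the alphabet. -/
lemma condFn_le {m : β → ℝ} (hm : ∀ b, 0 ≤ m b) :
    condFn m ≤ (∑ b, m b) * Real.logb 2 (Fintype.card β) := by
  -- Jensen's inequality for `η` with uniform weights on the atoms
  rcases isEmpty_or_nonempty β with h | h
  · simp [condFn, entropy_eq_sum_eta]
  have hcard : (0 : ℝ) < Fintype.card β := by exact_mod_cast Fintype.card_pos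
  have hj := concaveOn_eta.le_map_sum (t := Finset.univ)
      (w := fun _ : β => 1 / (Fintype.card β : ℝ))
    (p := m) (fun _ _ => by positivity) (by simp [hcard.ne']) (fun b _ => hm b)
  simp only [smul_eq_mul, ← Finset.mul_sum] at hj
  rw [eta_mul] at hj
  have e : eta (1 / (Fintype.card β : ℝ)) = 1 / (Fintype.card β : ℝ)
      * Real.logb 2 (Fintype.card β) := by
    rw [eta_eq, one_div, Real.logb_inv]; ring
  rw [e] at hj
  have := mul_le_mul_of_nonneg_left hj hcard.le
  rw [condFn, entropy_eq_sum_eta]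
  field_simp at this
  linarith

end CondFn

section RandomVariables

variable {Ω α β γ δ : Type*} [Fintype Ω] [Fintype α] [Fintype β] [Fintype γ] [Fintype δ]
  [DecidableEq α] [DecidableEq β] [DecidableEq γ] [DecidableEq δ] {p : Ω → ℝ}

lemma lawOf_nonneg (hp : ∀ ω, 0 ≤ p ω) (φ : Ω → β) (b : β) : 0 ≤ lawOf p φ b :=
  Finset.sum_nonneg fun a _ => by split_ifs <;> simp [hp]

lemma sum_lawOf_mul (φ : Ω → β) (F : β → ℝ) : ∑ b, lawOf p φ b * F b = ∑ ω, p ω * F (φ ω) := by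
  unfold lawOf
  simp only [Finset.sum_mul, ite_mul, zero_mul]
  rw [Finset.sum_comm]
  simp

lemma sum_lawOf (φ : Ω → β) : ∑ b, lawOf p φ b = ∑ ω, p ω := by
  simpa using sum_lawOf_mul (p := p) φ fun _ => 1

lemma lawOf_lawOf (φ : Ω → β) (ψ : β → γ) : lawOf (lawOf p φ) ψ = lawOf p fun ω => ψ (φ ω) := by
  funext c
  have := sum_lawOf_mul (p := p) φ fun b => if ψ b = c then 1 else 0
  simpa [lawOf] using this

lemma lawOf_snd_eq_sum (φ : Ω → β) (ψ : Ω → γ) (c : γ) :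
    lawOf p ψ c = ∑ b, lawOf p (fun ω => (φ ω, ψ ω)) (b, c) := by
  unfold lawOf
  rw [Finset.sum_comm]
  refine Finset.sum_congr rfl fun ω _ => ?_
  by_cases h : ψ ω = c <;> simp [h]

/-- Entropy in bits of a random variable `φ` on a finite measure space `(Ω, p)`. -/
noncomputable def ent (p : Ω → ℝ) (φ : Ω → β) : ℝ := entropy (lawOf p φ)

/-- Conditional entropy `H(φ | ψ) = H(φ, ψ) - H(ψ)` in bits. -/
noncomputable def condEnt (p : Ω → ℝ) (φ : Ω → β) (ψ : Ω → γ) : ℝ :=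
  ent p (fun ω => (φ ω, ψ ω)) - ent p ψ

lemma ent_comp (φ : Ω → β) (ψ : β → γ) : ent p (fun ω => ψ (φ ω)) = ent (lawOf p φ) ψ := by
  rw [ent, ent, lawOf_lawOf]

lemma condEnt_comp (φ : Ω → α) (ψ : α → β) (χ : α → γ) :
    condEnt p (fun ω => ψ (φ ω)) (fun ω => χ (φ ω)) = condEnt (lawOf p φ) ψ χ := by
  rw [condEnt, condEnt, ← ent_comp, ← ent_comp]

lemma condEnt_eq_sum (φ : Ω → β) (ψ : Ω → γ) :
    condEnt p φ ψ = ∑ c, condFn fun b => lawOf p (fun ω => (φ ω, ψ ω)) (b, c) := by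
  unfold condEnt ent condFn
  simp only [entropy_eq_sum_eta, Finset.sum_sub_distrib]
  rw [Fintype.sum_prod_type_right]
  simp only [← lawOf_snd_eq_sum φ ψ]

lemma entropy_lawOf_of_injective {e : β → γ} (he : Function.Injective e) (m : β → ℝ) :
    entropy (lawOf m e) = entropy m := by
  have h : ∀ c, lawOf m e c = ∑ b, if e b = c then m b else 0 := fun c => rfl
  have h1 : ∀ b, lawOf m e (e b) = m b := by
    intro b
    rw [h]
    simp [he.eq_iff]
  rw [entropy_eq_sum_eta, entropy_eq_sum_eta]
  have : ∑ b, eta (m b) = ∑ c ∈ Finset.univ.map ⟨e, he⟩, eta (lawOf m e c) := by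
    simp [h1]
  rw [this]
  symm
  refine Finset.sum_subset (Finset.subset_univ _) fun c _ hc => ?_
  have : lawOf m e c = 0 := by
    rw [h]
    refine Finset.sum_eq_zero fun b _ => if_neg fun hb => hc ?_
    simp only [Finset.mem_map, Finset.mem_univ, true_and, Function.Embedding.coeFn_mk]
    exact ⟨b, hb⟩
  simp [this]

lemma ent_of_injective (φ : Ω → β) {e : β → γ} (he : Function.Injective e) :
    ent p (fun ω => e (φ ω)) = ent p φ := by
  rw [ent, ent, ← lawOf_lawOf, entropy_lawOf_of_injective he]

lemma condEnt_nonneg (hp : ∀ ω, 0 ≤ p ω) (φ : Ω → β) (ψ : Ω → γ) : 0 ≤ condEnt p φ ψ := by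
  rw [condEnt_eq_sum]
  exact Finset.sum_nonneg fun c _ => condFn_nonneg fun b => lawOf_nonneg hp _ _

/-- Conditioning on more reduces entropy. -/
lemma condEnt_le_condEnt_comp (hp : ∀ ω, 0 ≤ p ω) (φ : Ω → β) (ψ : Ω → γ) (χ : γ → δ) :
    condEnt p φ ψ ≤ condEnt p φ fun ω => χ (ψ ω) := by
  rw [condEnt_eq_sum, condEnt_eq_sum]
  have h : ∀ d b, lawOf p (fun ω => (φ ω, χ (ψ ω))) (b, d)
      = ∑ c with χ c = d, lawOf p (fun ω => (φ ω, ψ ω)) (b, c) := by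
    intro d b
    unfold lawOf
    rw [Finset.sum_comm]
    refine Finset.sum_congr rfl fun ω _ => ?_
    by_cases hb : φ ω = b
    · simp [hb, Finset.sum_ite_eq]
    · simp [hb]
  simp only [h]
  rw [← Finset.sum_fiberwise Finset.univ χ]
  exact Finset.sum_le_sum fun d _ => condFn_sum_le _ _ fun i b => lawOf_nonneg hp _ _

lemma ent_comp_le (hp : ∀ ω, 0 ≤ p ω) (φ : Ω → β) (χ : β → γ) :
    ent p (fun ω => χ (φ ω)) ≤ ent p φ := by
  have h := condEnt_nonneg hp φ fun ω => χ (φ ω)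
  have : ent p (fun ω => (φ ω, χ (φ ω))) = ent p φ :=
    ent_of_injective φ (e := fun b => (b, χ b)) fun a b h => (Prod.ext_iff.1 h).1
  rw [condEnt, this] at h
  linarith

lemma condEnt_comp_le (hp : ∀ ω, 0 ≤ p ω) (φ : Ω → β) (χ : β → δ) (ψ : Ω → γ) :
    condEnt p (fun ω => χ (φ ω)) ψ ≤ condEnt p φ ψ :=
  sub_le_sub_right (ent_comp_le hp (fun ω => (φ ω, ψ ω)) fun x => (χ x.1, x.2)) _

/-- Chain rule. -/
lemma condEnt_prod (φ : Ω → α) (φ' : Ω → β) (ψ : Ω → γ) :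
    condEnt p (fun ω => (φ ω, φ' ω)) ψ
      = condEnt p φ ψ + condEnt p φ' (fun ω => (φ ω, ψ ω)) := by
  have : ent p (fun ω => (φ' ω, (φ ω, ψ ω))) = ent p (fun ω => ((φ ω, φ' ω), ψ ω)) :=
    ent_of_injective (fun ω => ((φ ω, φ' ω), ψ ω))
      (e := fun x : (α × β) × γ => (x.1.2, (x.1.1, x.2)))
          (by rintro ⟨⟨_, _⟩, _⟩ ⟨⟨_, _⟩, _⟩; simp; tauto)
  unfold condEnt
  rw [this]; ring

lemma condEnt_prod_le (hp : ∀ ω, 0 ≤ p ω) (φ : Ω → α) (φ' : Ω → β) (ψ : Ω → γ) :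
    condEnt p (fun ω => (φ ω, φ' ω)) ψ ≤ condEnt p φ ψ + condEnt p φ' ψ := by
  rw [condEnt_prod]
  exact add_le_add le_rfl (condEnt_le_condEnt_comp hp φ' _ Prod.snd)

lemma condEnt_pi_le (hp : ∀ ω, 0 ≤ p ω) (ψ : Ω → γ) : ∀ {n : ℕ} (φ : Fin n → Ω → β),
    condEnt p (fun ω i => φ i ω) ψ ≤ ∑ i, condEnt p (φ i) ψ := by
  intro n
  induction n with
  | zero =>
    intro φ
    have : ent p (fun ω => ((fun i => φ i ω : Fin 0 → β), ψ ω)) = ent p ψ := by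
      rw [← ent_of_injective (p := p) ψ (e := fun c => ((Fin.elim0 : Fin 0 → β), c))
        fun a b h => (Prod.ext_iff.1 h).2]
      congr 1
      funext ω
      exact Prod.ext (Subsingleton.elim _ _) rfl
    simp [condEnt, this]
  | succ n ih =>
    intro φ
    rw [Fin.sum_univ_succ]
    refine le_trans ?_ (add_le_add le_rfl (ih fun i => φ i.succ))
    refine le_trans ?_ (condEnt_prod_le hp (φ 0) (fun ω i => φ (Fin.succ i) ω) ψ)
    have := condEnt_comp_le hp (fun ω => (φ 0 ω, fun i => φ (Fin.succ i) ω))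
      (fun x : β × (Fin n → β) => (Fin.cons x.1 x.2 : Fin (n + 1) → β)) ψ
    refine le_trans (le_of_eq ?_) this
    congr 1
    funext ω i
    refine Fin.cases ?_ (fun j => ?_) i <;> simp

lemma ent_eq_condEnt (hp1 : ∑ ω, p ω = 1) (φ : Ω → β) : condEnt p φ (fun _ => ()) = ent p φ := by
  have h0 : ent p (fun _ : Ω => ()) = 0 := by
    simp [ent, entropy_eq_sum_eta, lawOf, hp1, eta]
  have := ent_of_injective (p := p) φ (e := fun b => (b, ())) fun a b h => (Prod.ext_iff.1 h).1
  rw [condEnt, this, h0, sub_zero]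

lemma condEnt_le_ent (hp : ∀ ω, 0 ≤ p ω) (hp1 : ∑ ω, p ω = 1) (φ : Ω → β) (ψ : Ω → γ) :
    condEnt p φ ψ ≤ ent p φ := by
  rw [← ent_eq_condEnt hp1]
  exact condEnt_le_condEnt_comp hp φ ψ fun _ => ()

lemma ent_le_logb_card (hp : ∀ ω, 0 ≤ p ω) (hp1 : ∑ ω, p ω = 1) (φ : Ω → β) :
    ent p φ ≤ Real.logb 2 (Fintype.card β) := by
  have h := condFn_le (m := lawOf p φ) (lawOf_nonneg hp φ)
  rw [condFn, sum_lawOf, hp1] at h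
  simpa [eta, ent] using h

/-- Relabelling the variable by a bijection that depends on the condition changes nothing. -/
lemma condEnt_relabel (φ : Ω → β) (ψ : Ω → γ) (e : γ → β → δ)
    (he : ∀ c, Function.Injective (e c)) :
    condEnt p (fun ω => e (ψ ω) (φ ω)) ψ = condEnt p φ ψ := by
  unfold condEnt
  congr 1
  refine ent_of_injective (fun ω => (φ ω, ψ ω)) (e := fun x : β × γ => (e x.2 x.1, x.2)) ?_
  rintro ⟨b, c⟩ ⟨b', c'⟩ h
  obtain ⟨h1, h2⟩ := Prod.ext_iff.1 h
  simp only at h1 h2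
  subst h2
  rw [he _ h1]

end RandomVariables

/-! ### Product laws and one-shot random binning -/

section ProdLaw

lemma sum_prod_apply {ι α : Type*} [Fintype ι] [Fintype α] [DecidableEq ι] (F : ι → α → ℝ) :
    ∑ s : ι → α, ∏ i, F i (s i) = ∏ i, ∑ a, F i a := by
  rw [Finset.prod_univ_sum, Fintype.piFinset_univ]

variable {ι κ α β : Type*} [Fintype ι] [Fintype κ] [Fintype α] [Fintype β]
  [DecidableEq ι] [DecidableEq κ] [DecidableEq α] [DecidableEq β]

/-- The law of a family of i.i.d. variables with probability mass function `P`, indexed by an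
arbitrary finite type; `iidLaw` is the case `Fin n`. -/
def prodLaw (P : α → ℝ) (s : ι → α) : ℝ := ∏ i, P (s i)

lemma iidLaw_eq_prodLaw (P : α → ℝ) (n : ℕ) : iidLaw P n = prodLaw P := rfl

lemma prodLaw_nonneg {P : α → ℝ} (hP : ∀ a, 0 ≤ P a) (s : ι → α) : 0 ≤ prodLaw P s :=
  Finset.prod_nonneg fun _ _ => hP _

lemma sum_prodLaw_mul_prod (P : α → ℝ) (F : ι → α → ℝ) :
    ∑ s : ι → α, prodLaw P s * ∏ i, F i (s i) = ∏ i, ∑ a, P a * F i a := by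
  rw [← sum_prod_apply]
  simp only [prodLaw, Finset.prod_mul_distrib]

lemma sum_prodLaw {P : α → ℝ} (hP : ∑ a, P a = 1) : ∑ s : ι → α, prodLaw P s = 1 := by
  have := sum_prodLaw_mul_prod (ι := ι) P fun _ _ => 1
  simpa [hP] using this

/-- A subfamily of a family of i.i.d. variables, each mapped by `φ`, is i.i.d. -/
lemma lawOf_prodLaw {P : α → ℝ} (hP : ∑ a, P a = 1) (φ : α → β) {e : κ → ι}
    (he : Function.Injective e) :
    lawOf (prodLaw P) (fun (s : ι → α) k => φ (s (e k))) = prodLaw (lawOf P φ) := by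
  classical
  funext t
  have h1 : ∀ s : ι → α, (if (fun k => φ (s (e k))) = t then prodLaw P s else 0)
      = prodLaw P s * ∏ i, (if ∀ k, e k = i → φ (s i) = t k then (1 : ℝ) else 0) := by
    intro s
    rw [Fintype.prod_ite_zero]
    have : ((fun k => φ (s (e k))) = t) ↔ ∀ i k, e k = i → φ (s i) = t k :=
      ⟨fun h i k hk => by rw [← h, ← hk], fun h => funext fun k => h _ k rfl⟩
    simp [this]
  unfold lawOf
  simp only [h1]
  rw [sum_prodLaw_mul_prod (ι := ι) P fun i a => if ∀ k, e k = i → φ a = t k then 1 else 0]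
  have h2 : ∏ k, ∑ a, (if φ a = t k then P a else 0)
      = ∏ i ∈ Finset.univ.map ⟨e, he⟩,
          ∑ a, P a * (if ∀ k, e k = i → φ a = t k then (1 : ℝ) else 0) := by
    rw [Finset.prod_map]
    refine Finset.prod_congr rfl fun k _ => Finset.sum_congr rfl fun a _ => ?_
    have : (∀ k', e k' = e k → φ a = t k') ↔ φ a = t k :=
      ⟨fun h => h k rfl, fun h k' hk' => by rw [he hk', h]⟩
    simp [this]
  unfold prodLaw
  refine Eq.trans ?_ h2.symm
  symm
  refine Finset.prod_subset (Finset.subset_univ _) fun i _ hi => ?_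
  have : ∀ k, e k ≠ i := fun k hk => hi (by simpa using ⟨k, hk⟩)
  simp [this, hP]

/-- Variance of a sum of i.i.d. centered variables. -/
lemma sum_prodLaw_mul_sq {P : α → ℝ} (hP : ∑ a, P a = 1) (ξ : α → ℝ) (hξ : ∑ a, P a * ξ a = 0) :
    ∑ s : ι → α, prodLaw P s * (∑ i, ξ (s i)) ^ 2 = Fintype.card ι * ∑ a, P a * ξ a ^ 2 := by
  have h1 : ∀ i j : ι, ∑ s : ι → α, prodLaw P s * (ξ (s i) * ξ (s j))
      = if i = j then ∑ a, P a * ξ a ^ 2 else 0 := by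
    intro i j
    have h := sum_prodLaw_mul_prod (ι := ι) P
      fun k a => (if k = i then ξ a else 1) * (if k = j then ξ a else 1)
    simp only [Finset.prod_mul_distrib, Finset.prod_ite_eq', Finset.mem_univ, if_true] at h
    rw [h]
    split_ifs with hij
    · subst hij
      rw [Finset.prod_eq_single i]
      · simp [sq]
      · intro k _ hk; simp [hk, hP]
      · simp
    · refine Finset.prod_eq_zero (Finset.mem_univ i) ?_
      simp [hij, hξ]
  have h2 : ∀ s : ι → α, prodLaw P s * (∑ i, ξ (s i)) ^ 2
      = ∑ i, ∑ j, prodLaw P s * (ξ (s i) * ξ (s j)) := by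
    intro s
    rw [sq, Finset.sum_mul_sum]
    simp only [Finset.mul_sum]
  simp only [h2]
  rw [Finset.sum_comm]
  have : ∀ i : ι, ∑ s : ι → α, ∑ j, prodLaw P s * (ξ (s i) * ξ (s j)) = ∑ a, P a * ξ a ^ 2 := by
    intro i
    rw [Finset.sum_comm]
    simp [h1]
  simp [this]

end ProdLaw

section Binning

variable {V X : Type*} [Fintype V] [Fintype X] [DecidableEq V] [DecidableEq X]

/-- Under uniformly random binning two different points share a bin with probability `1 / M`. -/
lemma sum_collision {M : ℕ} (hM : 0 < M) {v v' : V} (hv : v ≠ v') :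
    ∑ b : V → Fin M, prodLaw (fun _ => 1 / (M : ℝ)) b * (if b v' = b v then 1 else 0)
      = 1 / (M : ℝ) := by
  have hM' : (M : ℝ) ≠ 0 := by positivity
  have hP : ∑ _a : Fin M, 1 / (M : ℝ) = 1 := by simp [hM']
  have he : Function.Injective ![v, v'] := by
    intro i j h
    fin_cases i <;> fin_cases j <;> simp_all
  have h := lawOf_prodLaw (ι := V) hP (fun a : Fin M => a) he
  have h' := sum_lawOf_mul (p := prodLaw (ι := V) fun _ : Fin M => 1 / (M : ℝ))
    (fun b k => b (![v, v'] k)) fun t : Fin 2 → Fin M => if t 1 = t 0 then 1 else 0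
  simp only [Matrix.cons_val_one, Matrix.cons_val_zero] at h'
  refine Eq.trans (Eq.trans (Finset.sum_congr rfl fun b _ => ?_) h'.symm) ?_
  · congr
  rw [h]
  have hl : lawOf (fun _ : Fin M => 1 / (M : ℝ)) (fun a => a) = fun _ => 1 / (M : ℝ) := by
    funext a; simp [lawOf]
  rw [hl]
  have h3 : ∀ t : Fin 2 → Fin M, prodLaw (fun _ : Fin M => 1 / (M : ℝ)) t
      * (if t 1 = t 0 then 1 else 0) = 1 / (M : ℝ) ^ 2 * (if t 1 = t 0 then 1 else 0) := by
    intro t; simp [prodLaw]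
  simp only [h3, ← Finset.mul_sum]
  rw [← (finTwoArrowEquiv (Fin M)).symm.sum_comp]
  simp only [finTwoArrowEquiv_symm_apply, Matrix.cons_val_one, Matrix.cons_val_zero]
  rw [Fintype.sum_prod_type]
  simp
  field_simp

/-- One-shot random binning: some binning of `V` into `M` bins leaves an equivocation of at most
`E log₂ (1 + 1 / (M P(V | X)))`. -/
lemma exists_binning {Ω : Type*} [Fintype Ω] {p : Ω → ℝ} (hp : ∀ ω, 0 ≤ p ω)
    (v : Ω → V) (x : Ω → X) {M : ℕ} (hM : 0 < M) :
    ∃ b : V → Fin M, condEnt p v (fun ω => (b (v ω), x ω))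
      ≤ ∑ t : V × X, lawOf p (fun ω => (v ω, x ω)) t *
          Real.logb 2 (1 + lawOf p x t.2 / (M * lawOf p (fun ω => (v ω, x ω)) t)) := by
  classical
  set Q : V × X → ℝ := lawOf p (fun ω => (v ω, x ω)) with hQ
  have hQ0 : ∀ t, 0 ≤ Q t := lawOf_nonneg hp _
  have hX : ∀ c, lawOf p x c = ∑ w, Q (w, c) := fun c => lawOf_snd_eq_sum v x c
  have hM' : (0 : ℝ) < M := by exact_mod_cast hM
  -- the mass of the bin of `w` in the fibre over `c`
  let S : (V → Fin M) → V × X → ℝ := fun b t => ∑ w, Q (w, t.2) * (if b w = b t.1 then 1 else 0)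
  have hS : ∀ b t, Q t ≤ S b t := by
    intro b t
    have := Finset.single_le_sum (f := fun w => Q (w, t.2) * (if b w = b t.1 then (1 : ℝ) else 0))
      (fun w _ => mul_nonneg (hQ0 _) (by split_ifs <;> simp)) (Finset.mem_univ t.1)
    simpa [S] using this
  have hcond : ∀ b : V → Fin M, condEnt p v (fun ω => (b (v ω), x ω))
      = ∑ t, Q t * Real.logb 2 (S b t / Q t) := by
    intro b
    have hl : ∀ w j c, lawOf p (fun ω => (v ω, (b (v ω), x ω))) (w, (j, c))
        = if b w = j then Q (w, c) else 0 := by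
      intro w j c
      simp only [hQ, lawOf]
      split_ifs with h
      · refine Finset.sum_congr rfl fun ω _ => ?_
        congr 1
        simp only [Prod.mk.injEq, eq_iff_iff]
        constructor
        · rintro ⟨h1, _, h3⟩; exact ⟨h1, h3⟩
        · rintro ⟨h1, h3⟩; exact ⟨h1, by rw [h1, h], h3⟩
      · refine Finset.sum_eq_zero fun ω _ => if_neg ?_
        simp only [Prod.mk.injEq]
        rintro ⟨h1, h2, _⟩
        exact h (by rw [← h1, h2])
    rw [condEnt_eq_sum, Fintype.sum_prod_type_right, Fintype.sum_prod_type_right]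
    refine Finset.sum_congr rfl fun c _ => ?_
    have h2 : ∀ j, condFn (fun w => lawOf p (fun ω => (v ω, (b (v ω), x ω))) (w, (j, c)))
        = ∑ w, if b w = j then Q (w, c) * Real.logb 2 (S b (w, c) / Q (w, c)) else 0 := by
      intro j
      simp only [hl]
      rw [condFn_eq_sum _ fun w => by split_ifs <;> simp [hQ0]]
      refine Finset.sum_congr rfl fun w _ => ?_
      split_ifs with h
      · congr 3
        simp only [S, mul_ite, mul_one, mul_zero, h]
      · simp
    simp only [h2]
    rw [Finset.sum_comm]
    simp
  let u : (V → Fin M) → ℝ := prodLaw fun _ => 1 / (M : ℝ)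
  have hu0 : ∀ b, 0 ≤ u b := prodLaw_nonneg fun _ => by positivity
  have hu1 : ∑ b, u b = 1 := sum_prodLaw (by simp [hM'.ne'])
  have hES : ∀ t, ∑ b, u b * S b t ≤ Q t + lawOf p x t.2 / M := by
    intro t
    have h1 : ∀ w, ∑ b, u b * (if b w = b t.1 then (1 : ℝ) else 0)
        ≤ (if w = t.1 then 1 else 0) + 1 / M := by
      intro w
      by_cases hw : w = t.1
      · subst hw
        simp [hu1]
      · have := sum_collision hM (Ne.symm hw)
        simp only [u, hw, if_false, zero_add]
        exact this.le
    calc ∑ b, u b * S b t = ∑ w, Q (w, t.2) * ∑ b, u b * (if b w = b t.1 then (1 : ℝ) else 0) := by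
          simp only [S, Finset.mul_sum]
          rw [Finset.sum_comm]
          refine Finset.sum_congr rfl fun _ _ => Finset.sum_congr rfl fun _ _ => by ring
      _ ≤ ∑ w, Q (w, t.2) * ((if w = t.1 then 1 else 0) + 1 / M) :=
          Finset.sum_le_sum fun w _ => mul_le_mul_of_nonneg_left (h1 w) (hQ0 _)
      _ = Q t + lawOf p x t.2 / M := by
          simp only [mul_add, Finset.sum_add_distrib, ← Finset.sum_mul, hX]
          simp [div_eq_mul_inv]
  have hmain : ∑ b, u b * (∑ t, Q t * Real.logb 2 (S b t / Q t))
      ≤ ∑ b, u b * ∑ t, Q t * Real.logb 2 (1 + lawOf p x t.2 / (M * Q t)) := by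
    rw [← Finset.sum_mul, hu1, one_mul]
    simp only [Finset.mul_sum]
    rw [Finset.sum_comm]
    refine Finset.sum_le_sum fun t _ => ?_
    rcases (hQ0 t).eq_or_lt with h | h
    · simp [← h]
    have hx0 : 0 ≤ lawOf p x t.2 := lawOf_nonneg hp _ _
    set T := 1 + lawOf p x t.2 / (M * Q t) with hT
    have hT0 : 0 < T := by positivity
    -- the tangent of the logarithm at the mean bin mass
    have htan : ∀ b, Real.logb 2 (S b t / Q t)
        ≤ Real.logb 2 T + (S b t / Q t / T - 1) / Real.log 2 := by
      intro b
      have hpos : 0 < S b t / Q t := div_pos (h.trans_le (hS b t)) h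
      have := Real.log_le_sub_one_of_pos (div_pos hpos hT0)
      rw [Real.log_div hpos.ne' hT0.ne'] at this
      unfold Real.logb
      rw [← add_div]
      exact div_le_div_of_nonneg_right (by linarith) log_two_pos.le
    have hE : ∑ b, u b * (S b t / Q t / T) ≤ 1 := by
      have : ∑ b, u b * (S b t / Q t / T) = (∑ b, u b * S b t) / (Q t * T) := by
        rw [Finset.sum_div]
        refine Finset.sum_congr rfl fun b _ => by field_simp
      rw [this, div_le_one (by positivity)]
      refine (hES t).trans (le_of_eq ?_)
      rw [hT]; field_simp
    calc ∑ b, u b * (Q t * Real.logb 2 (S b t / Q t))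
        ≤ ∑ b, u b * (Q t * (Real.logb 2 T + (S b t / Q t / T - 1) / Real.log 2)) :=
          Finset.sum_le_sum fun b _ => mul_le_mul_of_nonneg_left
            (mul_le_mul_of_nonneg_left (htan b) h.le) (hu0 b)
      _ = Q t * (Real.logb 2 T * ∑ b, u b
            + (∑ b, u b * (S b t / Q t / T) - ∑ b, u b) / Real.log 2) := by
          rw [← Finset.sum_sub_distrib, Finset.sum_div, Finset.mul_sum, ← Finset.sum_add_distrib,
            Finset.mul_sum]
          refine Finset.sum_congr rfl fun b _ => by ring
      _ ≤ Q t * Real.logb 2 T := by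
          refine mul_le_mul_of_nonneg_left ?_ h.le
          rw [hu1, mul_one]
          have : (∑ b, u b * (S b t / Q t / T) - 1) / Real.log 2 ≤ 0 :=
            div_nonpos_of_nonpos_of_nonneg (by linarith) log_two_pos.le
          linarith
  by_contra hcon
  push Not at hcon
  refine absurd hmain (not_le.2 ?_)
  refine Finset.sum_lt_sum (fun b _ => mul_le_mul_of_nonneg_left ?_ (hu0 b)) ?_
  · have := (hcon b).le
    rwa [hcond b] at this
  · let b0 : V → Fin M := fun _ => ⟨0, hM⟩
    refine ⟨b0, Finset.mem_univ _, mul_lt_mul_of_pos_left ?_ ?_⟩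
    · have := hcon b0
      rwa [hcond b0] at this
    · exact Finset.prod_pos fun _ _ => by positivity

end Binning

/-! ### Binning with side information in blocks -/

section BlockBinning

variable {V X : Type*} [Fintype V] [Fintype X] [DecidableEq V] [DecidableEq X]

lemma lawOf_pair_self (Q : V × X → ℝ) : lawOf Q (fun t => (t.1, t.2)) = Q := by
  funext t; simp [lawOf]

/-- The conditional entropy is the mean of `log₂ (P(x) / P(v, x))`. -/
lemma condEnt_eq_sum_logb {Q : V × X → ℝ} (hQ : ∀ t, 0 ≤ Q t) :
    condEnt Q Prod.fst Prod.snd = ∑ t, Q t * Real.logb 2 (lawOf Q Prod.snd t.2 / Q t) := by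
  rw [condEnt_eq_sum, Fintype.sum_prod_type_right]
  refine Finset.sum_congr rfl fun c _ => ?_
  rw [condFn_eq_sum _ fun b => lawOf_nonneg hQ _ _]
  refine Finset.sum_congr rfl fun b _ => ?_
  rw [← lawOf_snd_eq_sum Prod.fst Prod.snd c]
  have : lawOf Q (fun ω => (ω.1, ω.2)) (b, c) = Q (b, c) := by rw [lawOf_pair_self]
  rw [this]

lemma logb_one_add_le {y : ℝ} (z : ℝ) (hy : 0 ≤ y) (h : y ≤ 2 ^ z) :
    Real.logb 2 (1 + y) ≤ 1 + |z| := by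
  have h1 : 1 + y ≤ 2 ^ (1 + |z|) := by
    rw [Real.rpow_add two_pos, Real.rpow_one]
    have h2 : (2 : ℝ) ^ z ≤ 2 ^ |z| := Real.rpow_le_rpow_of_exponent_le one_le_two (le_abs_self z)
    have h3 : (1 : ℝ) ≤ 2 ^ |z| := Real.one_le_rpow one_le_two (abs_nonneg z)
    linarith
  rw [Real.logb_le_iff_le_rpow one_lt_two (by positivity)]
  exact h1

/-- Slepian-Wolf coding with side information `x`: for `N` i.i.d. pairs with law `Q` a binning of
`v` at rate `H(V | X)` leaves an equivocation of order `√N`. -/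
lemma exists_block_binning {Q : V × X → ℝ} (hQ : ∀ t, 0 ≤ Q t) (hQ1 : ∑ t, Q t = 1) :
    ∃ c : ℝ, ∀ (N : ℕ) {Ω : Type} [Fintype Ω] (p : Ω → ℝ) (_ : ∀ ω, 0 ≤ p ω)
      (v : Ω → Fin N → V) (x : Ω → Fin N → X)
      (_ : lawOf p (fun ω j => (v ω j, x ω j)) = prodLaw Q),
      ∃ M : ℕ, 0 < M ∧ Real.logb 2 M ≤ N * condEnt Q Prod.fst Prod.snd + 1 ∧
        ∃ b : (Fin N → V) → Fin M,
          condEnt p v (fun ω => (b (v ω), x ω)) ≤ 1 + c * √N := by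
  set H := condEnt Q Prod.fst Prod.snd with hH
  set ξ : V × X → ℝ := fun t => Real.logb 2 (lawOf Q Prod.snd t.2 / Q t) - H with hξ
  have hξ0 : ∑ t, Q t * ξ t = 0 := by
    simp only [hξ, mul_sub, Finset.sum_sub_distrib, ← Finset.sum_mul, hQ1, one_mul]
    rw [hH, condEnt_eq_sum_logb hQ, sub_self]
  have hH0 : 0 ≤ H := condEnt_nonneg hQ _ _
  refine ⟨(∑ t, Q t * ξ t ^ 2 + 1) / 2, fun N Ω _ p hp v x hlaw => ?_⟩
  set y : ℝ := 2 ^ ((N : ℝ) * H) with hy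
  have hy1 : 1 ≤ y := Real.one_le_rpow one_le_two (by positivity)
  have hM : 0 < ⌈y⌉₊ := Nat.ceil_pos.2 (by linarith)
  have hyM : y ≤ (⌈y⌉₊ : ℝ) := Nat.le_ceil y
  have hM0 : (0 : ℝ) < ⌈y⌉₊ := by exact_mod_cast hM
  refine ⟨⌈y⌉₊, hM, ?_, ?_⟩
  · have h1 : (⌈y⌉₊ : ℝ) ≤ 2 ^ ((N : ℝ) * H + 1) := by
      rw [Real.rpow_add two_pos, Real.rpow_one, ← hy]
      have := (Nat.ceil_lt_add_one (by linarith : 0 ≤ y)).le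
      linarith
    rwa [Real.logb_le_iff_le_rpow one_lt_two hM0]
  obtain ⟨b, hb⟩ := exists_binning hp v x hM
  refine ⟨b, hb.trans ?_⟩
  have hjoint : lawOf p (fun ω => (v ω, x ω))
      = lawOf (prodLaw Q) (fun s : Fin N → V × X => (fun j => (s j).1, fun j => (s j).2)) := by
    rw [← hlaw, lawOf_lawOf]
  have hjoint' : ∀ s : Fin N → V × X,
      lawOf p (fun ω => (v ω, x ω)) (fun j => (s j).1, fun j => (s j).2) = prodLaw Q s := by
    intro s
    rw [← hlaw]
    unfold lawOf
    refine Finset.sum_congr rfl fun ω _ => ?_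
    congr 1
    simp only [funext_iff, Prod.ext_iff, forall_and]
  have hx : lawOf p x = prodLaw (lawOf Q Prod.snd) := by
    have h1 := lawOf_prodLaw hQ1 Prod.snd (e := fun j : Fin N => j) fun _ _ h => h
    rw [← hlaw, lawOf_lawOf] at h1
    exact h1
  rw [hjoint, sum_lawOf_mul, ← hjoint]
  simp only [hjoint', hx]
  have hN0 : (0 : ℝ) ≤ N := N.cast_nonneg
  have hterm : ∀ s : Fin N → V × X,
      prodLaw Q s * Real.logb 2 (1 + prodLaw (lawOf Q Prod.snd) (fun j => (s j).2)
        / (⌈y⌉₊ * prodLaw Q s)) ≤ prodLaw Q s * (1 + |∑ j, ξ (s j)|) := by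
    intro s
    rcases (prodLaw_nonneg hQ s).eq_or_lt with h | h
    · simp [← h]
    refine mul_le_mul_of_nonneg_left ?_ h.le
    have hpos : ∀ j, 0 < Q (s j) := fun j => (hQ _).lt_of_ne fun h0 =>
      h.ne' (Finset.prod_eq_zero (Finset.mem_univ j) h0.symm)
    have hpos' : ∀ j, 0 < lawOf Q Prod.snd (s j).2 := by
      intro j
      refine (hpos j).trans_le ?_
      have := Finset.single_le_sum (f := fun a => if a.2 = (s j).2 then Q a else 0)
        (fun a _ => by split_ifs <;> simp [hQ]) (Finset.mem_univ (s j))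
      simpa [lawOf] using this
    have hnum : 0 < prodLaw (lawOf Q Prod.snd) (fun j => (s j).2) :=
      Finset.prod_pos fun j _ => hpos' j
    refine logb_one_add_le _ (by positivity) ?_
    have e1 : prodLaw (lawOf Q Prod.snd) (fun j => (s j).2) / prodLaw Q s
        = 2 ^ (∑ j, ξ (s j) + N * H) := by
      have : ∑ j, ξ (s j) + N * H
          = ∑ j, Real.logb 2 (lawOf Q Prod.snd (s j).2 / Q (s j)) := by
        simp [hξ]
      rw [this, Real.rpow_sum_of_pos two_pos]
      unfold prodLaw
      rw [← Finset.prod_div_distrib]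
      refine Finset.prod_congr rfl fun j _ => ?_
      rw [Real.rpow_logb two_pos (by norm_num) (div_pos (hpos' j) (hpos j))]
    rw [mul_comm, ← div_div, e1, Real.rpow_add two_pos, ← hy, div_le_iff₀ hM0]
    exact mul_le_mul_of_nonneg_left hyM (by positivity)
  refine (Finset.sum_le_sum fun s _ => hterm s).trans ?_
  simp only [mul_add, Finset.sum_add_distrib, mul_one, sum_prodLaw hQ1]
  gcongr
  rcases N.eq_zero_or_pos with h0 | hN
  · subst h0; simp
  have hs : 0 < √(N : ℝ) := Real.sqrt_pos.2 (by exact_mod_cast hN)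
  have hss : √(N : ℝ) * √N = N := Real.mul_self_sqrt hN0
  -- the arithmetic-geometric mean inequality `|z| ≤ (z ^ 2 / √N + √N) / 2`
  have habs : ∀ z : ℝ, |z| ≤ (z ^ 2 / √N + √N) / 2 := by
    intro z
    have : (|z| - √N) ^ 2 / √N = z ^ 2 / √N - 2 * |z| + √N := by
      field_simp
      rw [sub_sq, sq_abs]; ring
    have h2 : 0 ≤ (|z| - √N) ^ 2 / √N := by positivity
    linarith
  calc ∑ s : Fin N → V × X, prodLaw Q s * |∑ j, ξ (s j)|
      ≤ ∑ s : Fin N → V × X, prodLaw Q s * (((∑ j, ξ (s j)) ^ 2 / √N + √N) / 2) :=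
        Finset.sum_le_sum fun s _ => mul_le_mul_of_nonneg_left (habs _) (prodLaw_nonneg hQ s)
    _ = ((∑ s : Fin N → V × X, prodLaw Q s * (∑ j, ξ (s j)) ^ 2) / √N
          + (∑ s : Fin N → V × X, prodLaw Q s) * √N) / 2 := by
        rw [Finset.sum_div, Finset.sum_mul, ← Finset.sum_add_distrib, Finset.sum_div]
        refine Finset.sum_congr rfl fun s _ => by ring
    _ = (∑ t, Q t * ξ t ^ 2 + 1) / 2 * √N := by
        rw [sum_prodLaw_mul_sq hQ1 ξ hξ0, sum_prodLaw hQ1, Fintype.card_fin]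
        field_simp
        rw [sq, hss]; ring

end BlockBinning

/-! ### Covering the Hamming cube and rate-distortion quantizers -/

section Covering

lemma choose_mul_pow_le {n k : ℕ} (hk : k ≤ n) {j : ℕ} (hj : j ≤ n) :
    n.choose j * k ^ j * (n - k) ^ (n - j) ≤ n.choose k * k ^ k * (n - k) ^ (n - k) := by
  have hup : ∀ j, j + 1 ≤ k → n.choose j * k ^ j * (n - k) ^ (n - j)
      ≤ n.choose (j + 1) * k ^ (j + 1) * (n - k) ^ (n - (j + 1)) := by
    intro j hjk
    have e : n - j = (n - (j + 1)) + 1 := by omega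
    have h1 : n.choose j * (n - k) ≤ n.choose (j + 1) * k := by
      refine Nat.le_of_mul_le_mul_right ?_ (Nat.succ_pos j)
      calc n.choose j * (n - k) * (j + 1) = n.choose j * ((n - k) * (j + 1)) := by ring
        _ ≤ n.choose j * ((n - j) * k) := by gcongr; omega
        _ = n.choose (j + 1) * k * (j + 1) := by
          have := Nat.choose_succ_right_eq n j
          rw [mul_right_comm, this]; ring
    rw [e, pow_succ (n - k), pow_succ k]
    calc n.choose j * k ^ j * ((n - k) ^ (n - (j + 1)) * (n - k))
        = (n.choose j * (n - k)) * (k ^ j * (n - k) ^ (n - (j + 1))) := by ring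
      _ ≤ (n.choose (j + 1) * k) * (k ^ j * (n - k) ^ (n - (j + 1))) := by gcongr
      _ = _ := by ring
  have hdown : ∀ j, k ≤ j → j + 1 ≤ n →
      n.choose (j + 1) * k ^ (j + 1) * (n - k) ^ (n - (j + 1))
      ≤ n.choose j * k ^ j * (n - k) ^ (n - j) := by
    intro j hkj hjn
    have e : n - j = (n - (j + 1)) + 1 := by omega
    have h1 : n.choose (j + 1) * k ≤ n.choose j * (n - k) := by
      refine Nat.le_of_mul_le_mul_right ?_ (Nat.succ_pos j)
      calc n.choose (j + 1) * k * (j + 1) = n.choose j * ((n - j) * k) := by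
            have := Nat.choose_succ_right_eq n j
            rw [mul_right_comm, this]; ring
        _ ≤ n.choose j * ((n - k) * (j + 1)) := by gcongr; omega
        _ = _ := by rw [Nat.succ_eq_add_one]; ring
    rw [e, pow_succ (n - k), pow_succ k]
    calc n.choose (j + 1) * (k ^ j * k) * (n - k) ^ (n - (j + 1))
        = (n.choose (j + 1) * k) * (k ^ j * (n - k) ^ (n - (j + 1))) := by ring
      _ ≤ (n.choose j * (n - k)) * (k ^ j * (n - k) ^ (n - (j + 1))) := by gcongr
      _ = _ := by ring
  rcases le_total j k with h | h
  · refine Nat.decreasingInduction' (P := fun j => n.choose j * k ^ j * (n - k) ^ (n - j)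
      ≤ n.choose k * k ^ k * (n - k) ^ (n - k)) (fun i hi _ ih => (hup i hi).trans ih) h le_rfl
  · induction j, h using Nat.le_induction with
    | base => exact le_rfl
    | succ i hi ih => exact (hdown i hi hj).trans (ih (by omega))

/-- Binomial coefficients are exponentially as large as the entropy predicts: the terms of
`∑ j, C(n, j) ρ ^ j (1 - ρ) ^ (n - j) = 1`, `ρ = k / n`, are largest at `j = k`. -/
lemma two_rpow_entropy_le {n k : ℕ} (hn : 0 < n) (hk : k ≤ n) :
    (2 : ℝ) ^ ((n : ℝ) * h₂ ((k : ℝ) / n)) ≤ (n + 1) * n.choose k := by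
  have hn' : (0 : ℝ) < n := by exact_mod_cast hn
  have h1 : (n : ℝ) ^ n ≤ (n + 1) * (n.choose k * k ^ k * (n - k : ℕ) ^ (n - k)) := by
    have : n ^ n ≤ (n + 1) * (n.choose k * k ^ k * (n - k) ^ (n - k)) := by
      calc n ^ n = (k + (n - k)) ^ n := by congr 1; omega
        _ = ∑ j ∈ Finset.range (n + 1), n.choose j * k ^ j * (n - k) ^ (n - j) := by
          rw [add_pow]
          refine Finset.sum_congr rfl fun j _ => by simp; ring
        _ ≤ ∑ j ∈ Finset.range (n + 1), n.choose k * k ^ k * (n - k) ^ (n - k) :=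
          Finset.sum_le_sum fun j hj => choose_mul_pow_le hk (by simp at hj; omega)
        _ = _ := by simp
    exact_mod_cast this
  rcases k.eq_zero_or_pos with h0 | hk0
  · subst h0; simp [h₂]
  rcases hk.eq_or_lt with h0 | hkn
  · subst h0; simp [h₂, hn'.ne']
  have hk' : (0 : ℝ) < k := by exact_mod_cast hk0
  have hkn' : (0 : ℝ) < (n - k : ℕ) := by exact_mod_cast (by omega : 0 < n - k)
  have hcast : ((n - k : ℕ) : ℝ) = n - k := by push_cast [hk]; ring
  have hc : (0 : ℝ) < n.choose k := by exact_mod_cast Nat.choose_pos hk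
  have hlog := Real.log_le_log (by positivity) h1
  rw [Real.log_mul (by positivity) (by positivity), Real.log_mul (by positivity) (by positivity),
    Real.log_mul (by positivity) (by positivity), Real.log_pow, Real.log_pow, Real.log_pow] at hlog
  rw [← Real.log_le_log_iff (by positivity) (by positivity), Real.log_rpow two_pos,
    Real.log_mul (by positivity) (by positivity)]
  have e : (n : ℝ) * h₂ ((k : ℝ) / n) * Real.log 2
      = n * Real.log n - k * Real.log k - (n - k : ℕ) * Real.log (n - k : ℕ) := by
    have e1 : 1 - (k : ℝ) / n = (n - k : ℕ) / n := by rw [hcast]; field_simp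
    have := log_two_pos
    rw [h₂, Real.binEntropy_eq_negMulLog_add_negMulLog_one_sub, e1, Real.negMulLog, Real.negMulLog,
      Real.log_div hk'.ne' hn'.ne', Real.log_div hkn'.ne' hn'.ne', hcast]
    field_simp
    ring
  rw [e]
  linarith

variable {n : ℕ}

lemma choose_le_card_ball (k : ℕ) (x : Fin n → Bool) :
    n.choose k ≤ (Finset.univ.filter fun c : Fin n → Bool => hammingDist x c ≤ k).card := by
  have h : (Finset.powersetCard k (Finset.univ : Finset (Fin n))).card = n.choose k := by simp
  rw [← h]
  refine Finset.card_le_card_of_injOn (fun S i => if i ∈ S then !(x i) else x i) ?_ ?_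
  · intro S hS
    have hS' : S.card = k := (Finset.mem_powersetCard.1 hS).2
    simp only [Finset.coe_filter, Finset.mem_univ, true_and, Set.mem_ofPred_eq, hammingDist]
    rw [← hS']
    refine Finset.card_le_card fun i hi => ?_
    by_contra hiS
    simp [hiS] at hi
  · intro S _ S' _ hSS
    ext i
    have := congrFun hSS i
    by_cases h1 : i ∈ S <;> by_cases h2 : i ∈ S' <;> simp_all

/-- Greedy covering: `M` Hamming balls of radius `k`, chosen one after the other so as to cover as
much as possible of what remains, leave a fraction of at most `(1 - C(n, k) / 2 ^ n) ^ M`. -/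
lemma exists_covering (n k M : ℕ) :
    ∃ c : Fin M → Fin n → Bool,
      ((Finset.univ.filter fun x : Fin n → Bool => ∀ j, k < hammingDist x (c j)).card : ℝ)
        ≤ 2 ^ n * (1 - n.choose k / 2 ^ n) ^ M := by
  induction M with
  | zero => exact ⟨Fin.elim0, by simp⟩
  | succ M ih =>
    obtain ⟨c, hc⟩ := ih
    set U := Finset.univ.filter fun x : Fin n → Bool => ∀ j, k < hammingDist x (c j)
    have hsum : ∑ _c : Fin n → Bool, ((U.card : ℝ) * (n.choose k / 2 ^ n))
        ≤ ∑ c : Fin n → Bool, ((U.filter fun x => hammingDist x c ≤ k).card : ℝ) := by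
      have h1 : ∑ c : Fin n → Bool, (U.filter fun x => hammingDist x c ≤ k).card
          = ∑ x ∈ U, (Finset.univ.filter fun c : Fin n → Bool => hammingDist x c ≤ k).card := by
        simp only [Finset.card_filter]
        exact Finset.sum_comm
      have h2 : U.card * n.choose k
          ≤ ∑ c : Fin n → Bool, (U.filter fun x => hammingDist x c ≤ k).card := by
        rw [h1, ← smul_eq_mul]
        exact Finset.card_nsmul_le_sum _ _ _ fun x _ => choose_le_card_ball k x
      have h3 : ((U.card * n.choose k : ℕ) : ℝ)
          ≤ ((∑ c : Fin n → Bool, (U.filter fun x => hammingDist x c ≤ k).card : ℕ) : ℝ) := by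
        exact_mod_cast h2
      push_cast at h3
      refine le_trans (le_of_eq ?_) h3
      simp
      field_simp
    obtain ⟨c0, -, hc0⟩ := Finset.exists_le_of_sum_le Finset.univ_nonempty hsum
    refine ⟨Fin.cons c0 c, ?_⟩
    have hset : (Finset.univ.filter fun x : Fin n → Bool =>
        ∀ j, k < hammingDist x ((Fin.cons c0 c : Fin (M + 1) → Fin n → Bool) j))
        = U.filter fun x => ¬ hammingDist x c0 ≤ k := by
      ext x
      simp [U, Fin.forall_fin_succ, and_comm]
    have hcard := Finset.card_filter_add_card_filter_not (s := U) fun x => hammingDist x c0 ≤ k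
    have hcard' : ((U.filter fun x => hammingDist x c0 ≤ k).card : ℝ)
        + ((U.filter fun x => ¬ hammingDist x c0 ≤ k).card : ℝ) = U.card := by
      exact_mod_cast hcard
    rw [hset]
    have hle : (n.choose k : ℝ) / 2 ^ n ≤ 1 := by
      rw [div_le_one (by positivity)]
      exact_mod_cast Nat.choose_le_two_pow n k
    calc ((U.filter fun x => ¬ hammingDist x c0 ≤ k).card : ℝ)
        ≤ U.card * (1 - n.choose k / 2 ^ n) := by linarith
      _ ≤ (2 ^ n * (1 - n.choose k / 2 ^ n) ^ M) * (1 - n.choose k / 2 ^ n) :=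
        mul_le_mul_of_nonneg_right hc (by linarith)
      _ = _ := by ring

lemma continuous_h₂ : Continuous h₂ := Real.binEntropy_continuous.div_const _

/-- Rate-distortion coding of a uniform binary source: at rate `1 - h₂ r` the mean Hamming
distortion can be brought down to `r`. -/
lemma exists_quantizer {r δ : ℝ} (hr : 0 ≤ r) (hr' : r ≤ 1 / 2) (hδ : 0 < δ) :
    ∃ (n L : ℕ) (c : Fin L → Fin n → Bool) (V : (Fin n → Bool) → Fin L), 0 < n ∧
      Real.logb 2 L ≤ n * (1 - h₂ r + δ) ∧
      ∑ x, (hammingDist x (c (V x)) : ℝ) ≤ 2 ^ n * (n * (r + δ)) := by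
  set l : ℝ := 1 / δ with hl
  have hl0 : 0 < l := by positivity
  have h1 : ∀ᶠ n : ℕ in Filter.atTop, h₂ r - δ / 2 ≤ h₂ ((⌊r * n⌋₊ : ℝ) / n) := by
    have := (continuous_h₂.tendsto r).comp ((tendsto_nat_floor_mul_div_atTop hr).comp
      (tendsto_natCast_atTop_atTop (R := ℝ)))
    exact this.eventually_const_le (by linarith)
  have h2 : ∀ᶠ n : ℕ in Filter.atTop, Real.logb 2 ((l + 1) * (n + 1)) ≤ n * (δ / 2) := by
    have hlim : Filter.Tendsto (fun n : ℕ => Real.log ((n : ℝ) + 1) / ((n : ℝ) + 1)) Filter.atTop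
        (nhds 0) := by
      have h := Real.isLittleO_log_id_atTop.tendsto_div_nhds_zero
      exact h.comp (Filter.tendsto_atTop_add_const_right _ 1 (tendsto_natCast_atTop_atTop (R := ℝ)))
    have he : 0 < δ / 8 * Real.log 2 := mul_pos (by positivity) log_two_pos
    filter_upwards [hlim.eventually_le_const he, Filter.eventually_ge_atTop 1,
      (tendsto_natCast_atTop_atTop (R := ℝ)).eventually_ge_atTop (Real.logb 2 (l + 1) / (δ / 4))]
      with n hn hn1 hn2
    have hn1' : (1 : ℝ) ≤ n := by exact_mod_cast hn1
    rw [Real.logb_mul (by positivity) (by positivity)]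
    rw [div_le_iff₀ (by positivity)] at hn hn2
    have : Real.logb 2 ((n : ℝ) + 1) ≤ δ / 8 * (n + 1) := by
      rw [Real.logb, div_le_iff₀ log_two_pos]; linarith
    have h3 : δ / 8 * ((n : ℝ) + 1) ≤ δ / 4 * n := by nlinarith
    linarith
  obtain ⟨n, hn1, hn2, hn⟩ := (h1.and (h2.and (Filter.eventually_gt_atTop 0))).exists
  have hn' : (0 : ℝ) < n := by exact_mod_cast hn
  set k := ⌊r * n⌋₊ with hk
  have hkr : (k : ℝ) ≤ r * n := Nat.floor_le (by positivity)
  have hkn : k ≤ n := by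
    have : (k : ℝ) ≤ n := by nlinarith
    exact_mod_cast this
  have hc : (0 : ℝ) < n.choose k := by exact_mod_cast Nat.choose_pos hkn
  set β : ℝ := n.choose k / 2 ^ n with hβ
  have hβ0 : 0 < β := by positivity
  have hβ1 : β ≤ 1 := by
    rw [hβ, div_le_one (by positivity)]
    exact_mod_cast Nat.choose_le_two_pow n k
  set L := ⌈l / β⌉₊ with hL
  have hL0 : 0 < L := Nat.ceil_pos.2 (by positivity)
  have hL0' : (0 : ℝ) < L := by exact_mod_cast hL0
  obtain ⟨c, hcov⟩ := exists_covering n k L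
  classical
  let V : (Fin n → Bool) → Fin L := fun x =>
    if h : ∃ j, hammingDist x (c j) ≤ k then h.choose else ⟨0, hL0⟩
  refine ⟨n, L, c, V, hn, ?_, ?_⟩
  · have hLle : (L : ℝ) ≤ (l + 1) / β := by
      have := (Nat.ceil_lt_add_one (show 0 ≤ l / β by positivity)).le
      have h3 : 1 ≤ 1 / β := by rw [le_div_iff₀ hβ0]; linarith
      rw [add_div]; linarith
    have hent := two_rpow_entropy_le hn hkn
    have hLle2 : (L : ℝ) ≤ (l + 1) * (n + 1) * 2 ^ ((n : ℝ) * (1 - h₂ ((k : ℝ) / n))) := by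
      refine hLle.trans ?_
      rw [hβ, div_div_eq_mul_div, div_le_iff₀ hc, mul_sub, mul_one, Real.rpow_sub two_pos,
        Real.rpow_natCast, mul_assoc, mul_assoc]
      refine mul_le_mul_of_nonneg_left ?_ (by positivity)
      have hp : (0 : ℝ) < 2 ^ ((n : ℝ) * h₂ ((k : ℝ) / n)) := by positivity
      rw [div_mul_eq_mul_div, ← mul_div_assoc, le_div_iff₀ hp]
      nlinarith [pow_pos (two_pos : (0:ℝ) < 2) n]
    have := Real.logb_le_logb_of_le one_lt_two hL0' hLle2
    rw [Real.logb_mul (by positivity) (by positivity), Real.logb_rpow two_pos (by norm_num)] at this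
    nlinarith
  · have hd : ∀ x, (hammingDist x (c (V x)) : ℝ)
        ≤ k + if ∀ j, k < hammingDist x (c j) then (n : ℝ) else 0 := by
      intro x
      split_ifs with h
      · have : hammingDist x (c (V x)) ≤ n := by
          simpa using hammingDist_le_card_fintype (x := x) (y := c (V x))
        have : (hammingDist x (c (V x)) : ℝ) ≤ n := by exact_mod_cast this
        have : (0 : ℝ) ≤ k := k.cast_nonneg
        linarith
      · push Not at h
        have hv : V x = h.choose := dif_pos h
        have := h.choose_spec
        rw [hv, add_zero]
        exact_mod_cast this
    have hexp : (1 - β) ^ L ≤ δ := by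
      have h3 : (1 - β) ^ L ≤ Real.exp (-β) ^ L :=
        pow_le_pow_left₀ (by linarith) (by have := Real.add_one_le_exp (-β); linarith) _
      have h4 : l ≤ L * β := by
        have := Nat.le_ceil (l / β)
        rwa [div_le_iff₀ hβ0] at this
      rw [← Real.exp_nat_mul] at h3
      have h5 : Real.exp (L * -β) ≤ Real.exp (-l) := Real.exp_le_exp.2 (by linarith)
      have h6 : Real.exp (-l) ≤ δ := by
        rw [Real.exp_neg]
        refine inv_le_of_inv_le₀ hδ ?_
        have := Real.add_one_le_exp l
        rw [hl, one_div] at this ⊢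
        linarith
      linarith
    calc ∑ x, (hammingDist x (c (V x)) : ℝ)
        ≤ ∑ x : Fin n → Bool, ((k : ℝ) + if ∀ j, k < hammingDist x (c j) then (n : ℝ) else 0) :=
          Finset.sum_le_sum fun x _ => hd x
      _ = 2 ^ n * k + n * ((Finset.univ.filter fun x : Fin n → Bool =>
            ∀ j, k < hammingDist x (c j)).card : ℝ) := by
          rw [Finset.sum_add_distrib, ← Finset.sum_filter]
          simp [mul_comm]
      _ ≤ 2 ^ n * (r * n) + n * (2 ^ n * δ) := by
          gcongr
          exact hcov.trans (by gcongr)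
      _ = _ := by ring

end Covering

/-! ### Curves whose ratio of second derivatives has at most one turning point -/

section SingleCrossing

/-- `u` changes sign at most once on `(0, 1)`, from positive to negative. -/
def SingleCrossing (u : ℝ → ℝ) : Prop :=
  ∀ x y, 0 < x → x < y → y < 1 → u x ≤ 0 → u y < 0

lemma strictMonoOn_of_hasDerivAt_pos {F F' : ℝ → ℝ} {s : Set ℝ} (hs : Convex ℝ s)
    (hc : ContinuousOn F s) (hd : ∀ x ∈ interior s, HasDerivAt F (F' x) x)
    (hpos : ∀ x ∈ interior s, 0 < F' x) : StrictMonoOn F s :=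
  strictMonoOn_of_deriv_pos hs hc fun x hx => by rw [(hd x hx).deriv]; exact hpos x hx

lemma strictAntiOn_of_hasDerivAt_neg {F F' : ℝ → ℝ} {s : Set ℝ} (hs : Convex ℝ s)
    (hc : ContinuousOn F s) (hd : ∀ x ∈ interior s, HasDerivAt F (F' x) x)
    (hneg : ∀ x ∈ interior s, F' x < 0) : StrictAntiOn F s :=
  strictAntiOn_of_deriv_neg hs hc fun x hx => by rw [(hd x hx).deriv]; exact hneg x hx

variable {u N c : ℝ → ℝ} (hu : SingleCrossing u) (hN : ContinuousOn N (Set.Ico 0 1))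
  (hN0 : N 0 = 0) (hd : ∀ x ∈ Set.Ioo (0 : ℝ) 1, HasDerivAt N (c x * u x) x)
  (hc : ∀ x ∈ Set.Ioo (0 : ℝ) 1, 0 < c x)

include hu hN hN0 hd hc

/-- Where the integrand is positive it has been positive all the way from `0`, so its integral is
positive there. -/
lemma SingleCrossing.pos_of_pos {x : ℝ} (hx : x ∈ Set.Ioo (0 : ℝ) 1) (hux : 0 < u x) : 0 < N x := by
  have hmono : StrictMonoOn N (Set.Icc 0 x) := by
    refine strictMonoOn_of_hasDerivAt_pos (F' := fun z => c z * u z) (convex_Icc 0 x)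
      (hN.mono fun z hz => ⟨hz.1, hz.2.trans_lt hx.2⟩) ?_ ?_
    · rw [interior_Icc]; exact fun z hz => hd z ⟨hz.1, hz.2.trans hx.2⟩
    · rw [interior_Icc]
      intro z hz
      refine mul_pos (hc z ⟨hz.1, hz.2.trans hx.2⟩) ?_
      by_contra h
      exact absurd (hu z x hz.1 hz.2 hx.2 (not_lt.1 h)) (not_lt.2 hux.le)
  have := hmono ⟨le_rfl, hx.1.le⟩ ⟨hx.1.le, le_rfl⟩ hx.1
  rwa [hN0] at this

/-- A weighted integral from `0` of a function with a single sign change has a single sign change. -/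
lemma SingleCrossing.integral : SingleCrossing N := by
  intro x y hx hxy hy hNx
  have hux : u x ≤ 0 := by
    by_contra h
    exact absurd (SingleCrossing.pos_of_pos hu hN hN0 hd hc ⟨hx, hxy.trans hy⟩ (not_le.1 h))
      (not_lt.2 hNx)
  have hanti : StrictAntiOn N (Set.Icc x y) := by
    refine strictAntiOn_of_hasDerivAt_neg (F' := fun z => c z * u z) (convex_Icc x y)
      (hN.mono fun z hz => ⟨hx.le.trans hz.1, hz.2.trans_lt hy⟩) ?_ ?_
    · rw [interior_Icc]; exact fun z hz => hd z ⟨hx.trans hz.1, hz.2.trans hy⟩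
    · rw [interior_Icc]
      intro z hz
      exact mul_neg_of_pos_of_neg (hc z ⟨hx.trans hz.1, hz.2.trans hy⟩)
        (hu x z hx hz.1 (hz.2.trans hy) hux)
  exact (hanti ⟨le_rfl, hxy.le⟩ ⟨hxy.le, le_rfl⟩ hxy).trans_le hNx

lemma SingleCrossing.neg_of_nonpos (h : ∀ x ∈ Set.Ioo (0 : ℝ) 1, u x ≤ 0) :
    ∀ x ∈ Set.Ioo (0 : ℝ) 1, N x < 0 := by
  intro x hx
  have hanti : StrictAntiOn N (Set.Icc 0 x) := by
    refine strictAntiOn_of_hasDerivAt_neg (F' := fun z => c z * u z) (convex_Icc 0 x)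
      (hN.mono fun z hz => ⟨hz.1, hz.2.trans_lt hx.2⟩) ?_ ?_
    · rw [interior_Icc]; exact fun z hz => hd z ⟨hz.1, hz.2.trans hx.2⟩
    · rw [interior_Icc]
      intro z hz
      have h2 := hu (z / 2) z (by linarith [hz.1]) (by linarith [hz.1]) (hz.2.trans hx.2)
        (h _ ⟨by linarith [hz.1], by linarith [hz.1, hz.2, hx.2]⟩)
      exact mul_neg_of_pos_of_neg (hc z ⟨hz.1, hz.2.trans hx.2⟩) h2
  have := hanti ⟨le_rfl, hx.1.le⟩ ⟨hx.1.le, le_rfl⟩ hx.1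
  rwa [hN0] at this

end SingleCrossing

lemma pos_of_hasDerivAt_pos {F F' : ℝ → ℝ} (h0 : F 0 = 0)
    (hd : ∀ x ∈ Set.Ico (0 : ℝ) 1, HasDerivAt F (F' x) x)
    (hp : ∀ x ∈ Set.Ioo (0 : ℝ) 1, 0 < F' x) {x : ℝ} (hx : x ∈ Set.Ioo (0 : ℝ) 1) : 0 < F x := by
  have hm : StrictMonoOn F (Set.Ico 0 1) := by
    refine strictMonoOn_of_hasDerivAt_pos (F' := F') (convex_Ico 0 1)
      (fun z hz => (hd z hz).continuousAt.continuousWithinAt) ?_ ?_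
    · rw [interior_Ico]; exact fun z hz => hd z ⟨hz.1.le, hz.2⟩
    · rw [interior_Ico]; exact hp
  have := hm ⟨le_rfl, one_pos⟩ ⟨hx.1.le, hx.2⟩ hx.1
  rwa [h0] at this

/-- Two functions `Φ`, `G` on `[0, 1]`, vanishing to second order at `0`, with first derivatives
`F₁`, `G₁` and second derivatives `0 < F₂ < G₂`, such that the derivative `c u` of the ratio
`ρ = F₂ / G₂` changes sign at most once, from positive to negative, and the slope `F₁ / G₁` of the
curve `(G, Φ)` tends to `0` at its far end `x = 1`. -/
structure RatioData (Φ G F₁ G₁ F₂ G₂ ρ c u : ℝ → ℝ) : Prop where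
  contΦ : ContinuousOn Φ (Set.Icc 0 1)
  contG : ContinuousOn G (Set.Icc 0 1)
  Φ_zero : Φ 0 = 0
  G_zero : G 0 = 0
  F₁_zero : F₁ 0 = 0
  G₁_zero : G₁ 0 = 0
  dΦ : ∀ x ∈ Set.Ico (0 : ℝ) 1, HasDerivAt Φ (F₁ x) x
  dG : ∀ x ∈ Set.Ico (0 : ℝ) 1, HasDerivAt G (G₁ x) x
  dF₁ : ∀ x ∈ Set.Ico (0 : ℝ) 1, HasDerivAt F₁ (F₂ x) x
  dG₁ : ∀ x ∈ Set.Ico (0 : ℝ) 1, HasDerivAt G₁ (G₂ x) x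
  F₂_pos : ∀ x ∈ Set.Ioo (0 : ℝ) 1, 0 < F₂ x
  F₂_lt : ∀ x ∈ Set.Ioo (0 : ℝ) 1, F₂ x < G₂ x
  dρ : ∀ x ∈ Set.Ico (0 : ℝ) 1, HasDerivAt ρ (c x * u x) x
  c_pos : ∀ x ∈ Set.Ioo (0 : ℝ) 1, 0 < c x
  F₂_eq : ∀ x ∈ Set.Ioo (0 : ℝ) 1, F₂ x = ρ x * G₂ x
  crossing : SingleCrossing u
  lim : Filter.Tendsto (fun x => F₁ x / G₁ x) (nhdsWithin 1 (Set.Iio 1)) (nhds 0)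

namespace RatioData

variable {Φ G F₁ G₁ F₂ G₂ ρ c u : ℝ → ℝ} (D : RatioData Φ G F₁ G₁ F₂ G₂ ρ c u)

include D

lemma G₂_pos {x : ℝ} (hx : x ∈ Set.Ioo (0 : ℝ) 1) : 0 < G₂ x := (D.F₂_pos x hx).trans (D.F₂_lt x hx)

lemma F₁_pos {x : ℝ} (hx : x ∈ Set.Ioo (0 : ℝ) 1) : 0 < F₁ x :=
  pos_of_hasDerivAt_pos D.F₁_zero D.dF₁ D.F₂_pos hx

lemma G₁_pos {x : ℝ} (hx : x ∈ Set.Ioo (0 : ℝ) 1) : 0 < G₁ x :=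
  pos_of_hasDerivAt_pos D.G₁_zero D.dG₁ (fun _ => D.G₂_pos) hx

lemma F₁_lt {x : ℝ} (hx : x ∈ Set.Ioo (0 : ℝ) 1) : F₁ x < G₁ x := by
  have := pos_of_hasDerivAt_pos (F := fun x => G₁ x - F₁ x) (F' := fun x => G₂ x - F₂ x)
    (by simp [D.F₁_zero, D.G₁_zero]) (fun x hx => (D.dG₁ x hx).sub (D.dF₁ x hx))
    (fun x hx => sub_pos.2 (D.F₂_lt x hx)) hx
  exact sub_pos.1 this

lemma strictMonoOn_G : StrictMonoOn G (Set.Icc 0 1) := by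
  refine strictMonoOn_of_hasDerivAt_pos (convex_Icc 0 1) D.contG (F' := G₁) ?_ ?_
  · rw [interior_Icc]; exact fun z hz => D.dG z ⟨hz.1.le, hz.2⟩
  · rw [interior_Icc]; exact fun z hz => D.G₁_pos hz

lemma strictMonoOn_Φ : StrictMonoOn Φ (Set.Icc 0 1) := by
  refine strictMonoOn_of_hasDerivAt_pos (convex_Icc 0 1) D.contΦ (F' := F₁) ?_ ?_
  · rw [interior_Icc]; exact fun z hz => D.dΦ z ⟨hz.1.le, hz.2⟩
  · rw [interior_Icc]; exact fun z hz => D.F₁_pos hz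

lemma Φ_le_G {x : ℝ} (hx : x ∈ Set.Icc (0 : ℝ) 1) : Φ x ≤ G x := by
  have hm : StrictMonoOn (fun x => G x - Φ x) (Set.Icc 0 1) := by
    refine strictMonoOn_of_hasDerivAt_pos (convex_Icc 0 1) (D.contG.sub D.contΦ)
      (F' := fun x => G₁ x - F₁ x) ?_ ?_
    · rw [interior_Icc]
      exact fun z hz => (D.dG z ⟨hz.1.le, hz.2⟩).sub (D.dΦ z ⟨hz.1.le, hz.2⟩)
    · rw [interior_Icc]; exact fun z hz => sub_pos.2 (D.F₁_lt hz)
  have := hm.monotoneOn ⟨le_rfl, zero_le_one⟩ hx hx.1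
  simp only [D.G_zero, D.Φ_zero, sub_zero] at this
  linarith

lemma G_pos {x : ℝ} (hx : x ∈ Set.Ioc (0 : ℝ) 1) : 0 < G x := by
  have := D.strictMonoOn_G ⟨le_rfl, zero_le_one⟩ ⟨hx.1.le, hx.2⟩ hx.1
  rwa [D.G_zero] at this

lemma Φ_pos {x : ℝ} (hx : x ∈ Set.Ioc (0 : ℝ) 1) : 0 < Φ x := by
  have := D.strictMonoOn_Φ ⟨le_rfl, zero_le_one⟩ ⟨hx.1.le, hx.2⟩ hx.1
  rwa [D.Φ_zero] at this

/-- `ρ G₁ - F₁`, the integral of `ρ' G₁`, carries the sign of the derivative of `F₁ / G₁`. -/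
lemma hasDerivAt_K {x : ℝ} (hx : x ∈ Set.Ioo (0 : ℝ) 1) :
    HasDerivAt (fun x => ρ x * G₁ x - F₁ x) ((c x * G₁ x) * u x) x := by
  have hx' : x ∈ Set.Ico (0 : ℝ) 1 := ⟨hx.1.le, hx.2⟩
  have := ((D.dρ x hx').mul (D.dG₁ x hx')).sub (D.dF₁ x hx')
  refine this.congr_deriv ?_
  rw [D.F₂_eq x hx]; ring

lemma continuousOn_K : ContinuousOn (fun x => ρ x * G₁ x - F₁ x) (Set.Ico 0 1) := fun x hx =>
  (((D.dρ x hx).continuousAt.mul (D.dG₁ x hx).continuousAt).sub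
    (D.dF₁ x hx).continuousAt).continuousWithinAt

lemma crossing_K : SingleCrossing fun x => ρ x * G₁ x - F₁ x :=
  D.crossing.integral D.continuousOn_K (by simp [D.F₁_zero, D.G₁_zero])
    (fun _ => D.hasDerivAt_K) fun x hx => mul_pos (D.c_pos x hx) (D.G₁_pos hx)

lemma hasDerivAt_H {x : ℝ} (hx : x ∈ Set.Ioo (0 : ℝ) 1) :
    HasDerivAt (fun x => F₁ x / G₁ x) (G₂ x / G₁ x ^ 2 * (ρ x * G₁ x - F₁ x)) x := by
  have hx' : x ∈ Set.Ico (0 : ℝ) 1 := ⟨hx.1.le, hx.2⟩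
  have := (D.dF₁ x hx').div (D.dG₁ x hx') (D.G₁_pos hx).ne'
  refine this.congr_deriv ?_
  rw [D.F₂_eq x hx]; ring

/-- `(F₁ / G₁) G - Φ`, minus the height at which the tangent of the curve `(G, Φ)` meets the vertical
axis; its zeros are the points whose tangent passes through the origin. -/
lemma hasDerivAt_N {x : ℝ} (hx : x ∈ Set.Ioo (0 : ℝ) 1) :
    HasDerivAt (fun x => F₁ x / G₁ x * G x - Φ x)
      ((G₂ x / G₁ x ^ 2 * G x) * (ρ x * G₁ x - F₁ x)) x := by
  have hx' : x ∈ Set.Ico (0 : ℝ) 1 := ⟨hx.1.le, hx.2⟩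
  have := ((D.hasDerivAt_H hx).mul (D.dG x hx')).sub (D.dΦ x hx')
  refine this.congr_deriv ?_
  have := (D.G₁_pos hx).ne'
  field_simp
  ring

lemma continuousOn_N : ContinuousOn (fun x => F₁ x / G₁ x * G x - Φ x) (Set.Ico 0 1) := by
  intro x hx
  rcases hx.1.eq_or_lt with h0 | h0
  · subst h0
    -- at `0` the quotient `F₁ / G₁` is `0 / 0`, but it stays in `[0, 1]` and `G` vanishes there
    have hG : ContinuousWithinAt G (Set.Ico 0 1) 0 :=
      (D.dG 0 ⟨le_rfl, one_pos⟩).continuousAt.continuousWithinAt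
    have hΦ : ContinuousWithinAt Φ (Set.Ico 0 1) 0 :=
      (D.dΦ 0 ⟨le_rfl, one_pos⟩).continuousAt.continuousWithinAt
    refine ContinuousWithinAt.sub ?_ hΦ
    unfold ContinuousWithinAt at hG ⊢
    simp only [D.G_zero, mul_zero] at hG ⊢
    refine squeeze_zero_norm' ?_ hG
    filter_upwards [self_mem_nhdsWithin] with z hz
    rcases hz.1.eq_or_lt with h1 | h1
    · rw [← h1, D.G_zero]; simp
    · have hz' : z ∈ Set.Ioo (0 : ℝ) 1 := ⟨h1, hz.2⟩
      have h2 := D.G₁_pos hz'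
      have h3 := D.F₁_pos hz'
      have h4 := D.G_pos ⟨h1, hz.2.le⟩
      rw [Real.norm_of_nonneg (by positivity)]
      refine mul_le_of_le_one_left h4.le ?_
      rw [div_le_one h2]
      exact (D.F₁_lt hz').le
  · exact (D.hasDerivAt_N ⟨h0, hx.2⟩).continuousAt.continuousWithinAt

lemma N_factor_pos {x : ℝ} (hx : x ∈ Set.Ioo (0 : ℝ) 1) : 0 < G₂ x / G₁ x ^ 2 * G x :=
  mul_pos (div_pos (D.G₂_pos hx) (pow_pos (D.G₁_pos hx) 2)) (D.G_pos ⟨hx.1, hx.2.le⟩)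

lemma N_zero : F₁ 0 / G₁ 0 * G 0 - Φ 0 = 0 := by simp [D.G_zero, D.Φ_zero]

lemma crossing_N : SingleCrossing fun x => F₁ x / G₁ x * G x - Φ x :=
  D.crossing_K.integral D.continuousOn_N D.N_zero (fun _ => D.hasDerivAt_N) fun _ => D.N_factor_pos

lemma exists_N_neg : ∃ x ∈ Set.Ioo (0 : ℝ) 1, F₁ x / G₁ x * G x - Φ x < 0 := by
  have hΦ := D.Φ_pos (x := 1 / 2) ⟨by norm_num, by norm_num⟩
  have hG := D.G_pos (x := 1) ⟨by norm_num, by norm_num⟩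
  have h1 := D.lim.eventually_lt_const (div_pos hΦ hG)
  have h2 : ∀ᶠ x in nhdsWithin (1 : ℝ) (Set.Iio 1), x ∈ Set.Ioo (1 / 2 : ℝ) 1 :=
    Ioo_mem_nhdsLT (by norm_num)
  obtain ⟨x, hx1, hx2⟩ := (h1.and h2).exists
  have hx : x ∈ Set.Ioo (0 : ℝ) 1 := ⟨by linarith [hx2.1], hx2.2⟩
  refine ⟨x, hx, ?_⟩
  have h3 : G x ≤ G 1 := D.strictMonoOn_G.monotoneOn ⟨hx.1.le, hx.2.le⟩ ⟨zero_le_one, le_rfl⟩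
      hx.2.le
  have h4 : Φ (1 / 2) < Φ x := D.strictMonoOn_Φ ⟨by norm_num, by norm_num⟩ ⟨hx.1.le, hx.2.le⟩ hx2.1
  have h5 : 0 < F₁ x / G₁ x := div_pos (D.F₁_pos hx) (D.G₁_pos hx)
  rw [lt_div_iff₀ hG] at hx1
  nlinarith

/-- The parameter `xc` of the tangency point, or `0` if there is none. The tangent meets the vertical
axis below the origin before `xc` and above it after `xc`, and the curve is strictly concave after
`xc`. A tangency point exists if and only if `ρ` increases somewhere. -/
lemma exists_tangency : ∃ xc ∈ Set.Ico (0 : ℝ) 1,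
    (∀ x ∈ Set.Ioo (0 : ℝ) 1, x < xc → 0 < F₁ x / G₁ x * G x - Φ x) ∧
    (∀ x ∈ Set.Ioo (0 : ℝ) 1, xc < x → F₁ x / G₁ x * G x - Φ x < 0) ∧
    (∀ x ∈ Set.Ioo (0 : ℝ) 1, xc < x → ρ x * G₁ x - F₁ x < 0) ∧
    F₁ xc / G₁ xc * G xc - Φ xc = 0 ∧
    (0 < xc ↔ ∃ x ∈ Set.Ioo (0 : ℝ) 1, 0 < u x) := by
  have hKd := fun x (hx : x ∈ Set.Ioo (0 : ℝ) 1) => D.hasDerivAt_K hx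
  have hKc := fun x (hx : x ∈ Set.Ioo (0 : ℝ) 1) => mul_pos (D.c_pos x hx) (D.G₁_pos hx)
  have hK0 : ρ 0 * G₁ 0 - F₁ 0 = 0 := by simp [D.F₁_zero, D.G₁_zero]
  have hNpos := fun x (hx : x ∈ Set.Ioo (0 : ℝ) 1) (h : 0 < ρ x * G₁ x - F₁ x) =>
    D.crossing_K.pos_of_pos D.continuousOn_N D.N_zero (fun _ => D.hasDerivAt_N)
      (fun _ => D.N_factor_pos) hx h
  by_cases h : ∃ x ∈ Set.Ioo (0 : ℝ) 1, 0 < u x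
  · obtain ⟨x₁, hx₁, hu₁⟩ := h
    have hN₁ := hNpos x₁ hx₁ (D.crossing.pos_of_pos D.continuousOn_K hK0 hKd hKc hx₁ hu₁)
    obtain ⟨x₂, hx₂, hN₂⟩ := D.exists_N_neg
    have h12 : x₁ ≤ x₂ := by
      by_contra h
      exact absurd (D.crossing_N x₂ x₁ hx₂.1 (not_le.1 h) hx₁.2 hN₂.le) (not_lt.2 hN₁.le)
    obtain ⟨xc, hxc, hNc⟩ := intermediate_value_Icc' h12
      (D.continuousOn_N.mono fun z hz => ⟨hx₁.1.le.trans hz.1, hz.2.trans_lt hx₂.2⟩)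
      (show (0 : ℝ) ∈ Set.Icc _ _ from ⟨hN₂.le, hN₁.le⟩)
    have hxc0 : 0 < xc := hx₁.1.trans_le hxc.1
    have hxc1 : xc < 1 := hxc.2.trans_lt hx₂.2
    simp only at hNc
    refine ⟨xc, ⟨hxc0.le, hxc1⟩, fun x hx hlt => ?_, fun x hx hlt => ?_, fun x hx hlt => ?_, hNc,
      fun _ => ⟨x₁, hx₁, hu₁⟩, fun _ => hxc0⟩
    · by_contra hcon
      exact absurd (D.crossing_N x xc hx.1 hlt hxc1 (not_lt.1 hcon)) (not_lt.2 hNc.ge)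
    · exact D.crossing_N xc x hxc0 hlt hx.2 hNc.le
    · refine D.crossing_K xc x hxc0 hlt hx.2 ?_
      by_contra hcon
      exact absurd hNc (hNpos xc ⟨hxc0, hxc1⟩ (not_le.1 hcon)).ne'
  · have hu : ∀ x ∈ Set.Ioo (0 : ℝ) 1, u x ≤ 0 := fun x hx => not_lt.1 fun hux => h ⟨x, hx, hux⟩
    have hK := D.crossing.neg_of_nonpos D.continuousOn_K hK0 hKd hKc hu
    have hN := D.crossing_K.neg_of_nonpos D.continuousOn_N D.N_zero (fun _ => D.hasDerivAt_N)
      (fun _ => D.N_factor_pos) fun x hx => (hK x hx).le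
    refine ⟨0, ⟨le_rfl, one_pos⟩, fun x hx hlt => absurd hlt (not_lt.2 hx.1.le),
      fun x hx _ => hN x hx, fun x hx _ => hK x hx, D.N_zero, fun h0 => absurd h0 (lt_irrefl _),
      fun h' => absurd h' h⟩

lemma hasDerivAt_ratio {x : ℝ} (hx : x ∈ Set.Ioo (0 : ℝ) 1) :
    HasDerivAt (fun x => Φ x / G x) (G₁ x / G x ^ 2 * (F₁ x / G₁ x * G x - Φ x)) x := by
  have hx' : x ∈ Set.Ico (0 : ℝ) 1 := ⟨hx.1.le, hx.2⟩
  have := (D.dΦ x hx').div (D.dG x hx') (D.G_pos ⟨hx.1, hx.2.le⟩).ne'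
  refine this.congr_deriv ?_
  have := (D.G₁_pos hx).ne'
  have := (D.G_pos ⟨hx.1, hx.2.le⟩).ne'
  field_simp

lemma ratio_factor_pos {x : ℝ} (hx : x ∈ Set.Ioo (0 : ℝ) 1) : 0 < G₁ x / G x ^ 2 :=
  div_pos (D.G₁_pos hx) (pow_pos (D.G_pos ⟨hx.1, hx.2.le⟩) 2)

lemma continuousOn_ratio : ContinuousOn (fun x => Φ x / G x) (Set.Ioc 0 1) :=
  (D.contΦ.mono Set.Ioc_subset_Icc_self).div (D.contG.mono Set.Ioc_subset_Icc_self)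
    fun _ hx => (D.G_pos hx).ne'

variable {xc : ℝ} (hxc : xc ∈ Set.Ico (0 : ℝ) 1)
  (h1 : ∀ x ∈ Set.Ioo (0 : ℝ) 1, x < xc → 0 < F₁ x / G₁ x * G x - Φ x)
  (h2 : ∀ x ∈ Set.Ioo (0 : ℝ) 1, xc < x → F₁ x / G₁ x * G x - Φ x < 0)
  (h3 : ∀ x ∈ Set.Ioo (0 : ℝ) 1, xc < x → ρ x * G₁ x - F₁ x < 0)
  (h4 : F₁ xc / G₁ xc * G xc - Φ xc = 0)

include hxc h1

lemma le_tangent_left {x : ℝ} (hx : x ∈ Set.Icc 0 xc) :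
    Φ x ≤ Φ xc / G xc * G x := by
  rcases hx.1.eq_or_lt with h | h
  · rw [← h, D.Φ_zero, D.G_zero, mul_zero]
  have hm : StrictMonoOn (fun x => Φ x / G x) (Set.Icc x xc) := by
    refine strictMonoOn_of_hasDerivAt_pos (convex_Icc x xc)
      (D.continuousOn_ratio.mono fun z hz => ⟨h.trans_le hz.1, hz.2.trans hxc.2.le⟩)
      (F' := fun x => G₁ x / G x ^ 2 * (F₁ x / G₁ x * G x - Φ x)) ?_ ?_
    · rw [interior_Icc]
      exact fun z hz => D.hasDerivAt_ratio ⟨h.trans hz.1, hz.2.trans hxc.2⟩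
    · rw [interior_Icc]
      intro z hz
      have hz' : z ∈ Set.Ioo (0 : ℝ) 1 := ⟨h.trans hz.1, hz.2.trans hxc.2⟩
      exact mul_pos (D.ratio_factor_pos hz') (h1 z hz' hz.2)
  have := hm.monotoneOn ⟨le_rfl, hx.2⟩ ⟨hx.2, le_rfl⟩ hx.2
  exact (div_le_iff₀ (D.G_pos ⟨h, hx.2.trans hxc.2.le⟩)).1 this

include h2 in
/-- The line through the origin and the tangency point lies above the curve `(G, Φ)`. -/
lemma le_tangent (h0 : 0 < xc) {x : ℝ} (hx : x ∈ Set.Icc (0 : ℝ) 1) :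
    Φ x ≤ Φ xc / G xc * G x := by
  rcases le_total x xc with h | h
  · exact D.le_tangent_left hxc h1 ⟨hx.1, h⟩
  have hm : StrictAntiOn (fun x => Φ x / G x) (Set.Icc xc x) := by
    refine strictAntiOn_of_hasDerivAt_neg (convex_Icc xc x)
      (D.continuousOn_ratio.mono fun z hz => ⟨h0.trans_le hz.1, hz.2.trans hx.2⟩)
      (F' := fun x => G₁ x / G x ^ 2 * (F₁ x / G₁ x * G x - Φ x)) ?_ ?_
    · rw [interior_Icc]
      exact fun z hz => D.hasDerivAt_ratio ⟨h0.trans hz.1, hz.2.trans_le hx.2⟩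
    · rw [interior_Icc]
      intro z hz
      have hz' : z ∈ Set.Ioo (0 : ℝ) 1 := ⟨h0.trans hz.1, hz.2.trans_le hx.2⟩
      exact mul_neg_of_pos_of_neg (D.ratio_factor_pos hz') (h2 z hz' hz.1)
  have := hm.antitoneOn ⟨le_rfl, h⟩ ⟨h, le_rfl⟩ h
  exact (div_le_iff₀ (D.G_pos ⟨h0.trans_le h, hx.2⟩)).1 this

include h3 h4 in
/-- Beyond the tangency point every tangent of the curve `(G, Φ)` lies above the whole curve. -/
lemma le_support {x₀ : ℝ} (hx₀ : x₀ ∈ Set.Ioo xc 1) {x : ℝ} (hx : x ∈ Set.Icc (0 : ℝ) 1) :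
    Φ x ≤ Φ x₀ + F₁ x₀ / G₁ x₀ * (G x - G x₀) := by
  have hx₀' : x₀ ∈ Set.Ioo (0 : ℝ) 1 := ⟨hxc.1.trans_lt hx₀.1, hx₀.2⟩
  set l := F₁ x₀ / G₁ x₀ with hl
  have hanti : ∀ y z, xc ≤ y → 0 < y → y < z → z < 1 → F₁ z / G₁ z < F₁ y / G₁ y := by
    intro y z hy hy0 hyz hz
    have hm : StrictAntiOn (fun x => F₁ x / G₁ x) (Set.Icc y z) := by
      refine strictAntiOn_of_hasDerivAt_neg (convex_Icc y z)
        (fun t ht => (D.hasDerivAt_H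
            ⟨hy0.trans_le ht.1, ht.2.trans_lt hz⟩).continuousAt.continuousWithinAt)
        (F' := fun x => G₂ x / G₁ x ^ 2 * (ρ x * G₁ x - F₁ x)) ?_ ?_
      · rw [interior_Icc]
        exact fun t ht => D.hasDerivAt_H ⟨hy0.trans ht.1, ht.2.trans hz⟩
      · rw [interior_Icc]
        intro t ht
        have ht' : t ∈ Set.Ioo (0 : ℝ) 1 := ⟨hy0.trans ht.1, ht.2.trans hz⟩
        exact mul_neg_of_pos_of_neg (div_pos (D.G₂_pos ht') (pow_pos (D.G₁_pos ht') 2))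
          (h3 t ht' (hy.trans_lt ht.1))
    exact hm ⟨le_rfl, hyz.le⟩ ⟨hyz.le, le_rfl⟩ hyz
  have hdD : ∀ z ∈ Set.Ioo (0 : ℝ) 1,
      HasDerivAt (fun x => Φ x - l * G x) (G₁ z * (F₁ z / G₁ z - l)) z := by
    intro z hz
    have hz' : z ∈ Set.Ico (0 : ℝ) 1 := ⟨hz.1.le, hz.2⟩
    refine ((D.dΦ z hz').sub ((D.dG z hz').const_mul l)).congr_deriv ?_
    have := (D.G₁_pos hz).ne'
    field_simp
  have hcD : ContinuousOn (fun x => Φ x - l * G x) (Set.Icc 0 1) :=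
    D.contΦ.sub (D.contG.const_smul l)
  suffices h : Φ x - l * G x ≤ Φ x₀ - l * G x₀ by linarith
  have hright : ∀ z ∈ Set.Icc x₀ 1, Φ z - l * G z ≤ Φ x₀ - l * G x₀ := by
    intro z hz
    have hm : StrictAntiOn (fun x => Φ x - l * G x) (Set.Icc x₀ 1) := by
      refine strictAntiOn_of_hasDerivAt_neg (convex_Icc x₀ 1)
        (hcD.mono fun t ht => ⟨hx₀'.1.le.trans ht.1, ht.2⟩)
        (F' := fun z => G₁ z * (F₁ z / G₁ z - l)) ?_ ?_
      · rw [interior_Icc]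
        exact fun t ht => hdD t ⟨hx₀'.1.trans ht.1, ht.2⟩
      · rw [interior_Icc]
        intro t ht
        exact mul_neg_of_pos_of_neg (D.G₁_pos ⟨hx₀'.1.trans ht.1, ht.2⟩)
          (sub_neg.2 (hanti x₀ t hx₀.1.le hx₀'.1 ht.1 ht.2))
    exact hm.antitoneOn ⟨le_rfl, hx₀'.2.le⟩ hz hz.1
  have hmid : ∀ z ∈ Set.Icc xc x₀, Φ z - l * G z ≤ Φ x₀ - l * G x₀ := by
    intro z hz
    have hm : StrictMonoOn (fun x => Φ x - l * G x) (Set.Icc xc x₀) := by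
      refine strictMonoOn_of_hasDerivAt_pos (convex_Icc xc x₀)
        (hcD.mono fun t ht => ⟨hxc.1.trans ht.1, ht.2.trans hx₀'.2.le⟩)
        (F' := fun z => G₁ z * (F₁ z / G₁ z - l)) ?_ ?_
      · rw [interior_Icc]
        exact fun t ht => hdD t ⟨hxc.1.trans_lt ht.1, ht.2.trans hx₀'.2⟩
      · rw [interior_Icc]
        intro t ht
        have ht0 : 0 < t := hxc.1.trans_lt ht.1
        exact mul_pos (D.G₁_pos ⟨ht0, ht.2.trans hx₀'.2⟩)
          (sub_pos.2 (hanti t x₀ ht.1.le ht0 ht.2 hx₀'.2))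
    exact hm.monotoneOn hz ⟨hx₀.1.le, le_rfl⟩ hz.2
  rcases le_total x₀ x with h | h
  · exact hright x ⟨h, hx.2⟩
  rcases le_total xc x with h' | h'
  · exact hmid x ⟨h', h⟩
  rcases hxc.1.eq_or_lt with h0 | h0
  · exact hmid x ⟨h0 ▸ hx.1, h⟩
  have hGc := D.G_pos ⟨h0, hxc.2.le⟩
  have hleft := D.le_tangent_left hxc h1 ⟨hx.1, h'⟩
  have hslope : Φ xc / G xc = F₁ xc / G₁ xc := by
    rw [div_eq_iff hGc.ne']; linarith
  have hlc : l < F₁ xc / G₁ xc := hanti xc x₀ le_rfl h0 hx₀.1 hx₀'.2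
  have hGx : G x ≤ G xc := D.strictMonoOn_G.monotoneOn hx ⟨h0.le, hxc.2.le⟩ h'
  have hm := hmid xc ⟨le_rfl, hx₀.1.le⟩
  rw [hslope] at hleft
  have : Φ xc = F₁ xc / G₁ xc * G xc := by linarith
  nlinarith

end RatioData

/-! ### The binary entropy in terms of the bias -/

section BinaryEntropyExpansion

/-- `psi x = log 2 - H((1 - x) / 2)` in nats, the entropy deficit of a bit of bias `x`. -/
noncomputable def psi (x : ℝ) : ℝ := Real.log 2 - Real.binEntropy ((1 - x) / 2)

/-- The inverse hyperbolic tangent, in the form in which it arises as the derivative of `psi`. -/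
noncomputable def ath (x : ℝ) : ℝ := (Real.log (1 + x) - Real.log (1 - x)) / 2

lemma continuous_psi : Continuous psi := by unfold psi; fun_prop

@[simp] lemma psi_zero : psi 0 = 0 := by
  have : ((1 : ℝ) - 0) / 2 = 2⁻¹ := by norm_num
  rw [psi, this, Real.binEntropy_two_inv, sub_self]

@[simp] lemma ath_zero : ath 0 = 0 := by simp [ath]

lemma hasDerivAt_psi {x : ℝ} (h1 : -1 < x) (h2 : x < 1) : HasDerivAt psi (ath x) x := by
  have h := (Real.hasDerivAt_binEntropy (p := (1 - x) / 2) (by linarith) (by linarith)).comp x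
    (((hasDerivAt_id x).const_sub 1).div_const 2)
  refine (h.const_sub (Real.log 2)).congr_deriv ?_
  have e1 : 1 - (1 - x) / 2 = (1 + x) / 2 := by ring
  rw [e1, Real.log_div (by linarith) two_ne_zero, Real.log_div (by linarith) two_ne_zero, ath]
  ring

lemma hasDerivAt_ath {x : ℝ} (h1 : -1 < x) (h2 : x < 1) :
    HasDerivAt ath (1 / (1 - x ^ 2)) x := by
  have ha := ((hasDerivAt_id x).const_add 1).log (show 1 + x ≠ 0 by linarith)
  have hb := ((hasDerivAt_id x).const_sub 1).log (show 1 - x ≠ 0 by linarith)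
  refine ((ha.sub hb).div_const 2).congr_deriv ?_
  have h3 : 1 + x ≠ 0 := by linarith
  have h4 : 1 - x ≠ 0 := by linarith
  have h5 : 1 - x ^ 2 ≠ 0 := by
    have : 1 - x ^ 2 = (1 + x) * (1 - x) := by ring
    rw [this]; exact mul_ne_zero h3 h4
  simp only [id]
  field_simp
  ring

lemma abs_mul_lt {m x : ℝ} (hm : m ^ 2 < 1) (hx : x ∈ Set.Icc (0 : ℝ) 1) :
    -1 < m * x ∧ m * x < 1 := by
  rw [← abs_lt]
  have : |m| < 1 := by rwa [← sq_lt_one_iff_abs_lt_one]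
  rw [abs_mul, abs_of_nonneg hx.1]
  nlinarith [hx.2, hx.1, abs_nonneg m]

lemma hasDerivAt_psi_mul {m x : ℝ} (hm : m ^ 2 < 1) (hx : x ∈ Set.Icc (0 : ℝ) 1) :
    HasDerivAt (fun x => psi (m * x)) (m * ath (m * x)) x := by
  have h := abs_mul_lt hm hx
  exact ((hasDerivAt_psi h.1 h.2).comp x ((hasDerivAt_id x).const_mul m)).congr_deriv (by ring)

lemma hasDerivAt_ath_mul {m x : ℝ} (hm : m ^ 2 < 1) (hx : x ∈ Set.Icc (0 : ℝ) 1) :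
    HasDerivAt (fun x => m * ath (m * x)) (m ^ 2 / (1 - m ^ 2 * x ^ 2)) x := by
  have h := abs_mul_lt hm hx
  refine (((hasDerivAt_ath h.1 h.2).comp x ((hasDerivAt_id x).const_mul m)).const_mul m).congr_deriv
      ?_
  rw [mul_pow]; ring

lemma tendsto_ath : Filter.Tendsto ath (nhdsWithin 1 (Set.Iio 1)) Filter.atTop := by
  have h1 : Filter.Tendsto (fun x : ℝ => 1 - x) (nhdsWithin 1 (Set.Iio 1))
      (nhdsWithin 0 (Set.Ioi 0)) := by
    refine tendsto_nhdsWithin_iff.2 ⟨?_, ?_⟩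
    · have : Filter.Tendsto (fun x : ℝ => 1 - x) (nhds 1) (nhds (1 - 1)) := by
        exact (continuous_const.sub continuous_id).tendsto 1
      rw [sub_self] at this
      exact this.mono_left nhdsWithin_le_nhds
    · filter_upwards [self_mem_nhdsWithin] with x hx
      exact sub_pos.2 (Set.mem_Iio.1 hx)
  have h2 := Real.tendsto_log_nhdsGT_zero.comp h1
  have h3 : Filter.Tendsto (fun x : ℝ => Real.log (1 + x)) (nhdsWithin 1 (Set.Iio 1))
      (nhds (Real.log (1 + 1))) := by
    have : ContinuousAt (fun x : ℝ => Real.log (1 + x)) 1 :=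
      (continuousAt_const.add continuousAt_id).log (by norm_num)
    exact this.tendsto.mono_left nhdsWithin_le_nhds
  have h4 := h3.add_atTop (Filter.tendsto_neg_atBot_atTop.comp h2)
  refine (h4.atTop_div_const two_pos).congr fun x => ?_
  simp [ath, sub_eq_add_neg]

end BinaryEntropyExpansion

section Curve

variable (w a α β : ℝ)

/-- The function `f` in nats, as a function of the bias `x = 1 - 2 r`. -/
noncomputable def curveΦ (x : ℝ) : ℝ := w * psi (α * x) + (1 - w) * psi (β * x) - psi (a * x)

/-- The function `g` in nats, as a function of the bias `x = 1 - 2 r`. -/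
noncomputable def curveG (x : ℝ) : ℝ := psi x - psi (a * x)

/-- The derivative of `curveΦ`. -/
noncomputable def curveF₁ (x : ℝ) : ℝ :=
  w * (α * ath (α * x)) + (1 - w) * (β * ath (β * x)) - a * ath (a * x)

/-- The derivative of `curveG`. -/
noncomputable def curveG₁ (x : ℝ) : ℝ := ath x - a * ath (a * x)

/-- The factor of the derivative of the ratio of second derivatives that carries its sign. -/
noncomputable def curveU (x : ℝ) : ℝ :=
  (1 - w) * (1 - β ^ 2) / (1 - a ^ 2) * (a ^ 2 - β ^ 2) / (1 - β ^ 2 * x ^ 2) ^ 2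
    - w * (1 - α ^ 2) / (1 - a ^ 2) * (α ^ 2 - a ^ 2) / (1 - α ^ 2 * x ^ 2) ^ 2

variable {w a α β} (hw0 : 0 < w) (hw1 : w < 1) (ha : a ^ 2 < 1) (hα : α ^ 2 < 1) (hβ : β ^ 2 < 1)
  (haα : a ^ 2 < α ^ 2) (hmix : a ^ 2 < w * α ^ 2 + (1 - w) * β ^ 2)

include hw0 hw1 ha hα hβ haα

lemma curveU_neg {x y : ℝ} (hx : 0 ≤ x) (hxy : x < y) (hy : y < 1) (h : curveU w a α β x ≤ 0) :
    curveU w a α β y < 0 := by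
  unfold curveU at h ⊢
  set A := α ^ 2
  set B := β ^ 2
  set C := a ^ 2
  have hC : 0 < 1 - C := by linarith
  set k₁ := w * (1 - A) / (1 - C) * (A - C) with hk₁
  set k₂ := (1 - w) * (1 - B) / (1 - C) * (C - B) with hk₂
  have hB0 : 0 ≤ B := sq_nonneg _
  have hA0 : 0 ≤ A := sq_nonneg _
  have hk₁' : 0 < k₁ :=
    mul_pos (div_pos (mul_pos hw0 (by linarith)) hC) (by linarith)
  have hst : x ^ 2 < y ^ 2 := by nlinarith
  have hs1 : y ^ 2 < 1 := by nlinarith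
  have ht0 : 0 ≤ x ^ 2 := sq_nonneg x
  generalize x ^ 2 = t at *
  generalize y ^ 2 = s at *
  have p1 : 0 < 1 - A * s := by nlinarith
  have p2 : 0 < 1 - B * s := by nlinarith
  have p3 : 0 < 1 - A * t := by nlinarith
  have p4 : 0 < 1 - B * t := by nlinarith
  rcases le_or_gt k₂ 0 with hk | hk
  · have h1 : k₂ / (1 - B * s) ^ 2 ≤ 0 := div_nonpos_of_nonpos_of_nonneg hk (by positivity)
    have h2 : 0 < k₁ / (1 - A * s) ^ 2 := by positivity
    linarith
  have hBC : B < C := by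
    by_contra hcon
    refine absurd hk (not_lt.2 (mul_nonpos_of_nonneg_of_nonpos ?_ (by linarith)))
    exact div_nonneg (mul_nonneg (by linarith) (by linarith)) hC.le
  have h1 : k₂ * (1 - A * t) ^ 2 ≤ k₁ * (1 - B * t) ^ 2 := by
    have := sub_nonpos.1 h
    rwa [div_le_div_iff₀ (by positivity) (by positivity)] at this
  have h2 : (1 - A * s) * (1 - B * t) < (1 - B * s) * (1 - A * t) := by nlinarith
  have h3 : ((1 - A * s) * (1 - B * t)) ^ 2 < ((1 - B * s) * (1 - A * t)) ^ 2 :=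
    pow_lt_pow_left₀ h2 (by positivity) two_ne_zero
  rw [sub_neg, div_lt_div_iff₀ (by positivity) (by positivity)]
  have h4 : k₂ * (1 - A * s) ^ 2 * (1 - B * t) ^ 2 < k₁ * (1 - B * s) ^ 2 * (1 - B * t) ^ 2 := by
    calc k₂ * (1 - A * s) ^ 2 * (1 - B * t) ^ 2 = k₂ * ((1 - A * s) * (1 - B * t)) ^ 2 := by ring
      _ < k₂ * ((1 - B * s) * (1 - A * t)) ^ 2 := mul_lt_mul_of_pos_left h3 hk
      _ = (k₂ * (1 - A * t) ^ 2) * (1 - B * s) ^ 2 := by ring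
      _ ≤ (k₁ * (1 - B * t) ^ 2) * (1 - B * s) ^ 2 := by gcongr
      _ = _ := by ring
  exact lt_of_mul_lt_mul_right h4 (by positivity)

include hmix

lemma curve_ratioData : RatioData (curveΦ w a α β) (curveG a) (curveF₁ w a α β) (curveG₁ a)
    (fun x => w * (α ^ 2 / (1 - α ^ 2 * x ^ 2)) + (1 - w) * (β ^ 2 / (1 - β ^ 2 * x ^ 2))
      - a ^ 2 / (1 - a ^ 2 * x ^ 2))
    (fun x => 1 / (1 - x ^ 2) - a ^ 2 / (1 - a ^ 2 * x ^ 2))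
    (fun x => 1 - w * (1 - α ^ 2) / (1 - a ^ 2) * ((1 - a ^ 2 * x ^ 2) / (1 - α ^ 2 * x ^ 2))
      - (1 - w) * (1 - β ^ 2) / (1 - a ^ 2) * ((1 - a ^ 2 * x ^ 2) / (1 - β ^ 2 * x ^ 2)))
    (fun x => 2 * x) (curveU w a α β) := by
  have hpos : ∀ {m x : ℝ}, m ^ 2 < 1 → x ∈ Set.Icc (0 : ℝ) 1 → 0 < 1 - m ^ 2 * x ^ 2 := by
    intro m x hm hx
    have : x ^ 2 ≤ 1 := by nlinarith [hx.1, hx.2]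
    nlinarith [sq_nonneg m]
  have hI : ∀ {x : ℝ}, x ∈ Set.Ico (0 : ℝ) 1 → x ∈ Set.Icc (0 : ℝ) 1 := fun h => ⟨h.1, h.2.le⟩
  have hO : ∀ {x : ℝ}, x ∈ Set.Ioo (0 : ℝ) 1 → x ∈ Set.Icc (0 : ℝ) 1 := fun h => ⟨h.1.le, h.2.le⟩
  have hcΦ : Continuous (curveΦ w a α β) := by
    have := continuous_psi
    unfold curveΦ; fun_prop
  have hcG : Continuous (curveG a) := by
    have := continuous_psi
    unfold curveG; fun_prop
  have hdF : ∀ x ∈ Set.Icc (0 : ℝ) 1, HasDerivAt (curveF₁ w a α β)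
      (w * (α ^ 2 / (1 - α ^ 2 * x ^ 2)) + (1 - w) * (β ^ 2 / (1 - β ^ 2 * x ^ 2))
      - a ^ 2 / (1 - a ^ 2 * x ^ 2)) x := fun x hx =>
    (((hasDerivAt_ath_mul hα hx).const_mul w).add
      ((hasDerivAt_ath_mul hβ hx).const_mul (1 - w))).sub (hasDerivAt_ath_mul ha hx)
  have hx2 : ∀ {x : ℝ}, x ∈ Set.Ioo (0 : ℝ) 1 → 0 < 1 - x ^ 2 := fun {x} hx => by
    nlinarith [hx.1, hx.2]
  refine ⟨hcΦ.continuousOn, hcG.continuousOn, by simp [curveΦ], by simp [curveG],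
    by simp [curveF₁], by simp [curveG₁], fun x hx => ?_, fun x hx => ?_, fun x hx => hdF x (hI hx),
    fun x hx => ?_, fun x hx => ?_, fun x hx => ?_, fun x hx => ?_, fun x hx => ?_,
    fun x hx => ?_, fun x y hx hxy hy h => curveU_neg hw0 hw1 ha hα hβ haα hx.le hxy hy h, ?_⟩
  · exact (((hasDerivAt_psi_mul hα (hI hx)).const_mul w).add
      ((hasDerivAt_psi_mul hβ (hI hx)).const_mul (1 - w))).sub (hasDerivAt_psi_mul ha (hI hx))
  · exact (hasDerivAt_psi (by linarith [hx.1]) hx.2).sub (hasDerivAt_psi_mul ha (hI hx))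
  · exact (hasDerivAt_ath (by linarith [hx.1]) hx.2).sub (hasDerivAt_ath_mul ha (hI hx))
  · -- the tangent at `a ^ 2` of the convex function `m ↦ m / (1 - m t)`,
    -- averaged over `α ^ 2` and `β ^ 2`
    have pC := hpos ha (hO hx)
    have htan : ∀ m : ℝ, m ^ 2 < 1 → a ^ 2 / (1 - a ^ 2 * x ^ 2)
        + (m ^ 2 - a ^ 2) / (1 - a ^ 2 * x ^ 2) ^ 2 ≤ m ^ 2 / (1 - m ^ 2 * x ^ 2) := by
      intro m hm
      have pm := hpos hm (hO hx)
      have : m ^ 2 / (1 - m ^ 2 * x ^ 2) - (a ^ 2 / (1 - a ^ 2 * x ^ 2)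
        + (m ^ 2 - a ^ 2) / (1 - a ^ 2 * x ^ 2) ^ 2)
          = (m ^ 2 - a ^ 2) ^ 2 * x ^ 2 / ((1 - m ^ 2 * x ^ 2) * (1 - a ^ 2 * x ^ 2) ^ 2) := by
        have e1 := pC.ne'
        have e2 := pm.ne'
        generalize m ^ 2 = m' at *
        generalize a ^ 2 = c at *
        generalize x ^ 2 = t at *
        rw [eq_div_iff (by positivity), sub_mul, add_mul]
        have e3 : m' / (1 - m' * t) * ((1 - m' * t) * (1 - c * t) ^ 2) = m' * (1 - c * t) ^ 2 := by
          field_simp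
        have e4 : c / (1 - c * t) * ((1 - m' * t) * (1 - c * t) ^ 2)
            = c * (1 - m' * t) * (1 - c * t) := by
          field_simp
        have e5 : (m' - c) / (1 - c * t) ^ 2 * ((1 - m' * t) * (1 - c * t) ^ 2)
            = (m' - c) * (1 - m' * t) := by
          field_simp
        rw [e3, e4, e5]
        ring
      have h2 : 0 ≤ (m ^ 2 - a ^ 2) ^ 2 * x ^ 2
          / ((1 - m ^ 2 * x ^ 2) * (1 - a ^ 2 * x ^ 2) ^ 2) := by
        positivity
      linarith
    have h1 := mul_le_mul_of_nonneg_left (htan α hα) hw0.le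
    have h2 := mul_le_mul_of_nonneg_left (htan β hβ) (sub_nonneg.2 hw1.le)
    have h3 : 0 < (w * α ^ 2 + (1 - w) * β ^ 2 - a ^ 2) / (1 - a ^ 2 * x ^ 2) ^ 2 :=
      div_pos (by linarith) (by positivity)
    have h4 : w * (a ^ 2 / (1 - a ^ 2 * x ^ 2) + (α ^ 2 - a ^ 2) / (1 - a ^ 2 * x ^ 2) ^ 2)
        + (1 - w) * (a ^ 2 / (1 - a ^ 2 * x ^ 2) + (β ^ 2 - a ^ 2) / (1 - a ^ 2 * x ^ 2) ^ 2)
        = a ^ 2 / (1 - a ^ 2 * x ^ 2)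
          + (w * α ^ 2 + (1 - w) * β ^ 2 - a ^ 2) / (1 - a ^ 2 * x ^ 2) ^ 2 := by ring
    linarith
  · have hlt : ∀ m : ℝ, m ^ 2 < 1 → m ^ 2 / (1 - m ^ 2 * x ^ 2) < 1 / (1 - x ^ 2) := by
      intro m hm
      rw [div_lt_div_iff₀ (hpos hm (hO hx)) (hx2 hx)]
      nlinarith
    have h1 := mul_lt_mul_of_pos_left (hlt α hα) hw0
    have h2 := mul_lt_mul_of_pos_left (hlt β hβ) (sub_pos.2 hw1)
    linarith
  · have hq : ∀ m : ℝ, m ^ 2 < 1 → HasDerivAt (fun x => (1 - a ^ 2 * x ^ 2) / (1 - m ^ 2 * x ^ 2))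
        (2 * x * (m ^ 2 - a ^ 2) / (1 - m ^ 2 * x ^ 2) ^ 2) x := by
      intro m hm
      have hd : ∀ l : ℝ, HasDerivAt (fun x => 1 - l ^ 2 * x ^ 2) (-(l ^ 2 * (2 * x))) x := by
        intro l
        refine (((hasDerivAt_pow 2 x).const_mul (l ^ 2)).const_sub 1).congr_deriv ?_
        norm_num
      refine ((hd a).div (hd m) (hpos hm (hI hx)).ne').congr_deriv ?_
      congr 1
      ring
    refine ((((hq α hα).const_mul (w * (1 - α ^ 2) / (1 - a ^ 2))).const_sub 1).sub
      ((hq β hβ).const_mul ((1 - w) * (1 - β ^ 2) / (1 - a ^ 2)))).congr_deriv ?_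
    unfold curveU
    ring
  · show 0 < 2 * x
    linarith [hx.1]
  · have e1 := (hpos ha (hO hx)).ne'
    have e2 := (hpos hα (hO hx)).ne'
    have e3 := (hpos hβ (hO hx)).ne'
    have e4 := (hx2 hx).ne'
    have e5 : 1 - a ^ 2 ≠ 0 := by linarith
    -- `1 / (1 - t) - m / (1 - m t) = (1 - m) / ((1 - t) (1 - m t))`
    have hm : ∀ m : ℝ, 1 - m ^ 2 * x ^ 2 ≠ 0 →
        m ^ 2 / (1 - m ^ 2 * x ^ 2)
          = 1 / (1 - x ^ 2) - (1 - m ^ 2) / ((1 - x ^ 2) * (1 - m ^ 2 * x ^ 2)) := by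
      intro m h
      field_simp
      ring
    rw [hm α e2, hm β e3, hm a e1]
    clear hm
    generalize 1 - a ^ 2 * x ^ 2 = P at *
    generalize 1 - α ^ 2 * x ^ 2 = P₁ at *
    generalize 1 - β ^ 2 * x ^ 2 = P₂ at *
    generalize 1 - x ^ 2 = T at *
    generalize 1 - a ^ 2 = Q at *
    field_simp
    ring
  · have h1 : ContinuousAt (curveF₁ w a α β) 1 := (hdF 1 ⟨zero_le_one, le_rfl⟩).continuousAt
    have h2 := (hasDerivAt_ath_mul ha (x := 1) ⟨zero_le_one, le_rfl⟩).continuousAt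
    have h3 := tendsto_ath.atTop_add (h2.neg.tendsto.mono_left nhdsWithin_le_nhds)
    refine (h1.tendsto.mono_left nhdsWithin_le_nhds).div_atTop (h3.congr fun x => ?_)
    simp [curveG₁, sub_eq_add_neg]

end Curve

/-! ### The functions `f`, `g` and the tangency condition -/

section Interface

lemma binEntropy_bconv (r s : ℝ) :
    Real.binEntropy (bconv r s) = Real.log 2 - psi ((1 - 2 * s) * (1 - 2 * r)) := by
  have : (1 - (1 - 2 * s) * (1 - 2 * r)) / 2 = bconv r s := by unfold bconv; ring
  rw [psi, this]; ring

variable {p q : ℝ}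

/-- The function `f`, in nats and in terms of the bias. -/
noncomputable def fBias (p q : ℝ) : ℝ → ℝ :=
  curveΦ (1 - bconv p q) (1 - 2 * q) (1 - 2 * (p * q / (1 - bconv p q)))
    (1 - 2 * (p * (1 - q) / bconv p q))

/-- The derivative of `fBias`. -/
noncomputable def fBias₁ (p q : ℝ) : ℝ → ℝ :=
  curveF₁ (1 - bconv p q) (1 - 2 * q) (1 - 2 * (p * q / (1 - bconv p q)))
    (1 - 2 * (p * (1 - q) / bconv p q))

lemma f_eq_fBias (p q r : ℝ) : f p q r = fBias p q (1 - 2 * r) / Real.log 2 := by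
  have := log_two_pos.ne'
  unfold f h₂ fBias curveΦ
  rw [binEntropy_bconv, binEntropy_bconv, binEntropy_bconv]
  field_simp
  ring

lemma g_eq_curveG (q r : ℝ) : g q r = curveG (1 - 2 * q) (1 - 2 * r) / Real.log 2 := by
  have := log_two_pos.ne'
  have e : (1 - (1 - 2 * r)) / 2 = r := by ring
  unfold g h₂ curveG
  rw [binEntropy_bconv]
  unfold psi
  rw [e]
  field_simp
  ring

lemma continuous_f (p q : ℝ) : Continuous (f p q) := by
  have : f p q = fun r => fBias p q (1 - 2 * r) / Real.log 2 := funext (f_eq_fBias p q)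
  rw [this]
  have := continuous_psi
  unfold fBias curveΦ
  fun_prop

lemma continuous_g (q : ℝ) : Continuous (g q) := by
  have : g q = fun r => curveG (1 - 2 * q) (1 - 2 * r) / Real.log 2 := funext (g_eq_curveG q)
  rw [this]
  have := continuous_psi
  unfold curveG
  fun_prop

lemma bconv_one_sub (r s : ℝ) : bconv (1 - r) s = 1 - bconv r s := by unfold bconv; ring

lemma f_one_sub (p q r : ℝ) : f p q (1 - r) = f p q r := by
  simp only [f, h₂, bconv_one_sub r, Real.binEntropy_one_sub]

lemma g_one_sub (q r : ℝ) : g q (1 - r) = g q r := by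
  simp only [g, h₂, bconv_one_sub, Real.binEntropy_one_sub]

lemma g_half (q : ℝ) : g q (1 / 2) = 0 := by
  rw [g_eq_curveG]; simp [curveG]

lemma g_zero (q : ℝ) : g q 0 = h₂ q := by simp [g, h₂, bconv]

lemma bconv_mem (hp : p ∈ Set.Ioo (0 : ℝ) (1 / 2)) (hq : q ∈ Set.Ioo (0 : ℝ) (1 / 2)) :
    bconv p q ∈ Set.Ioo (0 : ℝ) 1 := by
  obtain ⟨hp0, hp1⟩ := hp
  obtain ⟨hq0, hq1⟩ := hq
  unfold bconv
  constructor <;> nlinarith [mul_pos hp0 hq0]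

lemma add_mul_binEntropy_div {x y : ℝ} (h : 0 < x + y) :
    (x + y) * Real.binEntropy (x / (x + y))
      = Real.negMulLog x + Real.negMulLog y - Real.negMulLog (x + y) := by
  have e1 : 1 - x / (x + y) = y / (x + y) := by field_simp; ring
  have h1 := Real.negMulLog_mul (x / (x + y)) (x + y)
  have h2 := Real.negMulLog_mul (y / (x + y)) (x + y)
  rw [div_mul_cancel₀ _ h.ne'] at h1 h2
  rw [Real.binEntropy_eq_negMulLog_add_negMulLog_one_sub, e1, h1, h2]
  field_simp
  ring

/-- The chain rule for the entropy of `(Z, W)` expanded along `Z ⊕ W`. -/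
lemma f_zero (hp : p ∈ Set.Ioo (0 : ℝ) (1 / 2)) (hq : q ∈ Set.Ioo (0 : ℝ) (1 / 2)) :
    f p q 0 = h₂ (bconv p q) - h₂ p := by
  obtain ⟨hs0, hs1⟩ := bconv_mem hp hq
  have hz : ∀ s, bconv 0 s = s := fun s => by unfold bconv; ring
  have k1 := add_mul_binEntropy_div (x := p * q) (y := (1 - p) * (1 - q)) (by
    have : p * q + (1 - p) * (1 - q) = 1 - bconv p q := by unfold bconv; ring
    linarith)
  have k2 := add_mul_binEntropy_div (x := p * (1 - q)) (y := q * (1 - p)) hs0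
  have e1 : p * q + (1 - p) * (1 - q) = 1 - bconv p q := by unfold bconv; ring
  have e2 : p * (1 - q) + q * (1 - p) = bconv p q := rfl
  rw [e1, Real.negMulLog_mul, Real.negMulLog_mul] at k1
  rw [e2, Real.negMulLog_mul, Real.negMulLog_mul] at k2
  have := log_two_pos.ne'
  unfold f h₂
  simp only [hz]
  field_simp
  rw [Real.binEntropy_eq_negMulLog_add_negMulLog_one_sub q,
    Real.binEntropy_eq_negMulLog_add_negMulLog_one_sub p,
    Real.binEntropy_eq_negMulLog_add_negMulLog_one_sub (bconv p q)]
  linear_combination -k1 - k2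

section Parameters

variable (hp : p ∈ Set.Ioo (0 : ℝ) (1 / 2)) (hq : q ∈ Set.Ioo (0 : ℝ) (1 / 2))

include hp hq

/-- The parameters of the curve in terms of the biases `a = 1 - 2 q` and `b = 1 - 2 p`. -/
lemma parameters : ∃ a b : ℝ, a = 1 - 2 * q ∧ b = 1 - 2 * p ∧ 0 < a ∧ a < 1 ∧ 0 < b ∧ b < 1 ∧
    1 - bconv p q = (1 + a * b) / 2 ∧
    1 - 2 * (p * q / (1 - bconv p q)) = (a + b) / (1 + a * b) ∧
    1 - 2 * (p * (1 - q) / bconv p q) = (b - a) / (1 - a * b) := by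
  obtain ⟨hs0, hs1⟩ := bconv_mem hp hq
  refine ⟨1 - 2 * q, 1 - 2 * p, rfl, rfl, by linarith [hq.2], by linarith [hq.1],
    by linarith [hp.2], by linarith [hp.1], by unfold bconv; ring, ?_, ?_⟩
  · have e : 1 + (1 - 2 * q) * (1 - 2 * p) = 2 * (1 - bconv p q) := by unfold bconv; ring
    have : 1 - bconv p q ≠ 0 := by linarith
    rw [e]
    field_simp
    unfold bconv; ring
  · have e : 1 - (1 - 2 * q) * (1 - 2 * p) = 2 * bconv p q := by unfold bconv; ring
    rw [e]
    field_simp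
    unfold bconv; ring

lemma ratioData : ∃ F₂ G₂ ρ c : ℝ → ℝ, RatioData (fBias p q) (curveG (1 - 2 * q)) (fBias₁ p q)
    (curveG₁ (1 - 2 * q)) F₂ G₂ ρ c (curveU (1 - bconv p q) (1 - 2 * q)
      (1 - 2 * (p * q / (1 - bconv p q))) (1 - 2 * (p * (1 - q) / bconv p q))) := by
  obtain ⟨hs0, hs1⟩ := bconv_mem hp hq
  obtain ⟨a, b, ha, hb, ha0, ha1, hb0, hb1, hw, hα, hβ⟩ := parameters hp hq
  have hab : a * b < 1 := by nlinarith
  have hab0 : 0 < a * b := mul_pos ha0 hb0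
  have d1 : 0 < 1 + a * b := by linarith
  have d2 : 0 < 1 - a * b := by linarith
  have hA : 0 < (1 - a ^ 2) * (1 - b ^ 2) := mul_pos (by nlinarith) (by nlinarith)
  refine ⟨_, _, _, _, curve_ratioData (by linarith) (by linarith) ?_ ?_ ?_ ?_ ?_⟩
  · rw [← ha]; nlinarith
  · rw [hα, div_pow, div_lt_one (by positivity)]; nlinarith
  · rw [hβ, div_pow, div_lt_one (by positivity)]; nlinarith
  · rw [hα, ← ha, div_pow, lt_div_iff₀ (by positivity), ← mul_pow]
    refine pow_lt_pow_left₀ ?_ (by positivity) two_ne_zero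
    nlinarith
  · rw [hα, hβ, ← ha, hw]
    have e : (1 + a * b) / 2 * ((a + b) / (1 + a * b)) ^ 2
        + (1 - (1 + a * b) / 2) * ((b - a) / (1 - a * b)) ^ 2 - a ^ 2
        = b ^ 2 * (1 - a ^ 2) ^ 2 / ((1 + a * b) * (1 - a * b)) := by
      field_simp
      ring
    have h2 : 0 < b ^ 2 * (1 - a ^ 2) ^ 2 / ((1 + a * b) * (1 - a * b)) := by
      have : 0 < 1 - a ^ 2 := by nlinarith
      positivity
    linarith

/-- Having a single sign change, `curveU` is positive somewhere if and only if it is positive at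
`0`, where it is a positive multiple of `5 a ^ 2 - 1 - a ^ 2 (a ^ 2 + 3) b ^ 2`. -/
lemma exists_curveU_pos_iff : (∃ x ∈ Set.Ioo (0 : ℝ) 1, 0 < curveU (1 - bconv p q) (1 - 2 * q)
      (1 - 2 * (p * q / (1 - bconv p q))) (1 - 2 * (p * (1 - q) / bconv p q)) x) ↔
    (1 - 2 * q) ^ 2 * ((1 - 2 * q) ^ 2 + 3) * (1 - 2 * p) ^ 2 < 5 * (1 - 2 * q) ^ 2 - 1 := by
  obtain ⟨hs0, hs1⟩ := bconv_mem hp hq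
  obtain ⟨a, b, ha, hb, ha0, ha1, hb0, hb1, hw, hα, hβ⟩ := parameters hp hq
  have hab : a * b < 1 := by nlinarith
  have hab0 : 0 < a * b := mul_pos ha0 hb0
  have d1 : 0 < 1 + a * b := by linarith
  have d2 : 0 < 1 - a * b := by linarith
  have d3 : 0 < 1 - a ^ 2 := by nlinarith
  have d4 : 0 < 1 - b ^ 2 := by nlinarith
  have hA : 0 < (1 - a ^ 2) * (1 - b ^ 2) := mul_pos d3 d4
  have hα1 : ((a + b) / (1 + a * b)) ^ 2 < 1 := by
    rw [div_pow, div_lt_one (by positivity)]; nlinarith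
  have hβ1 : ((b - a) / (1 - a * b)) ^ 2 < 1 := by
    rw [div_pow, div_lt_one (by positivity)]; nlinarith
  have haα : a ^ 2 < ((a + b) / (1 + a * b)) ^ 2 := by
    rw [div_pow, lt_div_iff₀ (by positivity), ← mul_pow]
    refine pow_lt_pow_left₀ ?_ (by positivity) two_ne_zero
    nlinarith
  have hw0 : 0 < (1 + a * b) / 2 := by positivity
  have hw1 : (1 + a * b) / 2 < 1 := by linarith
  rw [hα, hβ, ← ha, ← hb, hw]
  set α := (a + b) / (1 + a * b)
  set β := (b - a) / (1 - a * b)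
  have hU0 : curveU ((1 + a * b) / 2) a α β 0
      = (1 - b ^ 2) * (1 - a ^ 2) * b ^ 2 / ((1 + a * b) ^ 3 * (1 - a * b) ^ 3)
        * (5 * a ^ 2 - 1 - a ^ 2 * (a ^ 2 + 3) * b ^ 2) := by
    have e1 : 1 - α ^ 2 = (1 - a ^ 2) * (1 - b ^ 2) / (1 + a * b) ^ 2 := by
      simp only [α]; field_simp; ring
    have e2 : 1 - β ^ 2 = (1 - a ^ 2) * (1 - b ^ 2) / (1 - a * b) ^ 2 := by
      simp only [β]
      rw [eq_div_iff (pow_ne_zero 2 d2.ne'), sub_mul, div_pow,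
        div_mul_cancel₀ _ (pow_ne_zero 2 d2.ne')]
      ring
    have e3 : α ^ 2 - a ^ 2 = b * (1 - a ^ 2) * (2 * a + b + a ^ 2 * b) / (1 + a * b) ^ 2 := by
      simp only [α]; field_simp; ring
    have e4 : a ^ 2 - β ^ 2 = b * (1 - a ^ 2) * (2 * a - b - a ^ 2 * b) / (1 - a * b) ^ 2 := by
      simp only [β]
      rw [eq_div_iff (pow_ne_zero 2 d2.ne'), sub_mul, div_pow,
        div_mul_cancel₀ _ (pow_ne_zero 2 d2.ne')]
      ring
    unfold curveU
    rw [e1, e2, e3, e4]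
    field_simp
    ring
  have hfac : 0 < (1 - b ^ 2) * (1 - a ^ 2) * b ^ 2 / ((1 + a * b) ^ 3 * (1 - a * b) ^ 3) := by
    positivity
  rw [← sub_pos (b := a ^ 2 * (a ^ 2 + 3) * b ^ 2), ← mul_pos_iff_of_pos_left hfac, ← hU0]
  constructor
  · rintro ⟨x, hx, hux⟩
    by_contra hcon
    exact absurd (curveU_neg hw0 hw1 (by linarith) hα1 hβ1 haα le_rfl hx.1 hx.2 (not_lt.1 hcon))
      (not_lt.2 hux.le)
  · intro h0
    have hc : ContinuousAt (curveU ((1 + a * b) / 2) a α β) 0 := by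
      unfold curveU
      refine ContinuousAt.sub (ContinuousAt.div (by fun_prop) (by fun_prop) (by simp))
        (ContinuousAt.div (by fun_prop) (by fun_prop) (by simp))
    have h1 : ∀ᶠ x in nhdsWithin (0 : ℝ) (Set.Ioi 0), 0 < curveU ((1 + a * b) / 2) a α β x :=
      (hc.tendsto.mono_left nhdsWithin_le_nhds).eventually_const_lt h0
    have h2 : ∀ᶠ x in nhdsWithin (0 : ℝ) (Set.Ioi 0), x ∈ Set.Ioo (0 : ℝ) 1 :=
      Ioo_mem_nhdsGT one_pos
    obtain ⟨x, hx1, hx2⟩ := (h1.and h2).exists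
    exact ⟨x, hx2, hx1⟩

lemma strictAntiOn_g : StrictAntiOn (g q) (Set.Icc 0 (1 / 2)) := by
  obtain ⟨F₂, G₂, ρ, c, D⟩ := ratioData hp hq
  intro r hr s hs hrs
  rw [g_eq_curveG, g_eq_curveG]
  refine div_lt_div_of_pos_right (D.strictMonoOn_G ?_ ?_ (by linarith)) log_two_pos
  · exact ⟨by linarith [hs.2], by linarith [hs.1]⟩
  · exact ⟨by linarith [hr.2], by linarith [hr.1]⟩

lemma antitoneOn_f : AntitoneOn (f p q) (Set.Icc 0 (1 / 2)) := by
  obtain ⟨F₂, G₂, ρ, c, D⟩ := ratioData hp hq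
  intro r hr s hs hrs
  rw [f_eq_fBias, f_eq_fBias]
  refine div_le_div_of_nonneg_right (D.strictMonoOn_Φ.monotoneOn ?_ ?_ (by linarith)) log_two_pos.le
  · exact ⟨by linarith [hs.2], by linarith [hs.1]⟩
  · exact ⟨by linarith [hr.2], by linarith [hr.1]⟩

lemma gInv_g {r : ℝ} (hr : r ∈ Set.Icc (0 : ℝ) (1 / 2)) : gInv q (g q r) = r :=
  (strictAntiOn_g hp hq).injOn.leftInvOn_invFunOn hr

lemma gInv_spec {R : ℝ} (hR : R ∈ Set.Icc 0 (h₂ q)) :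
    gInv q R ∈ Set.Icc (0 : ℝ) (1 / 2) ∧ g q (gInv q R) = R := by
  have hR' : R ∈ g q '' Set.Icc 0 (1 / 2) := by
    refine intermediate_value_Icc' (by norm_num) (continuous_g q).continuousOn ?_
    rwa [g_half, g_zero]
  exact ⟨Function.invFunOn_mem hR', Function.invFunOn_eq hR'⟩

lemma gInv_mem_Ioo {R : ℝ} (hR : R ∈ Set.Ioo 0 (h₂ q)) : gInv q R ∈ Set.Ioo (0 : ℝ) (1 / 2) := by
  obtain ⟨h1, h2⟩ := gInv_spec hp hq ⟨hR.1.le, hR.2.le⟩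
  refine ⟨h1.1.lt_of_ne fun h => ?_, h1.2.lt_of_ne fun h => ?_⟩
  · rw [← h, g_zero] at h2
    exact hR.2.ne h2.symm
  · rw [h, g_half] at h2
    exact hR.1.ne h2

/-- The tangency condition in terms of the bias `x = 1 - 2 r`; the common factor `-2` of the two
derivatives cancels. -/
lemma tangency_iff {T : ℝ} (hT : T ∈ Set.Ioo 0 (h₂ q)) :
    Tangency p q T ↔ fBias₁ p q (1 - 2 * gInv q T) / curveG₁ (1 - 2 * q) (1 - 2 * gInv q T)
      * curveG (1 - 2 * q) (1 - 2 * gInv q T) - fBias p q (1 - 2 * gInv q T) = 0 := by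
  obtain ⟨F₂, G₂, ρ, c, D⟩ := ratioData hp hq
  have hr := gInv_mem_Ioo hp hq hT
  have hgr := (gInv_spec hp hq ⟨hT.1.le, hT.2.le⟩).2
  unfold Tangency
  generalize gInv q T = r at *
  have hT' : T = curveG (1 - 2 * q) (1 - 2 * r) / Real.log 2 := by rw [← g_eq_curveG, hgr]
  have hx : 1 - 2 * r ∈ Set.Ioo (0 : ℝ) 1 := ⟨by linarith [hr.2], by linarith [hr.1]⟩
  have hd : HasDerivAt (fun r : ℝ => 1 - 2 * r) (-2) r :=
    (((hasDerivAt_id r).const_mul 2).const_sub 1).congr_deriv (by ring)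
  have hf : HasDerivAt (f p q) (fBias₁ p q (1 - 2 * r) * -2 / Real.log 2) r := by
    have e : f p q = fun r => fBias p q (1 - 2 * r) / Real.log 2 := funext (f_eq_fBias p q)
    rw [e]
    exact ((D.dΦ _ ⟨hx.1.le, hx.2⟩).comp r hd).div_const _
  have hg : HasDerivAt (g q) (curveG₁ (1 - 2 * q) (1 - 2 * r) * -2 / Real.log 2) r := by
    have e : g q = fun r => curveG (1 - 2 * q) (1 - 2 * r) / Real.log 2 := funext (g_eq_curveG q)
    rw [e]
    exact ((D.dG _ ⟨hx.1.le, hx.2⟩).comp r hd).div_const _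
  have h1 := log_two_pos.ne'
  have h2 := (D.G₁_pos hx).ne'
  have h3 := (D.G_pos ⟨hx.1, hx.2.le⟩).ne'
  rw [hf.deriv, hg.deriv, f_eq_fBias, hT', div_div_div_cancel_right₀ h1,
    div_div_div_cancel_right₀ h1, mul_div_mul_right _ _ (by norm_num : (-2 : ℝ) ≠ 0), sub_eq_zero,
    eq_div_iff h3]

end Parameters

end Interface

/-! ### The critical rate and the concave envelope -/

section CriticalRate

variable {p q : ℝ}

/-- The excess of the relevance-rate function over its value at rate `0`, for critical rate `Rc`:
the smallest concave function above the curve `r ↦ (g r, f r)`. -/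
noncomputable def envelope (p q Rc R : ℝ) : ℝ :=
  if R ≤ Rc then f p q (gInv q Rc) / Rc * R
  else if R ≤ h₂ q then f p q (gInv q R) else h₂ (bconv p q) - h₂ p

/-- The critical rate, together with the two facts that make `envelope` the concave envelope of the
curve: a supporting line of nonnegative slope at each rate, and a point of the curve which gives
the value at that rate after time sharing with the origin. -/
lemma exists_criticalRate (hp : p ∈ Set.Ioo (0 : ℝ) (1 / 2)) (hq : q ∈ Set.Ioo (0 : ℝ) (1 / 2)) :
    ∃ Rc ∈ Set.Ico (0 : ℝ) (h₂ q),
      (∀ T ∈ Set.Ioo (0 : ℝ) (h₂ q), Tangency p q T ↔ T = Rc) ∧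
      (0 < Rc ↔ (1 - 2 * q) ^ 2 * ((1 - 2 * q) ^ 2 + 3) * (1 - 2 * p) ^ 2
        < 5 * (1 - 2 * q) ^ 2 - 1) ∧
      ∀ R : ℝ, 0 ≤ R →
        (∃ l : ℝ, 0 ≤ l ∧ ∀ r ∈ Set.Icc (0 : ℝ) 1, f p q r ≤ envelope p q Rc R + l * (g q r - R)) ∧
        ∃ θ ∈ Set.Icc (0 : ℝ) 1, ∃ r ∈ Set.Icc (0 : ℝ) (1 / 2),
          θ * g q r ≤ R ∧ θ * f p q r = envelope p q Rc R := by
  obtain ⟨F₂, G₂, ρ, c, D⟩ := ratioData hp hq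
  obtain ⟨xc, hxc, h1, h2, h3, h4, h5⟩ := D.exists_tangency
  rw [exists_curveU_pos_iff hp hq] at h5
  have hlog := log_two_pos
  have hanti := strictAntiOn_g hp hq
  set rc : ℝ := (1 - xc) / 2 with hrc
  have hxrc : 1 - 2 * rc = xc := by rw [hrc]; ring
  have hrc1 : rc ∈ Set.Ioc (0 : ℝ) (1 / 2) := ⟨by linarith [hxc.2], by linarith [hxc.1]⟩
  have hrc2 : rc ∈ Set.Icc (0 : ℝ) (1 / 2) := ⟨hrc1.1.le, hrc1.2⟩
  have hgrc0 : 0 < g q rc ↔ 0 < xc := by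
    have e := hanti.lt_iff_gt (a := 1 / 2) (b := rc) ⟨by norm_num, le_rfl⟩ hrc2
    rw [g_half] at e
    rw [e, hrc]
    constructor <;> intro h <;> linarith
  have hgrc : 0 ≤ g q rc := by
    rw [← g_half q]
    exact hanti.antitoneOn hrc2 ⟨by norm_num, le_rfl⟩ hrc2.2
  have hgrc' : g q rc < h₂ q := by
    rw [← g_zero]
    exact hanti ⟨le_rfl, by norm_num⟩ hrc2 hrc1.1
  have hgi : gInv q (g q rc) = rc := gInv_g hp hq hrc2
  -- it suffices to treat `r ≤ 1 / 2`
  have hsymm : ∀ F l R : ℝ, (∀ x ∈ Set.Icc (0 : ℝ) 1,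
      fBias p q x / Real.log 2 ≤ F + l * (curveG (1 - 2 * q) x / Real.log 2 - R)) →
      ∀ r ∈ Set.Icc (0 : ℝ) 1, f p q r ≤ F + l * (g q r - R) := by
    intro F l R h r hr
    rcases le_total r (1 / 2) with hr' | hr'
    · rw [f_eq_fBias, g_eq_curveG]
      exact h _ ⟨by linarith, by linarith [hr.1]⟩
    · rw [← f_one_sub, ← g_one_sub, f_eq_fBias, g_eq_curveG]
      exact h _ ⟨by linarith, by linarith [hr.2]⟩
  refine ⟨g q rc, ⟨hgrc, hgrc'⟩, fun T hT => ?_, hgrc0.trans h5, fun R hR => ?_⟩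
  · have hr := gInv_mem_Ioo hp hq hT
    have hgr := (gInv_spec hp hq ⟨hT.1.le, hT.2.le⟩).2
    rw [tangency_iff hp hq hT]
    have hx : 1 - 2 * gInv q T ∈ Set.Ioo (0 : ℝ) 1 := ⟨by linarith [hr.2], by linarith [hr.1]⟩
    have hiff : T = g q rc ↔ 1 - 2 * gInv q T = xc := by
      constructor
      · intro h; rw [h, hgi, hxrc]
      · intro h
        have : gInv q T = rc := by rw [hrc]; linarith
        rw [← this, hgr]
    rw [hiff]
    constructor
    · intro h
      rcases lt_trichotomy (1 - 2 * gInv q T) xc with h' | h' | h'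
      · exact absurd h (h1 _ hx h').ne'
      · exact h'
      · exact absurd h (h2 _ hx h').ne
    · intro h
      rw [h]; exact h4
  · unfold envelope
    rw [hgi]
    by_cases hRc : R ≤ g q rc
    · rw [if_pos hRc]
      rcases hgrc.eq_or_lt with h0 | h0
      · have hR0 : R = 0 := le_antisymm (h0 ▸ hRc) hR
        rw [hR0, mul_zero]
        refine ⟨⟨1, zero_le_one, hsymm _ _ _ fun x hx => ?_⟩, 0, ⟨le_rfl, zero_le_one⟩, 0,
          ⟨le_rfl, by norm_num⟩, by simp, by simp⟩
        rw [sub_zero, zero_add, one_mul]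
        exact div_le_div_of_nonneg_right (D.Φ_le_G hx) hlog.le
      · have hxc0 := hgrc0.1 h0
        have hGc := D.G_pos ⟨hxc0, hxc.2.le⟩
        refine ⟨⟨f p q rc / g q rc, ?_, hsymm _ _ _ fun x hx => ?_⟩, R / g q rc,
          ⟨by positivity, (div_le_one h0).2 hRc⟩, rc, hrc2, ?_, by ring⟩
        · rw [f_eq_fBias, hxrc]
          exact div_nonneg (div_nonneg (D.Φ_pos ⟨hxc0, hxc.2.le⟩).le hlog.le) h0.le
        · have := D.le_tangent hxc h1 h2 hxc0 hx
          have e : f p q rc / g q rc = fBias p q xc / curveG (1 - 2 * q) xc := by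
            rw [f_eq_fBias, g_eq_curveG, hxrc, div_div_div_cancel_right₀ hlog.ne']
          rw [e, mul_sub, add_sub_cancel, ← mul_div_assoc]
          exact div_le_div_of_nonneg_right this hlog.le
        · rw [div_mul_cancel₀ _ h0.ne']
    rw [if_neg hRc]
    have hflat : ∀ x ∈ Set.Icc (0 : ℝ) 1, fBias p q x / Real.log 2 ≤ f p q 0 := by
      intro x hx
      rw [f_eq_fBias, mul_zero, sub_zero]
      exact div_le_div_of_nonneg_right
        (D.strictMonoOn_Φ.monotoneOn hx ⟨zero_le_one, le_rfl⟩ hx.2) hlog.le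
    rcases le_or_gt (h₂ q) R with hq' | hq'
    · have e : (if R ≤ h₂ q then f p q (gInv q R) else h₂ (bconv p q) - h₂ p) = f p q 0 := by
        split_ifs with h
        · rw [le_antisymm h hq', ← g_zero, gInv_g hp hq ⟨le_rfl, by norm_num⟩]
        · rw [f_zero hp hq]
      rw [e]
      refine ⟨⟨0, le_rfl, hsymm _ _ _ fun x hx => ?_⟩, 1, ⟨zero_le_one, le_rfl⟩, 0,
        ⟨le_rfl, by norm_num⟩, by rwa [one_mul, g_zero], one_mul _⟩
      rw [zero_mul, add_zero]
      exact hflat x hx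
    · rw [if_pos hq'.le]
      have hRI : R ∈ Set.Ioo 0 (h₂ q) := ⟨hgrc.trans_lt (not_le.1 hRc), hq'⟩
      have hr := gInv_mem_Ioo hp hq hRI
      have hgr := (gInv_spec hp hq ⟨hR, hq'.le⟩).2
      have hlt : gInv q R < rc := by
        have := not_le.1 hRc
        rw [← hgr] at this
        exact (hanti.lt_iff_gt hrc2 ⟨hr.1.le, hr.2.le⟩).1 this
      set x₀ := 1 - 2 * gInv q R with hx₀
      have hx₀' : x₀ ∈ Set.Ioo xc 1 := ⟨by linarith, by linarith [hr.1]⟩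
      have hx₀'' : x₀ ∈ Set.Ioo (0 : ℝ) 1 := ⟨hxc.1.trans_lt hx₀'.1, hx₀'.2⟩
      refine ⟨⟨_, (div_pos (D.F₁_pos hx₀'') (D.G₁_pos hx₀'')).le, hsymm _ _ _ fun x hx => ?_⟩,
        1, ⟨zero_le_one, le_rfl⟩, gInv q R, ⟨hr.1.le, hr.2.le⟩, by rw [one_mul, hgr], one_mul _⟩
      have := D.le_support hxc h1 h3 h4 hx₀' hx
      rw [g_eq_curveG, ← hx₀] at hgr
      rw [f_eq_fBias, ← hx₀]
      conv_rhs => rw [← hgr]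
      rw [← sub_div, ← mul_div_assoc, ← add_div]
      exact div_le_div_of_nonneg_right this hlog.le

end CriticalRate

/-! ### Tensorization of the Lagrangian bound -/

section Tensorization

variable {A B C A' B' C' : Type*} [Fintype A] [Fintype B] [Fintype C]
  [Fintype A'] [Fintype B'] [Fintype C']

/-- The conditional entropy `H(Y | X₂)` when `X₁` has the (unnormalized) law `ν` and `(X₂, Y)` is
the output of the channel `K` at `X₁`. -/
noncomputable def lossFn (K : A → B × C → ℝ) (ν : A → ℝ) : ℝ :=
  ∑ b, condFn fun c => ∑ a, ν a * K a (b, c)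

/-- The entropy increase `H(X₂) - H(X₁)` when `X₁` has the (unnormalized) law `ν` and `(X₂, Y)`
is the output of the channel `K` at `X₁`. -/
noncomputable def rateFn (K : A → B × C → ℝ) (ν : A → ℝ) : ℝ :=
  entropy (fun b => ∑ a, ν a * ∑ c, K a (b, c)) - entropy ν

/-- The Lagrangian bound `- H(Y | X₂) ≤ τ + l (H(X₂) - H(X₁))`, for all laws of the channel
input. -/
def Dominated (K : A → B × C → ℝ) (l τ : ℝ) : Prop :=
  ∀ ν : A → ℝ, (∀ a, 0 ≤ ν a) → - lossFn K ν ≤ τ * ∑ a, ν a + l * rateFn K ν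

/-- The parallel composition of two channels. -/
def tensorChan (K : A → B × C → ℝ) (K' : A' → B' × C' → ℝ) :
    A × A' → (B × B') × (C × C') → ℝ :=
  fun a t => K a.1 (t.1.1, t.2.1) * K' a.2 (t.1.2, t.2.2)

lemma condFn_prod (m : C × C' → ℝ) :
    condFn m = condFn (fun c => ∑ c', m (c, c')) + ∑ c, condFn fun c' => m (c, c') := by
  simp only [condFn, entropy_eq_sum_eta, Finset.sum_sub_distrib, Fintype.sum_prod_type]
  ring

/-- Single-letterization: the Lagrangian bound tensorizes. The conditional laws used are that of the
first input given the second `X₂`-output, and that of the second input given the first input. -/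
lemma Dominated.tensor {K : A → B × C → ℝ} {K' : A' → B' × C' → ℝ} {l τ τ' : ℝ}
    (hK0 : ∀ a t, 0 ≤ K a t) (hK1 : ∀ a, ∑ t, K a t = 1)
    (hK0' : ∀ a t, 0 ≤ K' a t) (hK1' : ∀ a, ∑ t, K' a t = 1)
    (h : Dominated K l τ) (h' : Dominated K' l τ') :
    Dominated (tensorChan K K') l (τ + τ') := by
  intro ν hν
  let ν₁ : B' → A → ℝ := fun b' a => ∑ a', ν (a, a') * ∑ c', K' a' (b', c')
  let ν₂ : A → A' → ℝ := fun a a' => ν (a, a')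
  have hν₁ : ∀ b' a, 0 ≤ ν₁ b' a := fun b' a => Finset.sum_nonneg fun a' _ =>
    mul_nonneg (hν _) (Finset.sum_nonneg fun c' _ => hK0' _ _)
  have hmass₁ : ∑ b', ∑ a, ν₁ b' a = ∑ x, ν x := by
    simp only [ν₁]
    rw [Finset.sum_comm, Fintype.sum_prod_type]
    refine Finset.sum_congr rfl fun a _ => ?_
    rw [Finset.sum_comm]
    refine Finset.sum_congr rfl fun a' _ => ?_
    rw [← Finset.mul_sum, ← Fintype.sum_prod_type (fun t => K' a' t), hK1', mul_one]
  have hmass₂ : ∑ a, ∑ a', ν₂ a a' = ∑ x, ν x := (Fintype.sum_prod_type _).symm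
  have hrate : rateFn (tensorChan K K') ν = ∑ b', rateFn K (ν₁ b') + ∑ a, rateFn K' (ν₂ a) := by
    have e1 : ∀ b b', ∑ x : A × A', ν x * ∑ t : C × C', tensorChan K K' x ((b, b'), t)
        = ∑ a, ν₁ b' a * ∑ c, K a (b, c) := by
      intro b b'
      rw [Fintype.sum_prod_type]
      refine Finset.sum_congr rfl fun a _ => ?_
      simp only [ν₁, Finset.sum_mul]
      refine Finset.sum_congr rfl fun a' _ => ?_
      simp only [tensorChan, Fintype.sum_prod_type, ← Finset.mul_sum, ← Finset.sum_mul]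
      ring
    have e2 : ∑ b', entropy (ν₁ b')
        = ∑ a, entropy (fun b' => ∑ a', ν₂ a a' * ∑ c', K' a' (b', c')) := by
      simp only [entropy_eq_sum_eta]
      rw [Finset.sum_comm]
    unfold rateFn
    simp only [Finset.sum_sub_distrib]
    rw [e2]
    have e3 : entropy (fun b : B × B' => ∑ x, ν x * ∑ t, tensorChan K K' x (b, t))
        = ∑ b', entropy (fun b => ∑ a, ν₁ b' a * ∑ c, K a (b, c)) := by
      simp only [entropy_eq_sum_eta]
      rw [Fintype.sum_prod_type_right]
      simp only [e1]
    have e4 : entropy ν = ∑ a, entropy (ν₂ a) := by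
      simp only [entropy_eq_sum_eta]
      rw [Fintype.sum_prod_type]
    rw [e3, e4]
    ring
  have hloss : ∑ b', lossFn K (ν₁ b') + ∑ a, lossFn K' (ν₂ a) ≤ lossFn (tensorChan K K') ν := by
    have e1 : ∀ b b', condFn (fun t : C × C' => ∑ x, ν x * tensorChan K K' x ((b, b'), t))
        = condFn (fun c => ∑ a, ν₁ b' a * K a (b, c))
          + ∑ c, condFn fun c' => ∑ a, K a (b, c) * ∑ a', ν₂ a a' * K' a' (b', c') := by
      intro b b'
      rw [condFn_prod]
      congr 1
      · congr 1
        funext c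
        rw [Finset.sum_comm, Fintype.sum_prod_type]
        refine Finset.sum_congr rfl fun a _ => ?_
        simp only [ν₁, Finset.sum_mul, Finset.mul_sum]
        refine Finset.sum_congr rfl fun a' _ => Finset.sum_congr rfl fun c' _ => ?_
        simp only [tensorChan]; ring
      · refine Finset.sum_congr rfl fun c _ => ?_
        congr 1
        funext c'
        rw [Fintype.sum_prod_type]
        refine Finset.sum_congr rfl fun a _ => ?_
        rw [Finset.mul_sum]
        refine Finset.sum_congr rfl fun a' _ => ?_
        simp only [tensorChan, ν₂]; ring
    have e2 : ∀ b b' c, ∑ a, K a (b, c) * condFn (fun c' => ∑ a', ν₂ a a' * K' a' (b', c'))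
        ≤ condFn fun c' => ∑ a, K a (b, c) * ∑ a', ν₂ a a' * K' a' (b', c') := fun b b' c =>
      condFn_mix_le _ _ _ (fun a => hK0 _ _) fun a c' => Finset.sum_nonneg fun a' _ =>
        mul_nonneg (hν _) (hK0' _ _)
    have e3 : ∑ a, lossFn K' (ν₂ a) = ∑ b, ∑ b', ∑ c, ∑ a, K a (b, c) *
        condFn (fun c' => ∑ a', ν₂ a a' * K' a' (b', c')) := by
      have : ∀ a, lossFn K' (ν₂ a) = ∑ b, ∑ b', ∑ c, K a (b, c) *
          condFn (fun c' => ∑ a', ν₂ a a' * K' a' (b', c')) := by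
        intro a
        have h1 : ∑ b, ∑ c, K a (b, c) = 1 := by rw [← Fintype.sum_prod_type (fun t => K a t), hK1]
        unfold lossFn
        simp only [← Finset.sum_mul, ← Finset.mul_sum]
        rw [h1, one_mul]
      simp only [this]
      rw [Finset.sum_comm]
      refine Finset.sum_congr rfl fun b _ => ?_
      rw [Finset.sum_comm]
      refine Finset.sum_congr rfl fun b' _ => ?_
      rw [Finset.sum_comm]
    rw [e3]
    unfold lossFn
    rw [Fintype.sum_prod_type, Finset.sum_comm, ← Finset.sum_add_distrib]
    refine Finset.sum_le_sum fun b _ => ?_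
    rw [← Finset.sum_add_distrib]
    refine Finset.sum_le_sum fun b' _ => ?_
    rw [e1]
    exact add_le_add le_rfl (Finset.sum_le_sum fun c _ => e2 b b' c)
  have s1 := Finset.sum_le_sum fun b' (_ : b' ∈ Finset.univ) => h (ν₁ b') (hν₁ b')
  have s2 := Finset.sum_le_sum fun a (_ : a ∈ Finset.univ) => h' (ν₂ a) fun a' => hν (a, a')
  simp only [Finset.sum_add_distrib, ← Finset.mul_sum, Finset.sum_neg_distrib] at s1 s2
  rw [hmass₁] at s1
  rw [hmass₂] at s2
  rw [hrate]
  linarith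

/-- The `n`-fold parallel power of a channel. -/
def powChan (K : A → B × C → ℝ) (n : ℕ) :
    (Fin n → A) → (Fin n → B) × (Fin n → C) → ℝ :=
  fun a t => ∏ i, K (a i) (t.1 i, t.2 i)

lemma Dominated.equiv {K : A → B × C → ℝ} {K' : A' → B' × C' → ℝ} {l τ : ℝ}
    (eA : A ≃ A') (eB : B ≃ B') (eC : C ≃ C')
    (hK : ∀ a b c, K' (eA a) (eB b, eC c) = K a (b, c)) (h : Dominated K l τ) :
    Dominated K' l τ := by
  intro ν hν
  have h0 := h (fun a => ν (eA a)) fun a => hν _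
  have e1 : ∀ b c, ∑ a, ν a * K' a (eB b, eC c) = ∑ a, ν (eA a) * K a (b, c) := by
    intro b c
    rw [← eA.sum_comp]
    simp only [hK]
  have hloss : lossFn K' ν = lossFn K fun a => ν (eA a) := by
    unfold lossFn condFn
    simp only [entropy_eq_sum_eta]
    rw [← eB.sum_comp]
    refine Finset.sum_congr rfl fun b _ => ?_
    rw [← eC.sum_comp, ← eC.sum_comp]
    simp only [e1]
  have e2 : ∀ b, ∑ a, ν a * ∑ c, K' a (eB b, c) = ∑ a, ν (eA a) * ∑ c, K a (b, c) := by
    intro b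
    rw [← eA.sum_comp]
    refine Finset.sum_congr rfl fun a _ => ?_
    rw [← eC.sum_comp]
    simp only [hK]
  have hrate : rateFn K' ν = rateFn K fun a => ν (eA a) := by
    unfold rateFn
    simp only [entropy_eq_sum_eta]
    rw [← eB.sum_comp, ← eA.sum_comp (fun a => eta (ν a))]
    simp only [e2]
  rw [hloss, hrate, ← eA.sum_comp ν]
  exact h0

lemma powChan_nonneg {K : A → B × C → ℝ} (hK0 : ∀ a t, 0 ≤ K a t) (n : ℕ) (a : Fin n → A)
    (t : (Fin n → B) × (Fin n → C)) : 0 ≤ powChan K n a t :=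
  Finset.prod_nonneg fun _ _ => hK0 _ _

lemma sum_powChan {K : A → B × C → ℝ} (hK1 : ∀ a, ∑ t, K a t = 1) (n : ℕ) (a : Fin n → A) :
    ∑ t, powChan K n a t = 1 := by
  have h := sum_prod_apply fun (i : Fin n) (t : B × C) => K (a i) t
  simp only [hK1, Finset.prod_const_one] at h
  rw [← h, ← (Equiv.arrowProdEquivProdArrow (Fin n) (fun _ => B) fun _ => C).sum_comp]
  rfl

lemma Dominated.pow {K : A → B × C → ℝ} {l τ : ℝ} (hK0 : ∀ a t, 0 ≤ K a t)
    (hK1 : ∀ a, ∑ t, K a t = 1) (h : Dominated K l τ) (n : ℕ) :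
    Dominated (powChan K n) l (n * τ) := by
  induction n with
  | zero =>
    intro ν _
    simp [lossFn, rateFn, condFn, powChan, entropy_eq_sum_eta]
  | succ n ih =>
    have ht := h.tensor hK0 hK1 (powChan_nonneg hK0 n) (sum_powChan hK1 n) ih
    have := ht.equiv (K' := powChan K (n + 1)) (Fin.consEquiv fun _ => A) (Fin.consEquiv fun _ => B)
      (Fin.consEquiv fun _ => C) (by
        intro a b c
        simp [powChan, tensorChan, Fin.prod_univ_succ, Fin.consEquiv])
    refine cast ?_ this
    congr 1
    push_cast; ring

end Tensorization

section BinaryChannel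

/-- The Bernoulli probabilities. -/
def bern (s : ℝ) (b : Bool) : ℝ := if b then s else 1 - s

/-- The channel from `X₁` to `(X₂, Y)`: two binary symmetric channels in parallel. -/
def chan (p q : ℝ) (x : Bool) (t : Bool × Bool) : ℝ := bern q (xor x t.1) * bern p (xor x t.2)

lemma bern_nonneg {s : ℝ} (h0 : 0 ≤ s) (h1 : s ≤ 1) (b : Bool) : 0 ≤ bern s b := by
  cases b <;> simp [bern, h0, h1]

lemma sum_chan (p q : ℝ) (x : Bool) : ∑ t, chan p q x t = 1 := by
  cases x <;> simp [chan, bern, Fintype.sum_prod_type] <;> ring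

lemma h₂_eq_eta (r : ℝ) : h₂ r = eta r + eta (1 - r) := by
  rw [h₂, Real.binEntropy_eq_negMulLog_add_negMulLog_one_sub, eta, eta, add_div]

lemma add_mul_h₂_div {x y : ℝ} (h : 0 < x + y) :
    (x + y) * h₂ (x / (x + y)) = eta x + eta y - eta (x + y) := by
  have := add_mul_binEntropy_div h
  rw [h₂, ← mul_div_assoc, this, eta, eta, eta]
  ring

lemma entropy_bern (r : ℝ) : entropy (bern r) = h₂ r := by
  simp [entropy_eq_sum_eta, h₂_eq_eta, bern]

lemma rateFn_bern (p q r : ℝ) : rateFn (chan p q) (bern r) = g q r := by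
  have e : (fun b => ∑ a, bern r a * ∑ c, chan p q a (b, c)) = bern (bconv r q) := by
    funext b
    cases b <;> simp [bern, chan, bconv] <;> ring
  rw [rateFn, e, entropy_bern, entropy_bern, g]

lemma lossFn_bern {p q : ℝ} (hp : p ∈ Set.Ioo (0 : ℝ) (1 / 2)) (hq : q ∈ Set.Ioo (0 : ℝ) (1 / 2))
    (r : ℝ) : lossFn (chan p q) (bern r) = h₂ (bconv p q) - f p q r := by
  obtain ⟨hs0, hs1⟩ := bconv_mem hp hq
  set x₁ := r * ((1 - q) * (1 - p)) + (1 - r) * (q * p) with hx₁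
  set y₁ := r * (q * p) + (1 - r) * ((1 - q) * (1 - p)) with hy₁
  set x₂ := r * (q * (1 - p)) + (1 - r) * ((1 - q) * p) with hx₂
  set y₂ := r * ((1 - q) * p) + (1 - r) * (q * (1 - p)) with hy₂
  have s₁ : x₁ + y₁ = 1 - bconv p q := by rw [hx₁, hy₁, bconv]; ring
  have s₂ : x₂ + y₂ = bconv p q := by rw [hx₂, hy₂, bconv]; ring
  have k₁ := add_mul_h₂_div (x := x₁) (y := y₁) (by linarith)
  have k₂ := add_mul_h₂_div (x := x₂) (y := y₂) (by linarith)
  have hne : 1 - bconv p q ≠ 0 := by linarith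
  have e₁ : bconv r (p * q / (1 - bconv p q)) = x₁ / (x₁ + y₁) := by
    rw [s₁, hx₁]; unfold bconv at hne ⊢; field_simp; ring
  have e₂ : bconv r (p * (1 - q) / bconv p q) = x₂ / (x₂ + y₂) := by
    have hne' := hs0.ne'
    rw [s₂, hx₂]; unfold bconv at hne' ⊢; field_simp; ring
  have hl : lossFn (chan p q) (bern r)
      = eta x₁ + eta y₁ + eta x₂ + eta y₂ - (eta (bconv r q) + eta (1 - bconv r q)) := by
    have m1 : bern r true * chan p q true (true, true) + bern r false * chan p q false (true, true)
        = x₁ := by simp [bern, chan, hx₁]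
    have m2 : bern r true * chan p q true (false, false)
        + bern r false * chan p q false (false, false) = y₁ := by simp [bern, chan, hy₁]
    have m3 : bern r true * chan p q true (false, true)
        + bern r false * chan p q false (false, true) = x₂ := by simp [bern, chan, hx₂]
    have m4 : bern r true * chan p q true (true, false)
        + bern r false * chan p q false (true, false) = y₂ := by simp [bern, chan, hy₂]
    unfold lossFn condFn
    simp only [entropy_eq_sum_eta, Fintype.sum_bool, m1, m2, m3, m4]
    have t4 : x₁ + y₂ = bconv r q := by rw [hx₁, hy₂, bconv]; ring
    have t5 : x₂ + y₁ = 1 - bconv r q := by rw [hx₂, hy₁, bconv]; ring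
    rw [t4, t5]
    ring
  rw [hl, f, h₂_eq_eta (bconv r q), h₂_eq_eta (bconv p q), e₁, e₂, ← s₁, k₁, s₁, ← s₂, k₂]
  ring

end BinaryChannel

/-! ### The source law and the converse -/

section SourceLaw

/-- The joint law of `(X₁, X₂, Y)`: a uniform bit `X₁` sent through `chan p q`. -/
noncomputable def srcLaw (p q : ℝ) (t : Bool × Bool × Bool) : ℝ := 1 / 2 * chan p q t.1 t.2

variable {p q : ℝ}

lemma chan_nonneg (hp : p ∈ Set.Icc (0 : ℝ) 1) (hq : q ∈ Set.Icc (0 : ℝ) 1) (x : Bool)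
    (t : Bool × Bool) : 0 ≤ chan p q x t :=
  mul_nonneg (bern_nonneg hq.1 hq.2 _) (bern_nonneg hp.1 hp.2 _)

lemma srcLaw_nonneg (hp : p ∈ Set.Icc (0 : ℝ) 1) (hq : q ∈ Set.Icc (0 : ℝ) 1)
    (t : Bool × Bool × Bool) : 0 ≤ srcLaw p q t :=
  mul_nonneg (by norm_num) (chan_nonneg hp hq _ _)

lemma sum_srcLaw (p q : ℝ) : ∑ t, srcLaw p q t = 1 := by
  rw [Fintype.sum_prod_type]
  simp only [srcLaw, ← Finset.mul_sum, sum_chan]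
  norm_num

/-- The hypotheses on the variables determine their joint law. -/
lemma jointLaw_eq {Ω : Type*} [MeasurableSpace Ω] (μ : Measure Ω) [IsProbabilityMeasure μ]
    (X₁ X₂ Y Z W : Ω → Bool)
    (hX₂ : Measurable X₂) (hZ : Measurable Z) (hW : Measurable W)
    (hX₂law : μ.real {ω | X₂ ω = true} = 1 / 2)
    (hZlaw : μ.real {ω | Z ω = true} = q)
    (hWlaw : μ.real {ω | W ω = true} = p)
    (hX₁ : ∀ ω, X₁ ω = xor (X₂ ω) (Z ω))
    (hY : ∀ ω, Y ω = xor (X₁ ω) (W ω))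
    (hZX₂ : IndepFun Z X₂ μ)
    (hWX : IndepFun W (fun ω => (X₁ ω, X₂ ω)) μ) :
    jointLaw μ X₁ X₂ Y = srcLaw p q := by
  have hbern : ∀ {V : Ω → Bool} {s : ℝ}, Measurable V → μ.real {ω | V ω = true} = s →
      ∀ b, μ.real (V ⁻¹' {b}) = bern s b := by
    intro V s hV h b
    have ht : V ⁻¹' {true} = {ω | V ω = true} := rfl
    cases b
    · have hc : V ⁻¹' {false} = (V ⁻¹' {true})ᶜ := by ext ω; simp
      rw [hc, probReal_compl_eq_one_sub (hV (measurableSet_singleton _)), ht, h]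
      simp [bern]
    · rw [ht, h]; simp [bern]
  funext ⟨x, b, c⟩
  have e1 : {ω | (X₁ ω, X₂ ω, Y ω) = (x, b, c)}
      = W ⁻¹' {xor x c} ∩ (fun ω => (X₁ ω, X₂ ω)) ⁻¹' {(x, b)} := by
    ext ω
    simp only [Set.mem_ofPred_eq, Prod.mk.injEq, Set.mem_inter_iff, Set.mem_preimage,
      Set.mem_singleton_iff, hY ω]
    constructor
    · rintro ⟨h1, h2, h3⟩
      refine ⟨?_, h1, h2⟩
      rw [← h3, ← h1]; simp
    · rintro ⟨h1, h2, h3⟩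
      refine ⟨h2, h3, ?_⟩
      rw [h1, h2]; simp
  have e2 : (fun ω => (X₁ ω, X₂ ω)) ⁻¹' {(x, b)} = Z ⁻¹' {xor x b} ∩ X₂ ⁻¹' {b} := by
    ext ω
    simp only [Prod.mk.injEq, Set.mem_inter_iff, Set.mem_preimage, Set.mem_singleton_iff, hX₁ ω]
    constructor
    · rintro ⟨h1, h2⟩
      refine ⟨?_, h2⟩
      rw [← h1, ← h2]; cases X₂ ω <;> cases Z ω <;> rfl
    · rintro ⟨h1, h2⟩
      refine ⟨?_, h2⟩
      rw [h1, h2]; cases x <;> cases b <;> rfl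
  have i1 := hWX.measure_inter_preimage_eq_mul {xor x c} {(x, b)} (measurableSet_singleton _)
    (measurableSet_singleton _)
  have i2 := hZX₂.measure_inter_preimage_eq_mul {xor x b} {b} (measurableSet_singleton _)
    (measurableSet_singleton _)
  have hhalf : bern (1 / 2) b = 1 / 2 := by cases b <;> norm_num [bern]
  unfold jointLaw
  rw [e1, Measure.real, i1, ENNReal.toReal_mul, e2, i2, ENNReal.toReal_mul]
  change μ.real _ * (μ.real _ * μ.real _) = _
  rw [hbern hW hWlaw, hbern hZ hZlaw, hbern hX₂ hX₂law, hhalf]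
  simp only [srcLaw, chan]
  ring

/-- Blockwise, `X₁ⁿ` is uniform and `(X₂ⁿ, Yⁿ)` is the output of the power channel. -/
lemma lawOf_iidLaw_srcLaw (p q : ℝ) (n : ℕ) (x b c : Fin n → Bool) :
    lawOf (iidLaw (srcLaw p q) n)
      (fun s => ((fun i => (s i).1), ((fun i => (s i).2.1), fun i => (s i).2.2))) (x, (b, c))
      = (1 / 2) ^ n * powChan (chan p q) n x (b, c) := by
  unfold lawOf
  rw [Finset.sum_eq_single fun i => (x i, b i, c i)]
  · simp [iidLaw, srcLaw, powChan, Finset.prod_mul_distrib]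
  · intro s _ hs
    refine if_neg fun h => hs ?_
    simp only [Prod.mk.injEq] at h
    obtain ⟨rfl, rfl, rfl⟩ := h
    rfl
  · simp

end SourceLaw

section Converse

variable {p q : ℝ}

/-- By homogeneity the Lagrangian bound for one use of the channel only has to be checked for
normalized input laws, where it says that a line lies above the curve `r ↦ (g r, f r)`. -/
lemma dominated_chan (hp : p ∈ Set.Ioo (0 : ℝ) (1 / 2)) (hq : q ∈ Set.Ioo (0 : ℝ) (1 / 2))
    {l τ : ℝ} (h : ∀ r ∈ Set.Icc (0 : ℝ) 1, f p q r - h₂ (bconv p q) ≤ τ + l * g q r) :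
    Dominated (chan p q) l τ := by
  intro ν hν
  have hm0 : 0 ≤ ∑ a, ν a := Finset.sum_nonneg fun a _ => hν a
  rcases hm0.eq_or_lt with h0 | h0
  · have hz : ν = fun _ => 0 := by
      funext a
      exact (Finset.sum_eq_zero_iff_of_nonneg fun a _ => hν a).1 h0.symm a (Finset.mem_univ a)
    subst hz
    simp [lossFn, rateFn, entropy_eq_sum_eta]
  · set m := ∑ a, ν a with hm
    set r := ν true / m with hr
    have hsum : m = ν true + ν false := by rw [hm, Fintype.sum_bool]
    have hr1 : r ∈ Set.Icc (0 : ℝ) 1 :=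
      ⟨div_nonneg (hν _) hm0, (div_le_one h0).2 (by rw [hsum]; linarith [hν false])⟩
    have hν' : ν = fun a => m * bern r a := by
      have e : m * (ν true / m) = ν true := by field_simp
      funext a
      cases a
      · change ν false = m * (1 - ν true / m)
        linarith
      · exact e.symm
    have hloss : lossFn (chan p q) ν = m * lossFn (chan p q) (bern r) := by
      rw [hν']
      unfold lossFn
      rw [Finset.mul_sum]
      refine Finset.sum_congr rfl fun b _ => ?_
      rw [← condFn_smul]
      congr 1
      funext c
      rw [Finset.mul_sum]
      refine Finset.sum_congr rfl fun a _ => by ring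
    have hb1 : ∑ a, bern r a = 1 := by simp [bern]
    have hrate : rateFn (chan p q) ν = m * rateFn (chan p q) (bern r) := by
      have e1 := condFn_smul m (bern r)
      have e2 := condFn_smul m fun b => ∑ a, bern r a * ∑ c, chan p q a (b, c)
      have e3 : (fun b => m * ∑ a, bern r a * ∑ c, chan p q a (b, c))
          = fun b => ∑ a, ν a * ∑ c, chan p q a (b, c) := by
        funext b
        rw [Finset.mul_sum, hν']
        refine Finset.sum_congr rfl fun a _ => by ring
      have e4 : ∑ b, ∑ a, bern r a * ∑ c, chan p q a (b, c) = 1 := by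
        have hK1 : ∀ a, ∑ b, ∑ c, chan p q a (b, c) = 1 := fun a => by
          rw [← Fintype.sum_prod_type (fun t => chan p q a t), sum_chan]
        rw [Finset.sum_comm]
        simp only [← Finset.mul_sum, hK1, mul_one, hb1]
      rw [e3] at e2
      rw [← hν'] at e1
      have e5 : ∑ b, ∑ a, ν a * ∑ c, chan p q a (b, c) = m := by
        rw [Finset.sum_congr rfl fun b _ => (congrFun e3 b).symm, ← Finset.mul_sum, e4, mul_one]
      simp only [condFn, hb1, e4, e5, ← hm] at e1 e2
      unfold rateFn
      linarith
    rw [hloss, hrate, rateFn_bern, lossFn_bern hp hq]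
    have := mul_le_mul_of_nonneg_left (h r hr1) h0.le
    linarith

/-- The converse: a supporting line of the single-letter region bounds the relevance of every
encoder of every block length. -/
lemma relevance_le (hp : p ∈ Set.Ioo (0 : ℝ) (1 / 2)) (hq : q ∈ Set.Ioo (0 : ℝ) (1 / 2))
    {l τ : ℝ} (hl : 0 ≤ l) (h : Dominated (chan p q) l τ) {n M : ℕ} (hM : 0 < M)
    (enc : (Fin n → Bool) → Fin M) :
    relevance (srcLaw p q) n enc ≤ n * (1 + τ) + l * Real.logb 2 M := by
  have hp' : p ∈ Set.Icc (0 : ℝ) 1 := ⟨hp.1.le, by linarith [hp.2]⟩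
  have hq' : q ∈ Set.Icc (0 : ℝ) 1 := ⟨hq.1.le, by linarith [hq.2]⟩
  have hK0 := chan_nonneg hp' hq'
  set P := iidLaw (srcLaw p q) n with hP
  have hP0 : ∀ s, 0 ≤ P s := prodLaw_nonneg (srcLaw_nonneg hp' hq')
  have hP1 : ∑ s, P s = 1 := sum_prodLaw (sum_srcLaw p q)
  set Yv : (Fin n → Bool × Bool × Bool) → Fin n → Bool := fun s i => (s i).2.2
  set JX : (Fin n → Bool × Bool × Bool) → Fin M × (Fin n → Bool) :=
    fun s => (enc fun i => (s i).1, fun i => (s i).2.1)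
  -- the law of `X₁ⁿ` restricted to the event that the description is `j`
  let ν : Fin M → (Fin n → Bool) → ℝ := fun j x => if enc x = j then (1 / 2) ^ n else 0
  have hν : ∀ j x, 0 ≤ ν j x := fun j x => by simp only [ν]; split_ifs <;> positivity
  have hcard : Real.logb 2 (Fintype.card (Fin n → Bool)) = n := by
    simp [Real.logb_pow]
  have hlaw : ∀ y j b, lawOf P (fun s => (Yv s, JX s)) (y, (j, b))
      = ∑ x, ν j x * powChan (chan p q) n x (b, y) := by
    intro y j b
    have h1 := lawOf_lawOf (p := P)
      (fun s => ((fun i => (s i).1), ((fun i => (s i).2.1), fun i => (s i).2.2)))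
      fun t : (Fin n → Bool) × (Fin n → Bool) × (Fin n → Bool) => (t.2.2, (enc t.1, t.2.1))
    rw [show (fun s => (Yv s, JX s)) = fun s => ((fun i => (s i).2.2),
      (enc fun i => (s i).1, fun i => (s i).2.1)) from rfl, ← h1]
    conv_lhs => unfold lawOf
    rw [Fintype.sum_prod_type]
    refine Finset.sum_congr rfl fun x _ => ?_
    have h2 : ∀ t : (Fin n → Bool) × (Fin n → Bool),
        (if (t.2, (enc x, t.1)) = (y, (j, b)) then
          lawOf P (fun s => ((fun i => (s i).1), ((fun i => (s i).2.1), fun i => (s i).2.2))) (x, t)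
          else 0) = if t = (b, y) then ν j x * powChan (chan p q) n x (b, y) else 0 := by
      intro t
      by_cases ht : t = (b, y)
      · subst ht
        rw [lawOf_iidLaw_srcLaw]
        by_cases hj : enc x = j <;> simp [ν, hj]
      · rw [if_neg ht, if_neg]
        intro h3
        simp only [Prod.mk.injEq] at h3
        exact ht (Prod.ext h3.2.2 h3.1)
    refine (Finset.sum_congr rfl fun t _ => h2 t).trans ?_
    simp
  have hloss : condEnt P Yv JX = ∑ j, lossFn (powChan (chan p q) n) (ν j) := by
    rw [condEnt_eq_sum, Fintype.sum_prod_type]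
    refine Finset.sum_congr rfl fun j _ => Finset.sum_congr rfl fun b _ => ?_
    simp only [hlaw]
  have hmass : ∑ j, ∑ x, ν j x = 1 := by
    rw [Finset.sum_comm]
    simp [ν]
  have hrate : ∑ j, rateFn (powChan (chan p q) n) (ν j) ≤ Real.logb 2 M := by
    have e1 : ∑ j, entropy (fun b => ∑ x, ν j x * ∑ c, powChan (chan p q) n x (b, c))
        = ent P JX := by
      rw [ent, entropy_eq_sum_eta, Fintype.sum_prod_type]
      refine Finset.sum_congr rfl fun j _ => Finset.sum_congr rfl fun b _ => ?_
      rw [lawOf_snd_eq_sum Yv JX]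
      simp only [hlaw]
      rw [Finset.sum_comm]
      simp only [Finset.mul_sum]
      rfl
    have e2 : ∑ j, entropy (ν j) = n := by
      simp only [entropy_eq_sum_eta]
      rw [Finset.sum_comm]
      have : ∀ x : Fin n → Bool, ∑ j, eta (ν j x) = (1 / 2) ^ n * n := by
        intro x
        have h3 : ∀ j, eta (ν j x) = if enc x = j then eta ((1 / 2) ^ n) else 0 := by
          intro j; simp only [ν]; split_ifs <;> simp
        simp only [h3]
        have h4 : Real.logb 2 (2⁻¹ : ℝ) = -1 := by
          rw [Real.logb_inv, Real.logb_self_eq_one one_lt_two]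
        simp [eta_eq, Real.logb_pow]
      simp [this]
    have e3 := ent_le_logb_card hP0 hP1 JX
    rw [Fintype.card_prod, Nat.cast_mul, Fintype.card_fin,
      Real.logb_mul (by positivity) (by positivity), hcard] at e3
    unfold rateFn
    rw [Finset.sum_sub_distrib, e1, e2]
    linarith
  have hdom := h.pow hK0 (sum_chan p q) n
  have hs := Finset.sum_le_sum fun j (_ : j ∈ Finset.univ) => hdom (ν j) (hν j)
  rw [Finset.sum_neg_distrib, ← hloss, Finset.sum_add_distrib, ← Finset.mul_sum, ← Finset.mul_sum,
    hmass, mul_one] at hs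
  have hY := ent_le_logb_card hP0 hP1 Yv
  rw [hcard] at hY
  have hrel : relevance (srcLaw p q) n enc = ent P Yv - condEnt P Yv JX := by
    unfold relevance mutualInfo condEnt ent
    ring
  rw [hrel]
  have := mul_le_mul_of_nonneg_left hrate hl
  linarith

end Converse

/-! ### Entropies of a quantized block -/

section Quantizer

variable {p q : ℝ}

lemma lawOf_id {α : Type*} [Fintype α] [DecidableEq α] (m : α → ℝ) : lawOf m (fun a => a) = m := by
  funext a; simp [lawOf]

lemma lawOf_fst {α β : Type*} [Fintype α] [Fintype β] [DecidableEq α] (m : α × β → ℝ) (a : α) :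
    lawOf m Prod.fst a = ∑ b, m (a, b) := by
  unfold lawOf
  rw [Fintype.sum_prod_type, Finset.sum_eq_single a]
  · simp
  · intro a' _ h; simp [h]
  · simp

lemma ent_uniform {n : ℕ} : entropy (prodLaw fun _ : Bool => (1 / 2 : ℝ) : (Fin n → Bool) → ℝ)
    = n := by
  have h4 : Real.logb 2 (2⁻¹ : ℝ) = -1 := by
    rw [Real.logb_inv, Real.logb_self_eq_one one_lt_two]
  simp [entropy_eq_sum_eta, prodLaw, eta_eq, Real.logb_pow]

lemma lawOf_srcLaw_X₂ (p q : ℝ) : lawOf (srcLaw p q) (fun t => t.2.1) = fun _ => 1 / 2 := by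
  funext b
  cases b <;> simp [lawOf, srcLaw, chan, bern, Fintype.sum_prod_type] <;> ring

lemma lawOf_srcLaw_Y (p q : ℝ) : lawOf (srcLaw p q) (fun t => t.2.2) = fun _ => 1 / 2 := by
  funext b
  cases b <;> simp [lawOf, srcLaw, chan, bern, Fintype.sum_prod_type] <;> ring

lemma ent_X₂ (p q : ℝ) (n : ℕ) : ent (iidLaw (srcLaw p q) n) (fun s i => (s i).2.1) = n := by
  rw [ent, iidLaw_eq_prodLaw, lawOf_prodLaw (sum_srcLaw p q) (fun t => t.2.1)
    (e := fun i : Fin n => i) fun _ _ h => h, lawOf_srcLaw_X₂, ent_uniform]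

lemma ent_Y (p q : ℝ) (n : ℕ) : ent (iidLaw (srcLaw p q) n) (fun s i => (s i).2.2) = n := by
  rw [ent, iidLaw_eq_prodLaw, lawOf_prodLaw (sum_srcLaw p q) (fun t => t.2.2)
    (e := fun i : Fin n => i) fun _ _ h => h, lawOf_srcLaw_Y, ent_uniform]

/-- The joint law of `X₁ⁿ` and of one coordinate of `(X₂ⁿ, Yⁿ)`. -/
lemma lawOf_block_coord (p q : ℝ) {n : ℕ} (i : Fin n) (x : Fin n → Bool) (t : Bool × Bool) :
    lawOf (iidLaw (srcLaw p q) n) (fun s => ((fun j => (s j).1), (s i).2)) (x, t)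
      = (1 / 2) ^ n * chan p q (x i) t := by
  have h := sum_prodLaw_mul_prod (ι := Fin n) (srcLaw p q) fun j a =>
    if a.1 = x j ∧ (j = i → a.2 = t) then 1 else 0
  have h1 : ∀ j, ∑ a, srcLaw p q a * (if a.1 = x j ∧ (j = i → a.2 = t) then 1 else 0)
      = 1 / 2 * if j = i then chan p q (x i) t else 1 := by
    intro j
    rw [Fintype.sum_prod_type, Finset.sum_eq_single (x j)]
    · by_cases hj : j = i
      · subst hj; simp [srcLaw]
      · have := sum_chan p q (x j)
        simp only [hj, false_imp_iff, and_true, if_true, mul_one, if_false, srcLaw,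
          ← Finset.mul_sum, this]
    · intro b _ hb; simp [hb]
    · simp
  simp only [h1, Finset.prod_mul_distrib, Finset.prod_ite_eq', Finset.mem_univ, if_true,
    Finset.prod_const, Finset.card_univ, Fintype.card_fin] at h
  rw [← h]
  unfold lawOf
  refine Finset.sum_congr rfl fun s _ => ?_
  rw [Fintype.prod_ite_zero]
  have : ((fun j => (s j).1), (s i).2) = (x, t) ↔
      ∀ j, (s j).1 = x j ∧ (j = i → (s j).2 = t) := by
    simp only [Prod.mk.injEq, funext_iff, forall_and, forall_eq]
  simp only [this, Finset.prod_const_one, mul_ite, mul_one, mul_zero, iidLaw_eq_prodLaw]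

variable {n L : ℕ} (V : (Fin n → Bool) → Fin L) (c : Fin L → Fin n → Bool)

/-- The probability that the quantizer with cells `V` and reproduction words `c` gets coordinate `i`
of `X₁ⁿ` wrong. -/
noncomputable def distortion (i : Fin n) : ℝ :=
  ∑ x : Fin n → Bool, (1 / 2) ^ n * if x i ≠ c (V x) i then 1 else 0

lemma distortion_mem (i : Fin n) : distortion V c i ∈ Set.Icc (0 : ℝ) 1 := by
  constructor
  · exact Finset.sum_nonneg fun x _ => mul_nonneg (by positivity) (by split_ifs <;> simp)
  · calc distortion V c i ≤ ∑ x : Fin n → Bool, (1 / 2 : ℝ) ^ n * 1 :=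
          Finset.sum_le_sum fun x _ => mul_le_mul_of_nonneg_left (by split_ifs <;> simp)
            (by positivity)
      _ = 1 := by simp

lemma sum_distortion : ∑ i, distortion V c i
    = (1 / 2) ^ n * ∑ x : Fin n → Bool, (hammingDist x (c (V x)) : ℝ) := by
  unfold distortion
  rw [Finset.sum_comm, Finset.mul_sum]
  refine Finset.sum_congr rfl fun x _ => ?_
  rw [← Finset.mul_sum, hammingDist, Finset.card_filter]
  push_cast
  rfl

/-- Relative to the reproduction of `X₁ᵢ`, the triple `(X₁ᵢ, X₂ᵢ, Yᵢ)` is a Bernoulli bit sent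
through the channel. -/
lemma lawOf_xor_coord (p q : ℝ) (i : Fin n) (t : Bool × Bool) :
    lawOf (iidLaw (srcLaw p q) n) (fun s => (xor (c (V fun j => (s j).1) i) (s i).2.1,
      xor (c (V fun j => (s j).1) i) (s i).2.2)) t
      = ∑ a, bern (distortion V c i) a * chan p q a t := by
  have h1 := lawOf_lawOf (p := iidLaw (srcLaw p q) n) (fun s => ((fun j => (s j).1), (s i).2))
    fun u : (Fin n → Bool) × (Bool × Bool) =>
      (xor (c (V u.1) i) u.2.1, xor (c (V u.1) i) u.2.2)
  rw [← h1]
  conv_lhs => unfold lawOf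
  rw [Fintype.sum_prod_type]
  have h2 : ∀ x : Fin n → Bool, ∑ u : Bool × Bool,
      (if (xor (c (V x) i) u.1, xor (c (V x) i) u.2) = t then
        lawOf (iidLaw (srcLaw p q) n) (fun s => ((fun j => (s j).1), (s i).2)) (x, u) else 0)
      = (1 / 2) ^ n * chan p q (xor (c (V x) i) (x i)) t := by
    intro x
    rw [Finset.sum_eq_single (xor (c (V x) i) t.1, xor (c (V x) i) t.2)]
    · rw [lawOf_block_coord, if_pos (by simp)]
      simp only [chan]
      cases c (V x) i <;> cases x i <;> simp
    · intro u _ hu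
      refine if_neg fun h => hu ?_
      rw [← h]; simp
    · simp
  refine (Finset.sum_congr rfl fun x _ => h2 x).trans ?_
  have h3 : ∀ x : Fin n → Bool, (1 / 2 : ℝ) ^ n * chan p q (xor (c (V x) i) (x i)) t
      = (1 / 2) ^ n * (if x i ≠ c (V x) i then 1 else 0) * chan p q true t
        + ((1 / 2) ^ n - (1 / 2) ^ n * (if x i ≠ c (V x) i then 1 else 0)) * chan p q false t := by
    intro x
    by_cases hx : x i = c (V x) i
    · simp [hx]
    · have : xor (c (V x) i) (x i) = true := by
        revert hx; cases c (V x) i <;> cases x i <;> simp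
      simp [hx, this]
  simp only [h3, Finset.sum_add_distrib, ← Finset.sum_mul, Finset.sum_sub_distrib]
  simp [bern, distortion]

lemma concaveOn_h₂ : ConcaveOn ℝ (Set.Icc 0 1) h₂ := by
  have h := Real.strictConcave_binEntropy.concaveOn.smul (inv_nonneg.2 log_two_pos.le)
  refine h.congr fun x _ => ?_
  simp [h₂, div_eq_inv_mul]

/-- `H(Y | X₂)` is concave in the law of `X₁`, so `f` is convex. -/
lemma sum_lossFn_bern_le (hp : p ∈ Set.Icc (0 : ℝ) 1) (hq : q ∈ Set.Icc (0 : ℝ) 1) (hn : 0 < n)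
    (D : Fin n → ℝ) (hD : ∀ i, D i ∈ Set.Icc (0 : ℝ) 1) :
    ∑ i, lossFn (chan p q) (bern (D i)) ≤ n * lossFn (chan p q) (bern ((∑ i, D i) / n)) := by
  have hn' : (n : ℝ) ≠ 0 := by positivity
  unfold lossFn
  rw [Finset.sum_comm, Finset.mul_sum]
  refine Finset.sum_le_sum fun b _ => ?_
  rw [← condFn_smul]
  refine (condFn_sum_le _ _ fun i y => Finset.sum_nonneg fun a _ =>
    mul_nonneg (bern_nonneg (hD i).1 (hD i).2 a) (chan_nonneg hp hq _ _)).trans (le_of_eq ?_)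
  congr 1
  funext y
  simp only [Fintype.sum_bool, bern, Finset.sum_add_distrib, ← Finset.sum_mul, if_true,
    Bool.false_eq_true, if_false, Finset.sum_sub_distrib, Finset.sum_const, Finset.card_univ,
    Fintype.card_fin, nsmul_eq_mul, mul_one]
  field_simp

lemma f_half (p q : ℝ) : f p q (1 / 2) = 0 := by
  rw [f_eq_fBias]; simp [fBias, curveΦ]

lemma h₂_le_one (x : ℝ) : h₂ x ≤ 1 := by
  rw [h₂, div_le_one log_two_pos]; exact Real.binEntropy_le_log_two

lemma h₂_half : h₂ (1 / 2) = 1 := by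
  rw [h₂, one_div, Real.binEntropy_two_inv, div_self log_two_pos.ne']

lemma f_nonneg (hp : p ∈ Set.Ioo (0 : ℝ) (1 / 2)) (hq : q ∈ Set.Ioo (0 : ℝ) (1 / 2)) {r : ℝ}
    (hr : r ∈ Set.Icc (0 : ℝ) 1) : 0 ≤ f p q r := by
  have h : ∀ r ∈ Set.Icc (0 : ℝ) (1 / 2), 0 ≤ f p q r := fun r hr => by
    rw [← f_half p q]
    exact antitoneOn_f hp hq hr ⟨by norm_num, le_rfl⟩ hr.2
  rcases le_total r (1 / 2) with h' | h'
  · exact h r ⟨hr.1, h'⟩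
  · rw [← f_one_sub]
    exact h _ ⟨by linarith [hr.2], by linarith⟩

variable (hp : p ∈ Set.Ioo (0 : ℝ) (1 / 2)) (hq : q ∈ Set.Ioo (0 : ℝ) (1 / 2)) (hn : 0 < n)
  {D : ℝ} (hD : 0 ≤ D)
  (hdist : ∑ x : Fin n → Bool, (hammingDist x (c (V x)) : ℝ) ≤ 2 ^ n * (n * D))

include hn hdist

lemma mean_distortion_le : (∑ i, distortion V c i) / n ≤ D := by
  have hn' : (0 : ℝ) < n := by exact_mod_cast hn
  rw [div_le_iff₀ hn', sum_distortion]
  calc (1 / 2 : ℝ) ^ n * ∑ x : Fin n → Bool, (hammingDist x (c (V x)) : ℝ)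
      ≤ (1 / 2 : ℝ) ^ n * (2 ^ n * (n * D)) := by gcongr
    _ = D * n := by rw [← mul_assoc, ← mul_pow]; norm_num; ring

include hp hq hD

/-- Given the side information, the description by a quantizer of mean distortion `D` has entropy
at most `g D` per letter, up to the excess of its rate over `1 - h₂ D`: the entropy of `X₂ⁿ` given
the description is at most that of its difference from the reproduction. -/
lemma condEnt_quantizer_le : condEnt (iidLaw (srcLaw p q) n) (fun s => V fun i => (s i).1)
      (fun s i => (s i).2.1)
    ≤ n * h₂ (bconv (min D (1 / 2)) q) - n + Real.logb 2 L := by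
  have hp' : p ∈ Set.Icc (0 : ℝ) 1 := ⟨hp.1.le, by linarith [hp.2]⟩
  have hq' : q ∈ Set.Icc (0 : ℝ) 1 := ⟨hq.1.le, by linarith [hq.2]⟩
  have hn' : (0 : ℝ) < n := by exact_mod_cast hn
  set P := iidLaw (srcLaw p q) n with hP
  have hP0 : ∀ s, 0 ≤ P s := prodLaw_nonneg (srcLaw_nonneg hp' hq')
  have hP1 : ∑ s, P s = 1 := sum_prodLaw (sum_srcLaw p q)
  set Vv : (Fin n → Bool × Bool × Bool) → Fin L := fun s => V fun i => (s i).1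
  have hbc : ∀ r ∈ Set.Icc (0 : ℝ) 1, bconv r q ∈ Set.Icc (0 : ℝ) 1 := by
    intro r hr
    obtain ⟨h1, h2⟩ := hr
    obtain ⟨h3, h4⟩ := hq'
    unfold bconv
    constructor <;> nlinarith
  have h1 : ∀ i, condEnt P (fun s => (s i).2.1) Vv ≤ h₂ (bconv (distortion V c i) q) := by
    intro i
    rw [← condEnt_relabel (fun s : Fin n → Bool × Bool × Bool => (s i).2.1) Vv
      (fun v b => xor (c v i) b) fun v b b' h => by simpa using h]
    refine (condEnt_le_ent hP0 hP1 _ _).trans (le_of_eq ?_)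
    rw [ent, ← entropy_bern]
    congr 1
    funext b
    have h2 := lawOf_lawOf (p := P)
        (fun s => (xor (c (Vv s) i) (s i).2.1, xor (c (Vv s) i) (s i).2.2))
      Prod.fst
    simp only at h2
    rw [← h2]
    rw [lawOf_fst]
    simp only [hP, Vv, lawOf_xor_coord]
    cases b <;> simp [bern, chan, bconv] <;> ring
  have h2 : ∑ i, h₂ (bconv (distortion V c i) q)
      ≤ n * h₂ (bconv ((∑ i, distortion V c i) / n) q) := by
    have hj := concaveOn_h₂.le_map_sum (t := Finset.univ) (w := fun _ : Fin n => 1 / (n : ℝ))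
      (p := fun i => bconv (distortion V c i) q) (fun _ _ => by positivity) (by simp [hn'.ne'])
      fun i _ => hbc _ (distortion_mem V c i)
    simp only [smul_eq_mul, ← Finset.mul_sum] at hj
    have e : 1 / (n : ℝ) * ∑ i, bconv (distortion V c i) q
        = bconv ((∑ i, distortion V c i) / n) q := by
      simp only [bconv, Finset.sum_add_distrib, ← Finset.sum_mul, ← Finset.mul_sum,
        Finset.sum_sub_distrib, Finset.sum_const, Finset.card_univ, Fintype.card_fin,
        nsmul_eq_mul, mul_one]
      field_simp
    rw [e] at hj
    have := mul_le_mul_of_nonneg_left hj hn'.le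
    rwa [← mul_assoc, mul_one_div_cancel hn'.ne', one_mul] at this
  have hav := mean_distortion_le V c hn hdist
  have hav0 : 0 ≤ (∑ i, distortion V c i) / n :=
    div_nonneg (Finset.sum_nonneg fun i _ => (distortion_mem V c i).1) hn'.le
  have h3 : h₂ (bconv ((∑ i, distortion V c i) / n) q) ≤ h₂ (bconv (min D (1 / 2)) q) := by
    rcases le_total D (1 / 2) with hD' | hD'
    · rw [min_eq_left hD']
      refine div_le_div_of_nonneg_right ?_ log_two_pos.le
      refine Real.binEntropy_strictMonoOn.monotoneOn ?_ ?_ ?_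
      · unfold bconv; constructor <;> nlinarith [hq.1, hq.2]
      · unfold bconv; constructor <;> nlinarith [hq.1, hq.2]
      · unfold bconv; nlinarith [hq.1, hq.2]
    · rw [min_eq_right hD']
      have : bconv (1 / 2) q = 1 / 2 := by unfold bconv; ring
      rw [this, h₂_half]
      exact h₂_le_one _
  have hpi := condEnt_pi_le hP0 Vv fun i s => (s i).2.1
  have hV := ent_le_logb_card hP0 hP1 Vv
  rw [Fintype.card_fin] at hV
  have hX := ent_X₂ p q n
  have hswap : ent P (fun s => (Vv s, fun i => (s i).2.1))
      = ent P (fun s => ((fun i => (s i).2.1), Vv s)) :=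
    ent_of_injective (fun s : Fin n → Bool × Bool × Bool => ((fun i => (s i).2.1), Vv s))
      (e := Prod.swap) Prod.swap_injective
  have hchain : condEnt P Vv (fun s i => (s i).2.1)
      = condEnt P (fun s i => (s i).2.1) Vv + ent P Vv - n := by
    rw [condEnt, condEnt, hswap, hX]; ring
  rw [hchain]
  have h4 := Finset.sum_le_sum fun i (_ : i ∈ Finset.univ) => h1 i
  have h5 := mul_le_mul_of_nonneg_left h3 hn'.le
  linarith

/-- A quantizer of mean distortion `D` leaves an uncertainty about `Yⁿ` of at most
`h₂ (p ∗ q) - f D` per letter, because `f` is convex. -/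
lemma condEnt_Y_quantizer_le : condEnt (iidLaw (srcLaw p q) n) (fun s i => (s i).2.2)
      (fun s => (V fun i => (s i).1, fun i => (s i).2.1))
    ≤ n * (h₂ (bconv p q) - f p q (min D (1 / 2))) := by
  have hp' : p ∈ Set.Icc (0 : ℝ) 1 := ⟨hp.1.le, by linarith [hp.2]⟩
  have hq' : q ∈ Set.Icc (0 : ℝ) 1 := ⟨hq.1.le, by linarith [hq.2]⟩
  have hn' : (0 : ℝ) < n := by exact_mod_cast hn
  set P := iidLaw (srcLaw p q) n with hP
  have hP0 : ∀ s, 0 ≤ P s := prodLaw_nonneg (srcLaw_nonneg hp' hq')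
  set VX : (Fin n → Bool × Bool × Bool) → Fin L × (Fin n → Bool) :=
    fun s => (V fun i => (s i).1, fun i => (s i).2.1)
  have h1 : ∀ i, condEnt P (fun s => (s i).2.2) VX
      ≤ lossFn (chan p q) (bern (distortion V c i)) := by
    intro i
    rw [← condEnt_relabel (fun s : Fin n → Bool × Bool × Bool => (s i).2.2) VX
      (fun v b => xor (c v.1 i) b) fun v b b' h => by simpa using h]
    refine (condEnt_le_condEnt_comp hP0 _ VX fun v => xor (c v.1 i) (v.2 i)).trans (le_of_eq ?_)
    rw [condEnt_eq_sum]
    unfold lossFn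
    refine Finset.sum_congr rfl fun b _ => ?_
    congr 1
    funext y
    rw [← lawOf_xor_coord]
    simp only [lawOf, hP, VX, Prod.mk.injEq, and_comm]
  have h2 := sum_lossFn_bern_le hp' hq' hn (distortion V c) (distortion_mem V c)
  rw [lossFn_bern hp hq] at h2
  have hav := mean_distortion_le V c hn hdist
  have hav0 : 0 ≤ (∑ i, distortion V c i) / n :=
    div_nonneg (Finset.sum_nonneg fun i _ => (distortion_mem V c i).1) hn'.le
  have hav1 : (∑ i, distortion V c i) / n ≤ 1 := by
    rw [div_le_one hn']
    simpa using Finset.sum_le_sum fun i (_ : i ∈ Finset.univ) => (distortion_mem V c i).2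
  have h3 : f p q (min D (1 / 2)) ≤ f p q ((∑ i, distortion V c i) / n) := by
    rcases le_total D (1 / 2) with hD' | hD'
    · rw [min_eq_left hD']
      exact antitoneOn_f hp hq ⟨hav0, hav.trans hD'⟩ ⟨hD, hD'⟩ hav
    · rw [min_eq_right hD', f_half]
      exact f_nonneg hp hq ⟨hav0, hav1⟩
  have hpi := condEnt_pi_le hP0 VX fun i s => (s i).2.2
  have h4 := Finset.sum_le_sum fun i (_ : i ∈ Finset.univ) => h1 i
  have h5 := mul_le_mul_of_nonneg_left h3 hn'.le
  rw [mul_sub] at h2 ⊢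
  linarith

end Quantizer

/-! ### Achievability -/

section Achievability

variable {p q : ℝ}

lemma lawOf_curry {ι κ α : Type*} [Fintype ι] [Fintype κ] [Fintype α] [DecidableEq ι]
    [DecidableEq κ] [DecidableEq α] (P : α → ℝ) :
    lawOf (prodLaw P) (fun (s : ι × κ → α) i k => s (i, k)) = prodLaw (prodLaw P) := by
  funext t
  unfold lawOf
  rw [Finset.sum_eq_single fun x : ι × κ => t x.1 x.2]
  · simp [prodLaw, Fintype.prod_prod_type]
  · intro s _ hs
    refine if_neg fun h => hs ?_
    rw [← h]
  · simp

/-- `H(Y | X₂)` of one letter, the value of the loss at the uninformative `r = 1 / 2`. -/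
lemma condEnt_srcLaw (hp : p ∈ Set.Ioo (0 : ℝ) (1 / 2)) (hq : q ∈ Set.Ioo (0 : ℝ) (1 / 2)) :
    condEnt (srcLaw p q) (fun t => t.2.2) (fun t => t.2.1) = h₂ (bconv p q) := by
  have h := lossFn_bern hp hq (1 / 2)
  rw [f_half, sub_zero] at h
  rw [← h, condEnt_eq_sum]
  unfold lossFn
  refine Finset.sum_congr rfl fun b _ => ?_
  congr 1
  funext y
  cases b <;> cases y <;> norm_num [lawOf, srcLaw, bern, Fintype.sum_prod_type]

/-- Concatenation: a quantizer of block length `n₀` is applied to `N` blocks, the resulting indices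
are binned, and `s` further coordinates are ignored. -/
lemma exists_encoder (hp : p ∈ Set.Ioo (0 : ℝ) (1 / 2)) (hq : q ∈ Set.Ioo (0 : ℝ) (1 / 2))
    {n₀ L : ℕ} (V : (Fin n₀ → Bool) → Fin L) :
    ∃ C : ℝ, ∀ N s : ℕ, ∃ (M : ℕ) (enc : (Fin (N * n₀ + s) → Bool) → Fin M),
      Real.logb 2 M ≤ N * condEnt (iidLaw (srcLaw p q) n₀) (fun s => V fun i => (s i).1)
        (fun s i => (s i).2.1) + 1 ∧
      ((N * n₀ + s : ℕ) : ℝ) - (1 + C * √N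
        + N * condEnt (iidLaw (srcLaw p q) n₀) (fun s i => (s i).2.2)
          (fun s => (V fun i => (s i).1, fun i => (s i).2.1))
        + s * h₂ (bconv p q)) ≤ relevance (srcLaw p q) (N * n₀ + s) enc := by
  have hp' : p ∈ Set.Icc (0 : ℝ) 1 := ⟨hp.1.le, by linarith [hp.2]⟩
  have hq' : q ∈ Set.Icc (0 : ℝ) 1 := ⟨hq.1.le, by linarith [hq.2]⟩
  have hsrc1 := sum_srcLaw p q
  set P₀ := iidLaw (srcLaw p q) n₀ with hP₀
  have hP₀0 : ∀ s, 0 ≤ P₀ s := prodLaw_nonneg (srcLaw_nonneg hp' hq')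
  have hP₀1 : ∑ s, P₀ s = 1 := sum_prodLaw hsrc1
  let VX : (Fin n₀ → Bool × Bool × Bool) → Fin L × (Fin n₀ → Bool) :=
    fun s => (V fun i => (s i).1, fun i => (s i).2.1)
  obtain ⟨C, hC⟩ := exists_block_binning (Q := lawOf P₀ VX) (lawOf_nonneg hP₀0 _)
    (by rw [sum_lawOf, hP₀1])
  refine ⟨C, fun N s => ?_⟩
  let e : (Fin N × Fin n₀) ⊕ Fin s ≃ Fin (N * n₀ + s) :=
    (Equiv.sumCongr finProdFinEquiv (Equiv.refl _)).trans finSumFinEquiv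
  set P := iidLaw (srcLaw p q) (N * n₀ + s) with hP
  have hP0 : ∀ s, 0 ≤ P s := prodLaw_nonneg (srcLaw_nonneg hp' hq')
  have hblk : lawOf P (fun u (j : Fin N) (k : Fin n₀) => u (e (.inl (j, k)))) = prodLaw P₀ := by
    have h1 := lawOf_prodLaw hsrc1 (fun a => a) (e := fun x : Fin N × Fin n₀ => e (.inl x))
      fun x y h => Sum.inl_injective (e.injective h)
    rw [lawOf_id] at h1
    have h2 := lawOf_lawOf (p := P) (fun u (x : Fin N × Fin n₀) => u (e (.inl x)))
      fun (t : Fin N × Fin n₀ → Bool × Bool × Bool) j k => t (j, k)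
    rw [← h2, hP, iidLaw_eq_prodLaw, h1, lawOf_curry, hP₀, iidLaw_eq_prodLaw]
  have hblk1 : ∀ j, lawOf P (fun u (k : Fin n₀) => u (e (.inl (j, k)))) = P₀ := by
    intro j
    have h1 := lawOf_prodLaw hsrc1 (fun a => a) (e := fun k : Fin n₀ => e (.inl (j, k)))
      fun x y h => (Prod.ext_iff.1 (Sum.inl_injective (e.injective h))).2
    rwa [lawOf_id] at h1
  have hrest : ∀ i, lawOf P (fun u => u (e (.inr i))) = srcLaw p q := by
    intro i
    have h1 := lawOf_prodLaw hsrc1 (fun a => a) (e := fun _ : Unit => e (.inr i))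
      fun _ _ _ => rfl
    have h2 := lawOf_lawOf (p := P) (fun u (_ : Unit) => u (e (.inr i)))
      fun t : Unit → Bool × Bool × Bool => t ()
    rw [← h2, hP, iidLaw_eq_prodLaw, h1, lawOf_id]
    funext t
    unfold lawOf
    rw [Finset.sum_eq_single fun _ => t]
    · simp [prodLaw]
    · intro u _ hu
      exact if_neg fun h => hu (funext fun _ => h)
    · simp
  let vv : (Fin (N * n₀ + s) → Bool × Bool × Bool) → Fin N → Fin L :=
    fun u j => V fun k => (u (e (.inl (j, k)))).1
  let xx : (Fin (N * n₀ + s) → Bool × Bool × Bool) → Fin N → Fin n₀ → Bool :=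
    fun u j k => (u (e (.inl (j, k)))).2.1
  obtain ⟨M, -, hM, b, hb⟩ := hC N P hP0 vv xx (by
    have h1 := lawOf_prodLaw hP₀1 VX (e := fun j : Fin N => j) fun _ _ h => h
    rw [← hblk, lawOf_lawOf] at h1
    exact h1)
  rw [← condEnt_comp VX Prod.fst Prod.snd] at hM
  refine ⟨M, fun x => b fun j => V fun k => x (e (.inl (j, k))), hM, ?_⟩
  let Yv : (Fin (N * n₀ + s) → Bool × Bool × Bool) → Fin (N * n₀ + s) → Bool := fun u i => (u i).2.2
  let JX : (Fin (N * n₀ + s) → Bool × Bool × Bool) → Fin M × (Fin (N * n₀ + s) → Bool) :=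
    fun u => (b (vv u), fun i => (u i).2.1)
  have hrel : relevance (srcLaw p q) (N * n₀ + s)
        (fun x => b fun j => V fun k => x (e (.inl (j, k))))
      = ent P Yv - condEnt P Yv JX := by
    unfold relevance mutualInfo condEnt ent
    ring
  rw [hrel, show ent P Yv = _ from ent_Y p q _]
  refine sub_le_sub_left ?_ _
  have h1 : condEnt P Yv JX ≤ condEnt P (fun u => (vv u, Yv u)) JX :=
    condEnt_comp_le hP0 (fun u => (vv u, Yv u)) Prod.snd JX
  rw [condEnt_prod] at h1
  have h2 : condEnt P vv JX ≤ 1 + C * √N :=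
    (condEnt_le_condEnt_comp hP0 vv JX fun t => (t.1, fun j k => t.2 (e (.inl (j, k))))).trans hb
  let Z : (Fin (N * n₀ + s) → Bool × Bool × Bool) →
    (Fin N → Fin L) × (Fin M × (Fin (N * n₀ + s) → Bool)) := fun u => (vv u, JX u)
  have h3 : condEnt P Yv Z ≤ condEnt P (fun u => ((fun j k => (u (e (.inl (j, k)))).2.2),
      fun i => (u (e (.inr i))).2.2)) Z := by
    have h4 := condEnt_comp_le hP0 (fun u => ((fun (j : Fin N) (k : Fin n₀) =>
      (u (e (.inl (j, k)))).2.2), fun i : Fin s => (u (e (.inr i))).2.2))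
      (fun t i => Sum.elim (fun x => t.1 x.1 x.2) t.2 (e.symm i)) Z
    refine le_trans (le_of_eq ?_) h4
    congr 1
    funext u i
    obtain ⟨x, rfl⟩ := e.surjective i
    rcases x with ⟨j, k⟩ | i <;> simp [Yv]
  have h5 := h3.trans (condEnt_prod_le hP0 _ _ _)
  have h6 : condEnt P (fun u (j : Fin N) (k : Fin n₀) => (u (e (.inl (j, k)))).2.2) Z
      ≤ N * condEnt P₀ (fun s i => (s i).2.2) VX := by
    refine (condEnt_pi_le hP0 Z fun j u k => (u (e (.inl (j, k)))).2.2).trans ?_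
    refine (Finset.sum_le_sum (g := fun _ => condEnt P₀ (fun s i => (s i).2.2) VX)
      fun j _ => ?_).trans (by simp)
    rw [← hblk1 j, ← condEnt_comp (fun (u : Fin (N * n₀ + s) → Bool × Bool × Bool) (k : Fin n₀) =>
      u (e (.inl (j, k)))) (fun s i => (s i).2.2) VX]
    exact condEnt_le_condEnt_comp hP0 (fun u k => (u (e (.inl (j, k)))).2.2) Z
      fun z => (z.1 j, fun k => z.2.2 (e (.inl (j, k))))
  have h7 : condEnt P (fun u (i : Fin s) => (u (e (.inr i))).2.2) Z ≤ s * h₂ (bconv p q) := by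
    refine (condEnt_pi_le hP0 Z fun i u => (u (e (.inr i))).2.2).trans ?_
    refine (Finset.sum_le_sum (g := fun _ => h₂ (bconv p q)) fun i _ => ?_).trans (by simp)
    rw [← condEnt_srcLaw hp hq, ← hrest i, ← condEnt_comp
        (fun u : Fin (N * n₀ + s) → Bool × Bool × Bool => u (e (.inr i)))
      (fun t : Bool × Bool × Bool => t.2.2) fun t => t.2.1]
    exact condEnt_le_condEnt_comp hP0 (fun u => (u (e (.inr i))).2.2) Z
      fun z => z.2.2 (e (.inr i))
  linarith

/-- Every point of the curve `r ↦ (g r, f r)`, time-shared with the origin, is achievable. -/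
lemma achievable_of_curve (hp : p ∈ Set.Ioo (0 : ℝ) (1 / 2)) (hq : q ∈ Set.Ioo (0 : ℝ) (1 / 2))
    {r θ R : ℝ} (hr : r ∈ Set.Icc (0 : ℝ) (1 / 2)) (hθ : θ ∈ Set.Icc (0 : ℝ) 1) (hR : 0 ≤ R)
    (hgR : θ * g q r ≤ R) :
    Achievable (srcLaw p q) R (1 - h₂ (bconv p q) + θ * f p q r) := by
  have hf0 : 0 ≤ f p q r := f_nonneg hp hq ⟨hr.1, by linarith [hr.2]⟩
  have hh1 := h₂_le_one (bconv p q)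
  refine ⟨hR, by have := mul_nonneg hθ.1 hf0; linarith, fun ε hε => ?_⟩
  -- a distortion margin `δ` that costs little in both functions
  obtain ⟨δ, hδ0, hδε, hδg, hδf⟩ : ∃ δ > 0, δ ≤ ε / 8 ∧
      h₂ (bconv (min (r + δ) (1 / 2)) q) ≤ h₂ (bconv r q) + ε / 8 ∧
      f p q r - ε / 8 ≤ f p q (min (r + δ) (1 / 2)) := by
    have hc : Filter.Tendsto (fun δ : ℝ => min (r + δ) (1 / 2)) (nhdsWithin 0 (Set.Ioi 0))
        (nhds r) := by
      have : Continuous fun δ : ℝ => min (r + δ) (1 / 2) := by fun_prop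
      have h := this.tendsto 0
      rw [add_zero, min_eq_left hr.2] at h
      exact h.mono_left nhdsWithin_le_nhds
    have hcb : Continuous fun x => h₂ (bconv x q) := by
      have := continuous_h₂
      unfold bconv; fun_prop
    have h1 := ((hcb.tendsto r).comp hc).eventually_le_const
      (show h₂ (bconv r q) < h₂ (bconv r q) + ε / 8 by linarith)
    have h2 := (((continuous_f p q).tendsto r).comp hc).eventually_const_le
      (show f p q r - ε / 8 < f p q r by linarith)
    have h3 : ∀ᶠ δ in nhdsWithin (0 : ℝ) (Set.Ioi 0), δ ∈ Set.Ioo 0 (ε / 8) :=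
      Ioo_mem_nhdsGT (by positivity)
    obtain ⟨δ, h1, h2, h3⟩ := (h1.and (h2.and h3)).exists
    exact ⟨δ, h3.1, h3.2.le, h1, h2⟩
  obtain ⟨n₀, L, c, V, hn₀, hL, hdist⟩ := exists_quantizer hr.1 hr.2 hδ0
  have hn₀' : (1 : ℝ) ≤ n₀ := by exact_mod_cast hn₀
  have hD : 0 ≤ r + δ := by linarith [hr.1]
  have hV := condEnt_quantizer_le V c hp hq hn₀ hD hdist
  have hY := condEnt_Y_quantizer_le V c hp hq hn₀ hD hdist
  obtain ⟨C, hC⟩ := exists_encoder hp hq V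
  set HV := condEnt (iidLaw (srcLaw p q) n₀) (fun s => V fun i => (s i).1) (fun s i => (s i).2.1)
  set HY := condEnt (iidLaw (srcLaw p q) n₀) (fun s i => (s i).2.2)
    (fun s => (V fun i => (s i).1, fun i => (s i).2.1))
  have hV' : HV ≤ n₀ * (g q r + ε / 4) := by
    have : (n₀ : ℝ) * h₂ (bconv (min (r + δ) (1 / 2)) q) ≤ n₀ * (h₂ (bconv r q) + ε / 8) := by
      gcongr
    have h3 : (n₀ : ℝ) * (1 - h₂ r + δ) ≤ n₀ * (1 - h₂ r + ε / 8) := by gcongr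
    have h4 : (n₀ : ℝ) * (g q r + ε / 4) = n₀ * (h₂ (bconv r q) + ε / 8) - n₀
      + n₀ * (1 - h₂ r + ε / 8) := by rw [g]; ring
    linarith
  have hY' : HY ≤ n₀ * (h₂ (bconv p q) - f p q r + ε / 8) :=
    hY.trans (mul_le_mul_of_nonneg_left (by linarith) (by linarith))
  have hsqrt : Filter.Tendsto (fun n : ℕ => √(n : ℝ)) Filter.atTop Filter.atTop :=
    Real.tendsto_sqrt_atTop.comp tendsto_natCast_atTop_atTop
  obtain ⟨n₁, hn₁⟩ := Filter.eventually_atTop.1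
    ((hsqrt.eventually_ge_atTop (|C| / (ε / 4))).and
      (((tendsto_natCast_atTop_atTop (R := ℝ)).eventually_ge_atTop
        ((n₀ * f p q r + 1) / (ε / 2))).and
      (((tendsto_natCast_atTop_atTop (R := ℝ)).eventually_ge_atTop (1 / (ε / 2))).and
        (Filter.eventually_ge_atTop 1))))
  refine ⟨n₁, fun n hn => ?_⟩
  obtain ⟨k1, k2, k3, k4⟩ := hn₁ n hn.le
  have hn0 : (0 : ℝ) < n := by exact_mod_cast k4
  rw [div_le_iff₀ (by positivity)] at k1 k2 k3
  obtain ⟨N, hN1, hN2⟩ : ∃ N : ℕ, (N : ℝ) * n₀ ≤ θ * n ∧ θ * n - n₀ ≤ (N : ℝ) * n₀ := by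
    refine ⟨⌊θ * n / n₀⌋₊, ?_, ?_⟩
    · have := Nat.floor_le (show 0 ≤ θ * n / n₀ from
        div_nonneg (mul_nonneg hθ.1 hn0.le) (by linarith))
      rwa [le_div_iff₀ (by linarith)] at this
    · have := (Nat.lt_floor_add_one (θ * n / n₀)).le
      rw [div_le_iff₀ (by linarith)] at this
      linarith
  have hθn : θ * n ≤ n := mul_le_of_le_one_left hn0.le hθ.2
  have hNn : N * n₀ ≤ n := by
    have : ((N * n₀ : ℕ) : ℝ) ≤ n := by push_cast; linarith
    exact_mod_cast this
  obtain ⟨s, rfl⟩ := Nat.exists_eq_add_of_le hNn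
  obtain ⟨M, enc, hM, hrel⟩ := hC N s
  refine ⟨M, enc, ?_, ?_⟩
  · have h1 : (N : ℝ) * HV ≤ N * (n₀ * (g q r + ε / 4)) := by gcongr
    have hg0 : 0 ≤ g q r := by
      rw [← g_half q]
      exact (strictAntiOn_g hp hq).antitoneOn hr ⟨by norm_num, le_rfl⟩ hr.2
    have h2 : (N : ℝ) * n₀ * (g q r + ε / 4) ≤ θ * (N * n₀ + s : ℕ) * (g q r + ε / 4) := by gcongr
    have h3 : θ * (N * n₀ + s : ℕ) * (ε / 4) ≤ (N * n₀ + s : ℕ) * (ε / 4) := by gcongr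
    have h4 : (N * n₀ + s : ℕ) * (θ * g q r) ≤ (N * n₀ + s : ℕ) * R := by gcongr
    rw [one_div, inv_mul_le_iff₀ hn0]
    nlinarith
  · rw [one_div, inv_mul_eq_div, le_div_iff₀ hn0]
    have h1 : (N : ℝ) * HY ≤ N * (n₀ * (h₂ (bconv p q) - f p q r + ε / 8)) := by gcongr
    have h2 : C * √N ≤ ε / 4 * (N * n₀ + s : ℕ) := by
      have hNle : (N : ℝ) ≤ (N * n₀ + s : ℕ) := by
        have : N ≤ N * n₀ + s := le_trans (Nat.le_mul_of_pos_right N hn₀) (Nat.le_add_right _ _)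
        exact_mod_cast this
      calc C * √N ≤ |C| * √((N * n₀ + s : ℕ) : ℝ) := by
            gcongr
            exact le_abs_self C
        _ ≤ √((N * n₀ + s : ℕ) : ℝ) * (ε / 4) * √((N * n₀ + s : ℕ) : ℝ) := by gcongr
        _ = ε / 4 * (√((N * n₀ + s : ℕ) : ℝ) * √((N * n₀ + s : ℕ) : ℝ)) := by ring
        _ = ε / 4 * (N * n₀ + s : ℕ) := by rw [Real.mul_self_sqrt hn0.le]
    have h3 : (θ * (N * n₀ + s : ℕ) - n₀) * f p q r ≤ N * n₀ * f p q r := by gcongr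
    have h4 : (N : ℝ) * n₀ * (ε / 8) ≤ (N * n₀ + s : ℕ) * (ε / 8) := by
      gcongr
      exact hN1.trans hθn
    have h5 : (s : ℝ) = (N * n₀ + s : ℕ) - N * n₀ := by push_cast; ring
    have h6 : (s : ℝ) * h₂ (bconv p q) = (N * n₀ + s : ℕ) * h₂ (bconv p q)
      - N * n₀ * h₂ (bconv p q) := by rw [← sub_mul, ← h5]
    have h7 : (0 : ℝ) ≤ (N * n₀ + s : ℕ) * ε := by positivity
    generalize ((N * n₀ + s : ℕ) : ℝ) = n at *
    linarith

end Achievability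

end InfoBottleneck

theorem theorem11 {Ω : Type*} [MeasurableSpace Ω] (μ : Measure Ω) [IsProbabilityMeasure μ]
    (p q : ℝ) (hp : p ∈ Set.Ioo (0 : ℝ) (1 / 2)) (hq : q ∈ Set.Ioo (0 : ℝ) (1 / 2))
    (X₁ X₂ Y Z W : Ω → Bool)
    (hX₂ : Measurable X₂) (hZ : Measurable Z) (hW : Measurable W)
    (hX₂law : μ.real {ω | X₂ ω = true} = 1 / 2)
    (hZlaw : μ.real {ω | Z ω = true} = q)
    (hWlaw : μ.real {ω | W ω = true} = p)
    (hX₁ : ∀ ω, X₁ ω = xor (X₂ ω) (Z ω))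
    (hY : ∀ ω, Y ω = xor (X₁ ω) (W ω))
    (hZX₂ : IndepFun Z X₂ μ)
    (hWX : IndepFun W (fun ω => (X₁ ω, X₂ ω)) μ) :
    ∃ Rc ∈ Set.Ico (0 : ℝ) (InfoBottleneck.h₂ q),
      -- `Rc` is the unique solution of the tangency condition, and is `0` if there is none
      (∀ T ∈ Set.Ioo (0 : ℝ) (InfoBottleneck.h₂ q), InfoBottleneck.Tangency p q T ↔ T = Rc) ∧
      -- the parameters for which the tangency condition has a solution
      (0 < Rc ↔ (1 - 2 * q) ^ 2 * ((1 - 2 * q) ^ 2 + 3) * (1 - 2 * p) ^ 2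
        < 5 * (1 - 2 * q) ^ 2 - 1) ∧
      -- the relevance-rate function
      ∀ R : ℝ, 0 ≤ R →
        IsLUB {m : ℝ | (R, m) ∈ InfoBottleneck.region (InfoBottleneck.jointLaw μ X₁ X₂ Y)}
          (if R ≤ Rc then
            1 - InfoBottleneck.h₂ (InfoBottleneck.bconv p q)
              + InfoBottleneck.f p q (InfoBottleneck.gInv q Rc) / Rc * R
          else if R ≤ InfoBottleneck.h₂ q then
            1 - InfoBottleneck.h₂ (InfoBottleneck.bconv p q)
              + InfoBottleneck.f p q (InfoBottleneck.gInv q R)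
          else 1 - InfoBottleneck.h₂ p) := by
  obtain ⟨Rc, hRc, hT, hcond, henv⟩ := InfoBottleneck.exists_criticalRate hp hq
  refine ⟨Rc, hRc, hT, hcond, fun R hR => ?_⟩
  obtain ⟨⟨l, hl, hsupp⟩, θ, hθ, r, hr, hrate, hval⟩ := henv R hR
  rw [InfoBottleneck.jointLaw_eq μ X₁ X₂ Y Z W hX₂ hZ hW hX₂law hZlaw hWlaw hX₁ hY hZX₂ hWX]
  have hvalue : (if R ≤ Rc then
      1 - InfoBottleneck.h₂ (InfoBottleneck.bconv p q)
        + InfoBottleneck.f p q (InfoBottleneck.gInv q Rc) / Rc * R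
      else if R ≤ InfoBottleneck.h₂ q then
        1 - InfoBottleneck.h₂ (InfoBottleneck.bconv p q)
          + InfoBottleneck.f p q (InfoBottleneck.gInv q R)
      else 1 - InfoBottleneck.h₂ p)
      = 1 - InfoBottleneck.h₂ (InfoBottleneck.bconv p q) + InfoBottleneck.envelope p q Rc R := by
    unfold InfoBottleneck.envelope
    split_ifs <;> ring
  rw [hvalue]
  refine IsGreatest.isLUB ⟨?_, ?_⟩
  · have := InfoBottleneck.achievable_of_curve hp hq hr hθ hR hrate
    rwa [hval] at this
  · rintro m ⟨-, -, hm⟩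
    have hdom : InfoBottleneck.Dominated (InfoBottleneck.chan p q) l
        (InfoBottleneck.envelope p q Rc R - l * R
          - InfoBottleneck.h₂ (InfoBottleneck.bconv p q)) :=
      InfoBottleneck.dominated_chan hp hq fun r hr => by linarith [hsupp r hr]
    -- every margin `ε` costs at most `(1 + l) ε`
    refine le_of_forall_pos_le_add fun η hη => ?_
    obtain ⟨n₀, hn₀⟩ := hm (η / (1 + l)) (by positivity)
    obtain ⟨M, enc, hM, hrel⟩ := hn₀ (n₀ + 1) (Nat.lt_succ_self _)
    have hMpos : 0 < M := (enc fun _ => false).pos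
    have hbound := InfoBottleneck.relevance_le hp hq hl hdom hMpos enc
    have hn : (0 : ℝ) < ((n₀ + 1 : ℕ) : ℝ) := by positivity
    generalize ((n₀ + 1 : ℕ) : ℝ) = n at *
    have h1 := mul_le_mul_of_nonneg_left hbound (one_div_pos.2 hn).le
    have h2 := mul_le_mul_of_nonneg_left hM hl
    have h3 : 1 / n * (n * (1 + (InfoBottleneck.envelope p q Rc R - l * R
        - InfoBottleneck.h₂ (InfoBottleneck.bconv p q))) + l * Real.logb 2 M)
        = 1 + (InfoBottleneck.envelope p q Rc R - l * R
        - InfoBottleneck.h₂ (InfoBottleneck.bconv p q)) + l * (1 / n * Real.logb 2 M) := by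
      field_simp
    have h4 : η / (1 + l) + l * (η / (1 + l)) = η := by field_simp
    rw [h3] at h1
    linarith
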